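/- A multimode bosonic system is a finite family of modes with frequencies $\omega_j>0$ and free Hamiltonian $H=\sum_j\omega_j\hat a_j^\dagger\hat a_j$; time translation is $\mathcal U_t(\cdot)=e^{-iHt}(\cdot)e^{iHt}$. For a system $S$ and $\omega>0$ let $F^\omega(S)$ be the subsystem of all modes of $S$ of frequency $\omega$. A Gaussian channel is a completely positive trace-preserving map that acts on first and second moments $\vec r=(\langle\hat a_j\rangle,\langle\hat a_j^\dagger\rangle)$ and $M$ by $\vec r\mapsto X\vec r+\vec d$, $M\mapsto XMX^\dagger+Y$ for some $(X,Y,\vec d)$ with $Y\ge XZ_{\rm in}X^\dagger-Z_{\rm out}$, $Z=\frac12\,\mathrm{diag}(\mathbb I,-\mathbb I)$; precisely, it multiplies the characteristic function $\chi_\rho(u)=\mathrm{Tr}[\rho\,e^{u^\dagger(\hat a,\hat a^\dagger)}]$ as $\chi_\rho(u)\mapsto\chi_\rho(X^\dagger u)\,e^{u^\dagger d-\frac12u^\dagger Yu}$, where $u=(-\xi,\bar\xi)$. A Gaussian covariant operation (GCO) is a Gaussian channel $\mathcal E$ with $\mathcal E\circ\mathcal U_t^{\rm in}=\mathcal U_t^{\rm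 out}\circ\mathcal E$ for all $t\in\mathbb R$. A state is symmetric if it is invariant under all $\mathcal U_t$. **Proposition.** Let $\mathcal E$ be a GCO from a system $I$ with finitely many modes to a system $O$ with finitely many modes, with arbitrary positive frequencies. Then $\mathcal E=\mathcal E_3\circ\mathcal E_2\circ\mathcal E_1$ for three GCOs $\mathcal E_1,\mathcal E_2,\mathcal E_3$ such that 1. $\mathcal E_1$ is the partial trace over all input modes whose frequency $\omega$ satisfies $F^\omega(O)=\emptyset$; 2. $\mathcal E_2=\bigoplus_\omega\mathcal E_\omega$, over all $\omega$ with $F^\omega(I)\neq\emptyset$ and $F^\omega(O)\neq\emptyset$, where each $\mathcal E_\omega$ is a GCO from $F^\omega(I)$ to $F^\omega(O)$ (a direct sum on phase space, that is, the tensor product of the channels $\mathcal E_\omega$); 3. $\mathcal E_3(\rho)=\rho\otimes\bigotimes_\omega\sigma_\omega$, over all $\omega$ with $F^\omega(O)\neq\emptyset$ and $F^\omega(I)=\emptyset$, where each $\sigma_\omega$ is a fixed symmetric Gaussian state of $F^\omega(O)$, independent of the input. -/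

import Mathlib

open scoped ComplexOrder ComplexConjugate Matrix

noncomputable section

namespace Bosonic

/-! ### Operators on the Fock space of a finite family of bosonic modes

A system has a finite type `I` of modes; its Hilbert space is `ℓ²(I → ℕ)`, with orthonormal basis the
number states `|n⟩`, `n : I → ℕ`.  Operators are written as matrices in the number basis. -/

/-- Matrices `⟨n|A|m⟩` in the number basis of the Fock space of the modes `I`. -/
abbrev Op (I : Type*) := Matrix (I → ℕ) (I → ℕ) ℂ

/-- A density operator: positive semidefinite with trace `1`.  (A positive semidefinite infinite matrix
with summable diagonal is the matrix of a unique positive trace-class operator.) -/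
structure DensityOp (I : Type*) where
  toOp : Op I
  posSemidef : toOp.PosSemidef
  hasSum_diag : HasSum (fun n => toOp n n) 1

/-- The trace-class operators, i.e. the linear span of the density operators. -/
def traceClass (I : Type*) : Submodule ℂ (Op I) :=
  Submodule.span ℂ (Set.range DensityOp.toOp)

/-- The trace (an absolutely convergent sum on trace-class operators). -/
def opTrace {I : Type*} (A : Op I) : ℂ := ∑' n, A n n

/-! ### Time translation -/

/-- The eigenvalue on `|n⟩` of the free Hamiltonian `H = ∑ j, ω j • a_j† a_j`. -/
def energy {I : Type*} [Fintype I] (ω : I → ℝ) (n : I → ℕ) : ℝ := ∑ j, ω j * n j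

/-- The matrix of `e^{-iHt} A e^{iHt}`. -/
def evolveOp {I : Type*} [Fintype I] (ω : I → ℝ) (t : ℝ) : Op I →ₗ[ℂ] Op I where
  toFun A := Matrix.of fun n m =>
    Complex.exp (-(Complex.I * energy ω n * t)) * A n m * Complex.exp (Complex.I * energy ω m * t)
  map_add' A B := by ext n m; simp only [Matrix.of_apply, Matrix.add_apply]; ring
  map_smul' c A := by
    ext n m; simp only [Matrix.of_apply, Matrix.smul_apply, smul_eq_mul, RingHom.id_apply]; ring

theorem evolveOp_apply {I : Type*} [Fintype I] (ω : I → ℝ) (t : ℝ) (A : Op I) (n m : I → ℕ) :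
    evolveOp ω t A n m = Complex.exp (-(Complex.I * energy ω n * t)) * A n m *
      Complex.exp (Complex.I * energy ω m * t) := rfl

theorem conj_phase (x t : ℝ) :
    conj (Complex.exp (Complex.I * x * t)) = Complex.exp (-(Complex.I * x * t)) := by
  rw [← Complex.exp_conj]
  simp

/-- Time translation maps density operators to density operators. -/
def DensityOp.evolve {I : Type*} [Fintype I] (ω : I → ℝ) (t : ℝ) (ρ : DensityOp I) :
    DensityOp I where
  toOp := evolveOp ω t ρ.toOp
  posSemidef := by
    refine ⟨?_, fun x => ?_⟩
    · ext n m
      have h : conj (ρ.toOp m n) = ρ.toOp n m := ρ.posSemidef.1.apply n m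
      simp only [evolveOp_apply, Matrix.conjTranspose_apply, Complex.star_def, map_mul, h, conj_phase]
      rw [← conj_phase (energy ω m), Complex.conj_conj]
      ring
    · let y : (I → ℕ) →₀ ℂ := Finsupp.onFinset x.support
        (fun n => x n * Complex.exp (Complex.I * energy ω n * t))
        (fun n hn => Finsupp.mem_support_iff.2 (left_ne_zero_of_mul hn))
      have hy : ∀ n, y n = x n * Complex.exp (Complex.I * energy ω n * t) := fun n => rfl
      have hs : y.support = x.support := by
        ext n
        simp [Finsupp.mem_support_iff, hy]
      have h := ρ.posSemidef.2 y
      simp only [Finsupp.sum, hs, hy] at h ⊢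
      refine h.trans_eq (Finset.sum_congr rfl fun n _ => Finset.sum_congr rfl fun m _ => ?_)
      simp only [evolveOp_apply, Complex.star_def, map_mul, conj_phase]
      ring
  hasSum_diag := by
    have h : (fun n => evolveOp ω t ρ.toOp n n) = fun n => ρ.toOp n n := by
      funext n
      rw [evolveOp_apply, mul_right_comm, ← Complex.exp_add]
      simp
    rw [h]
    exact ρ.hasSum_diag

theorem evolveOp_mem {I : Type*} [Fintype I] (ω : I → ℝ) (t : ℝ) :
    ∀ A ∈ traceClass I, evolveOp ω t A ∈ traceClass I := by
  intro A hA
  induction hA using Submodule.span_induction with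
  | mem x hx =>
    obtain ⟨ρ, rfl⟩ := hx
    exact Submodule.subset_span ⟨ρ.evolve ω t, rfl⟩
  | zero => simp
  | add x y _ _ hx hy => rw [map_add]; exact add_mem hx hy
  | smul c x _ hx => rw [map_smul]; exact Submodule.smul_mem _ _ hx

/-- The time translation `𝒰_t(A) = e^{-iHt} A e^{iHt}` on trace-class operators. -/
def evolve {I : Type*} [Fintype I] (ω : I → ℝ) (t : ℝ) : traceClass I →ₗ[ℂ] traceClass I :=
  (evolveOp ω t).restrict (evolveOp_mem ω t)

/-- A symmetric state: one that is invariant under time translation. -/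
def DensityOp.IsSymmetric {I : Type*} [Fintype I] (ω : I → ℝ) (σ : DensityOp I) : Prop :=
  ∀ t : ℝ, evolveOp ω t σ.toOp = σ.toOp

/-! ### Quantum channels -/

/-- The operator on `ℂ^k ⊗ (Fock space)` with blocks `B a b`. -/
def blockOp {I : Type*} {k : ℕ} (B : Fin k → Fin k → traceClass I) :
    Matrix (Fin k × (I → ℕ)) (Fin k × (I → ℕ)) ℂ :=
  fun p q => (B p.1 q.1 : Op I) p.2 q.2

/-- A quantum channel (Schrödinger picture) from the modes `I` to the modes `O`: a completely positive
trace-preserving linear map between the spaces of trace-class operators. -/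
structure Channel (I O : Type*) where
  toLin : traceClass I →ₗ[ℂ] traceClass O
  trace_preserving : ∀ A : traceClass I, opTrace (toLin A : Op O) = opTrace (A : Op I)
  completely_positive : ∀ (k : ℕ) (B : Fin k → Fin k → traceClass I),
    (blockOp B).PosSemidef → (blockOp fun a b => toLin (B a b)).PosSemidef

/-! ### Gaussian states and Gaussian channels -/

/-- The matrix element `⟨m|D(z)|n⟩` of the one-mode displacement operator
`D(z) = exp (z a† - conj z a) = e^{-|z|²/2} e^{z a†} e^{-conj z a}`, as the sum over `k` of
`⟨m|e^{z a†}|k⟩⟨k|e^{-conj z a}|n⟩`. -/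
def dispEntry (z : ℂ) (m n : ℕ) : ℂ :=
  (Real.exp (-‖z‖ ^ 2 / 2) : ℂ) * ∑ k ∈ Finset.range (min m n + 1),
    ((Real.sqrt (m.factorial / k.factorial) : ℂ) * z ^ (m - k) / (m - k).factorial) *
      ((Real.sqrt (n.factorial / k.factorial) : ℂ) * (-conj z) ^ (n - k) / (n - k).factorial)

/-- The displacement operator `D(ξ) = exp (∑ j, (ξ j a_j† - conj (ξ j) a_j))`. -/
def disp {I : Type*} [Fintype I] (ξ : I → ℂ) : Op I := fun m n => ∏ j, dispEntry (ξ j) (m j) (n j)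

/-- The characteristic function `ξ ↦ Tr[A D(ξ)]` of a trace-class operator. -/
def charFun {I : Type*} [Fintype I] (A : Op I) (ξ : I → ℂ) : ℂ :=
  ∑' n, ∑' m, A n m * disp ξ m n

/-- Phase-space vectors are written in the doubled form `(⟨a_j⟩, ⟨a_j†⟩)`; in these coordinates
`∑ j, (ξ j a_j† - conj (ξ j) a_j) = (dbl ξ)† (a, a†)`. -/
def dbl {I : Type*} (ξ : I → ℂ) : I ⊕ I → ℂ := Sum.elim (fun j => -ξ j) (fun j => conj (ξ j))

/-- A doubled matrix sends doubled vectors `(α, conj α)` to doubled vectors. -/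
def IsDoubled {I O : Type*} (X : Matrix (O ⊕ O) (I ⊕ I) ℂ) : Prop :=
  ∀ a b, X (Sum.swap a) (Sum.swap b) = conj (X a b)

/-- A doubled vector, of the form `(α, conj α)`. -/
def IsDoubledVec {I : Type*} (r : I ⊕ I → ℂ) : Prop := ∀ a, r (Sum.swap a) = conj (r a)

/-- The matrix `Z = ½ diag(𝟙, -𝟙)`. -/
def Zmat (I : Type*) [DecidableEq I] : Matrix (I ⊕ I) (I ⊕ I) ℂ :=
  Matrix.fromBlocks ((1 / 2 : ℂ) • 1) 0 0 (-((1 / 2 : ℂ) • 1))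

/-- The Gaussian function `exp (u† r - ½ u† M u)` with `u = dbl ξ`; for an operator with first moments
`r` and (symmetrized) second moments `M` it is the Gaussian characteristic function. -/
def gaussFun {I : Type*} [Fintype I] (r : I ⊕ I → ℂ) (M : Matrix (I ⊕ I) (I ⊕ I) ℂ) (ξ : I → ℂ) : ℂ :=
  Complex.exp (star (dbl ξ) ⬝ᵥ r - 1 / 2 * (star (dbl ξ) ⬝ᵥ M *ᵥ dbl ξ))

/-- A Gaussian state: its characteristic function is Gaussian, with first moments `r` and second
moments `M` (subject to the uncertainty relation `M + Z ≥ 0`). -/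
def DensityOp.IsGaussian {I : Type*} [Fintype I] [DecidableEq I] (ρ : DensityOp I) : Prop :=
  ∃ (r : I ⊕ I → ℂ) (M : Matrix (I ⊕ I) (I ⊕ I) ℂ),
    IsDoubledVec r ∧ IsDoubled M ∧ M.IsHermitian ∧ (M + Zmat I).PosSemidef ∧
      ∀ ξ, charFun ρ.toOp ξ = gaussFun r M ξ

/-- The displacement parameter `ξ'` with `dbl ξ' = X† (dbl ξ)`. -/
def pullback {I O : Type*} [Fintype O] (X : Matrix (O ⊕ O) (I ⊕ I) ℂ) (ξ : O → ℂ) : I → ℂ :=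
  fun j => -(Xᴴ *ᵥ dbl ξ) (Sum.inl j)

/-- The channel `E` is the Gaussian channel with tuple `(X, Y, d)`: it acts on phase space as
`r ↦ X r + d`, `M ↦ X M X† + Y`, i.e. on the characteristic function of *every* input by
`χ(u) ↦ χ(X† u) exp (u† d - ½ u† Y u)`, and `Y ≥ X Z_in X† - Z_out`. -/
structure Channel.HasTuple {I O : Type*} [Fintype I] [DecidableEq I] [Fintype O] [DecidableEq O]
    (E : Channel I O) (X : Matrix (O ⊕ O) (I ⊕ I) ℂ) (Y : Matrix (O ⊕ O) (O ⊕ O) ℂ)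
    (d : O ⊕ O → ℂ) : Prop where
  doubled_X : IsDoubled X
  doubled_Y : IsDoubled Y
  doubled_d : IsDoubledVec d
  hermitian_Y : Y.IsHermitian
  uncertainty : (Y - (X * Zmat I * Xᴴ - Zmat O)).PosSemidef
  charFun_eq : ∀ (A : traceClass I) (ξ : O → ℂ),
    charFun (E.toLin A : Op O) ξ = charFun (A : Op I) (pullback X ξ) * gaussFun d Y ξ

/-- A Gaussian channel. -/
def Channel.IsGaussian {I O : Type*} [Fintype I] [DecidableEq I] [Fintype O] [DecidableEq O]
    (E : Channel I O) : Prop :=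
  ∃ X Y d, E.HasTuple X Y d

/-- A Gaussian covariant operation (GCO) between modes of frequencies `ωI` and modes of
frequencies `ωO`: a Gaussian channel with `E ∘ 𝒰_t^in = 𝒰_t^out ∘ E` for all `t`. -/
structure IsGCO {I O : Type*} [Fintype I] [DecidableEq I] [Fintype O] [DecidableEq O]
    (ωI : I → ℝ) (ωO : O → ℝ) (E : Channel I O) : Prop where
  gaussian : E.IsGaussian
  covariant : ∀ t : ℝ, E.toLin ∘ₗ evolve ωI t = evolve ωO t ∘ₗ E.toLin

/-! ### Frequency subsystems -/

/-- `F^w`: the subsystem of all modes of frequency `w`. -/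
abbrev Sector {I : Type*} (ω : I → ℝ) (w : ℝ) := {j : I // ω j = w}

/-- The subsystem of all modes whose frequency lies in `W`. -/
abbrev ModesIn {I : Type*} (ω : I → ℝ) (W : Finset ℝ) := {j : I // ω j ∈ W}

/-- The frequencies of the modes of `F^w` (all equal to `w`). -/
def sectorFreq {I : Type*} (ω : I → ℝ) (w : ℝ) : Sector ω w → ℝ := fun j => ω j.1

/-- The frequencies of the modes whose frequency lies in `W`. -/
def modesFreq {I : Type*} (ω : I → ℝ) (W : Finset ℝ) : ModesIn ω W → ℝ := fun j => ω j.1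

/-- The frequencies that occur both in the input and in the output. -/
def commonFreq {I O : Type*} [Fintype I] [Fintype O] (ωI : I → ℝ) (ωO : O → ℝ) : Finset ℝ :=
  Finset.univ.image ωI ∩ Finset.univ.image ωO

/-- The frequencies that occur in the output but not in the input. -/
def newFreq {I O : Type*} [Fintype I] [Fintype O] (ωI : I → ℝ) (ωO : O → ℝ) : Finset ℝ :=
  Finset.univ.image ωO \ Finset.univ.image ωI

/-- Restriction of occupation numbers to the modes of frequency `w`. -/
def restrictSector {I : Type*} {ω : I → ℝ} {W : Finset ℝ} (w : W) (n : ModesIn ω W → ℕ) :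
    Sector ω w → ℕ :=
  fun j => n ⟨j.1, by rw [j.2]; exact w.2⟩

/-- Restriction of occupation numbers to the modes whose frequency lies in `W`. -/
def restrictModes {I : Type*} (ω : I → ℝ) (W : Finset ℝ) (n : I → ℕ) : ModesIn ω W → ℕ :=
  fun j => n j.1

/-- The tensor product `⨂ w ∈ W, A w` of operators on the subsystems `F^w`. -/
def sectorProduct {I : Type*} (ω : I → ℝ) (W : Finset ℝ) (A : ∀ w : W, Op (Sector ω w)) :
    Op (ModesIn ω W) :=
  fun n m => ∏ w : W, A w (restrictSector w n) (restrictSector w m)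

/-- The partial trace over all modes whose frequency does not lie in `W`. -/
def partialTrace {I : Type*} (ω : I → ℝ) (W : Finset ℝ) (A : Op I) : Op (ModesIn ω W) :=
  fun n m => ∑' k : {j : I // ω j ∉ W} → ℕ,
    A (fun j => if h : ω j ∈ W then n ⟨j, h⟩ else k ⟨j, h⟩)
      (fun j => if h : ω j ∈ W then m ⟨j, h⟩ else k ⟨j, h⟩)

/-- `E` traces out exactly the modes whose frequency does not lie in `W`. -/
def Channel.IsPartialTrace {I : Type*} {ω : I → ℝ} {W : Finset ℝ}
    (E : Channel I (ModesIn ω W)) : Prop :=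
  ∀ A : traceClass I, (E.toLin A : Op (ModesIn ω W)) = partialTrace ω W A

/-- `E = ⨁ w ∈ W, F w`: the modes of each frequency `w ∈ W` undergo `F w`, independently of the others
(on the Hilbert space this is the tensor product of the channels `F w`, on phase space their direct
sum).  The product operators span a dense subspace, so this determines `E`. -/
def Channel.IsDirectSum {I O : Type*} {ωI : I → ℝ} {ωO : O → ℝ} {W : Finset ℝ}
    (E : Channel (ModesIn ωI W) (ModesIn ωO W))
    (F : ∀ w : W, Channel (Sector ωI w) (Sector ωO w)) : Prop :=
  ∀ A : ∀ w : W, traceClass (Sector ωI w),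
    ∃ B : traceClass (ModesIn ωI W),
      (B : Op (ModesIn ωI W)) = sectorProduct ωI W (fun w => (A w : Op (Sector ωI w))) ∧
      (E.toLin B : Op (ModesIn ωO W)) =
        sectorProduct ωO W (fun w => ((F w).toLin (A w) : Op (Sector ωO w)))

/-- `E(ρ) = ρ ⊗ ⨂ w ∈ V, σ w`: `E` leaves the modes with frequency in `W` alone and appends the fixed
states `σ w` on the modes of each frequency `w ∈ V`. -/
def Channel.Appends {O : Type*} {ω : O → ℝ} {W V : Finset ℝ} (E : Channel (ModesIn ω W) O)
    (σ : ∀ w : V, DensityOp (Sector ω w)) : Prop :=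
  ∀ (A : traceClass (ModesIn ω W)) (n m : O → ℕ),
    (E.toLin A : Op O) n m =
      (A : Op (ModesIn ω W)) (restrictModes ω W n) (restrictModes ω W m) *
        sectorProduct ω V (fun w => (σ w).toOp) (restrictModes ω V n) (restrictModes ω V m)

end Bosonic

end

open Bosonic

noncomputable section
namespace Bosonic

/-! ### Sums over product types -/

/-! Everything is read off characteristic functions. Time translation rotates their argument, so
covariance says that χ_A(R_t X†u) g(u) = χ_A(X†R_t u) g(R_t u) for every trace-class A, where g is
the Gaussian factor of the channel. The probes |0⟩⟨0| and |0⟩⟨1_j| already separate phase-space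
points, hence X† intertwines the two rotations and g is rotation invariant
(`rotate_pullback_and_gaussFun`). Scaling u by real numbers and comparing exponents shows that d and
Y are invariant separately. The rotations are diagonal with phases e^{±iωt}, so a nonzero entry of X
or Y joins coordinates of equal signed frequency, and d lives on signed frequency zero. Since all
frequencies are positive, d = 0 and the tuple is block diagonal in the frequency (`pullback_congr`,
`gaussFun_eq_prod`).

The factors are not built from the blocks of the tuple, which would require showing that a tuple
with the uncertainty relation comes from a completely positive map. They are compressions of the
given channel: the second step and each of its summands put the vacuum into the other input modes,
apply the channel and trace out the other output modes (`Channel.reduce`); the appended states are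
marginals of the image of the vacuum (`Channel.prepared`). Complete positivity, Gaussianity,
covariance and symmetry are then inherited. What remains are identities of characteristic functions,
and these follow from the block structure.

Passing back to operators needs injectivity of the characteristic function (`eq_of_charFun_eq`).
Integrated against (conj z)^p z^q e^{-|z|²/2}, the displacement entries form a triangular array with
nonzero corner: the bare Gaussian weight gives π|0⟩⟨0|, and each further factor acts through a
ladder relation. The matrix entries of an operator with vanishing characteristic function therefore
vanish one after another. Exchanging sums and integrals rests on a bound uniform in ξ
(`exists_charFun_bound`), which holds because displacement matrices have orthonormal columns and so
are contractions. -/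

theorem hasSum_pi_prod_option {α : Type*} [Fintype α] {κ : Option α → Type*}
    {f : ∀ i, κ i → ℂ} {s : Option α → ℂ} (h0 : HasSum (f none) (s none))
    (h1 : HasSum (fun k : ∀ a, κ (some a) => ∏ a, f (some a) (k a)) (∏ a, s (some a))) :
    HasSum (fun k : ∀ i, κ i => ∏ i, f i (k i)) (∏ i, s i) := by
  rw [← (Equiv.piOptionEquivProd (β := κ)).symm.hasSum_iff]
  set g : (∀ a, κ (some a)) → ℂ := fun k => ∏ a, f (some a) (k a) with hg
  have hs : Summable fun x : κ none × (∀ a, κ (some a)) => f none x.1 * g x.2 :=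
    summable_mul_of_summable_norm h0.summable.norm h1.summable.norm
  have h3 := h0.mul h1 hs
  rw [Fintype.prod_option]
  convert! h3 using 1
  funext k
  simp [Fintype.prod_option, Equiv.piOptionEquivProd, hg]

theorem hasSum_pi_prod_equiv {α β : Type*} [Fintype α] [Fintype β] (e : α ≃ β) {κ : β → Type*}
    {f : ∀ i, κ i → ℂ} {s : β → ℂ}
    (h : HasSum (fun k : ∀ a, κ (e a) => ∏ a, f (e a) (k a)) (∏ a, s (e a))) :
    HasSum (fun k : ∀ i, κ i => ∏ i, f i (k i)) (∏ i, s i) := by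
  rw [← (Equiv.piCongrLeft κ e).hasSum_iff, ← e.prod_comp]
  convert! h using 1
  funext k
  rw [Function.comp_apply, ← e.prod_comp]
  simp only [Equiv.piCongrLeft_apply_apply]


/-- A finite product of convergent series is the series of the products over the product type. -/
theorem hasSum_pi_prod.{u, v} {ι : Type u} [Fintype ι] {κ : ι → Type v} (f : ∀ i, κ i → ℂ) (s : ι → ℂ)
    (h : ∀ i, HasSum (f i) (s i)) : HasSum (fun k : ∀ i, κ i => ∏ i, f i (k i)) (∏ i, s i) := by
  have key := Fintype.induction_empty_option (P := fun ι _ => ∀ (κ : ι → Type v)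
    (f : ∀ i, κ i → ℂ) (s : ι → ℂ), (∀ i, HasSum (f i) (s i)) →
      HasSum (fun k : ∀ i, κ i => ∏ i, f i (k i)) (∏ i, s i)) ?_ ?_ ?_ ι
  · exact key κ f s h
  · intro α β _ e ih κ f s h
    let _ := Fintype.ofEquiv β e.symm
    exact hasSum_pi_prod_equiv e (ih _ _ _ fun a => h (e a))
  · intro κ f s _
    simp only [Finset.univ_eq_empty, Finset.prod_empty]
    exact hasSum_unique (fun _ : ∀ i, κ i => (1 : ℂ))
  · intro α _ ih κ f s h
    exact hasSum_pi_prod_option (h none) (ih _ _ _ fun a => h (some a))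
/-! ### Positive semidefinite matrices over infinite index types -/

theorem posSemidef_vecMulVec {ι : Type*} (v : ι → ℂ) :
    (Matrix.vecMulVec v (star v)).PosSemidef := by
  refine ⟨?_, fun x => ?_⟩
  · ext i j
    simp [Matrix.conjTranspose_apply, Matrix.vecMulVec_apply, mul_comm]
  · have : (x.sum fun i xi => x.sum fun j xj =>
        star xi * Matrix.vecMulVec v (star v) i j * xj) =
        star (x.sum fun i xi => star (v i) * xi) * x.sum fun i xi => star (v i) * xi := by
      simp only [Finsupp.sum, star_sum, Finset.sum_mul_sum, Matrix.vecMulVec_apply, star_mul,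
        star_star, Pi.star_apply]
      exact Finset.sum_congr rfl fun i _ => Finset.sum_congr rfl fun j _ => by ring
    rw [this]
    exact star_mul_self_nonneg _

/-- Each quadratic form involves only finitely many entries, so positivity survives entrywise
convergence. This gives positivity, and complete positivity, of partial traces. -/
theorem posSemidef_of_hasSum {ι κ : Type*} {M : κ → Matrix ι ι ℂ} {L : Matrix ι ι ℂ}
    (h : ∀ k, (M k).PosSemidef) (hs : ∀ i j, HasSum (fun k => M k i j) (L i j)) :
    L.PosSemidef := by
  refine ⟨?_, fun x => ?_⟩
  · ext i j
    rw [Matrix.conjTranspose_apply]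
    refine (hs j i).star.unique ?_
    convert! hs i j using 2 with k
    exact (h k).1.apply i j
  · have : HasSum (fun k => x.sum fun i xi => x.sum fun j xj => star xi * M k i j * xj)
        (x.sum fun i xi => x.sum fun j xj => star xi * L i j * xj) := by
      simp only [Finsupp.sum]
      exact hasSum_sum fun i _ => hasSum_sum fun j _ => ((hs i j).mul_left _).mul_right _
    exact this.nonneg fun k => (h k).2 x

/-- The 2 × 2 minor on rows and columns n, m is nonnegative; the case n = m needs no separate
treatment. -/
theorem _root_.Matrix.PosSemidef.norm_sq_le {ι : Type*} {A : Matrix ι ι ℂ} (hA : A.PosSemidef)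
    (n m : ι) : ‖A n m‖ ^ 2 ≤ (A n n).re * (A m m).re := by
  have h := (hA.submatrix ![n, m]).det_nonneg
  have hn : ∀ k, A k k = ((A k k).re : ℂ) := fun k =>
    (Complex.conj_eq_iff_re.1 (hA.1.apply k k)).symm
  have hmn : A m n = conj (A n m) := (hA.1.apply m n).symm
  rw [Matrix.det_fin_two] at h
  simp only [Matrix.submatrix_apply, Matrix.cons_val_zero, Matrix.cons_val_one] at h
  rw [hmn, Complex.mul_conj, hn n, hn m, Complex.normSq_eq_norm_sq] at h
  have h2 : (0 : ℂ) ≤ (((A n n).re * (A m m).re - ‖A n m‖ ^ 2 : ℝ) : ℂ) := by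
    push_cast at h ⊢
    exact h
  have := Complex.zero_le_real.1 h2
  linarith

theorem _root_.Matrix.PosSemidef.re_diag_nonneg {ι : Type*} {A : Matrix ι ι ℂ}
    (hA : A.PosSemidef) (n : ι) : 0 ≤ (A n n).re :=
  (Complex.nonneg_iff.1 hA.diag_nonneg).1

/-- The matrix `D` is a contraction from finitely supported vectors to `ℓ²`. -/
def IsContraction {ι : Type*} (D : ι → ι → ℂ) : Prop :=
  ∀ (S T : Finset ι) (v : ι → ℂ), ∑ n ∈ S, ‖∑ m ∈ T, v m * D m n‖ ^ 2 ≤ ∑ m ∈ T, ‖v m‖ ^ 2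

/-- A finite form of |Tr(AD)| ≤ Tr A for a contraction D. On the finite set S ∪ T one has A = B*B,
and each row b of B contributes terms of the form conj(b n) · (bD) n; the squares of the second
factors are controlled by the contraction property. -/
theorem _root_.Matrix.PosSemidef.sum_norm_le {ι : Type*} [DecidableEq ι] {A : Matrix ι ι ℂ}
    (hA : A.PosSemidef) {D : ι → ι → ℂ} (hD : IsContraction D) (S T : Finset ι) :
    ∑ n ∈ S, ‖∑ m ∈ T, A n m * D m n‖ ≤ ∑ n ∈ S ∪ T, (A n n).re := by
  set U := S ∪ T with hU
  obtain ⟨B, hB⟩ : ∃ B : Matrix U U ℂ, A.submatrix ((↑) : U → ι) (↑) = star B * B := by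
    open scoped MatrixOrder in
    exact CStarAlgebra.nonneg_iff_eq_star_mul_self.1
      (Matrix.nonneg_iff_posSemidef.2 (hA.submatrix ((↑) : U → ι)))
  let b : U → ι → ℂ := fun k n => if h : n ∈ U then B k ⟨n, h⟩ else 0
  have hb : ∀ n ∈ U, ∀ m ∈ U, A n m = ∑ k, conj (b k n) * b k m := by
    intro n hn m hm
    have := congrFun (congrFun hB ⟨n, hn⟩) ⟨m, hm⟩
    simpa [b, hn, hm, Matrix.mul_apply, Matrix.star_apply] using this
  have hdiag : ∀ n ∈ U, (A n n).re = ∑ k, ‖b k n‖ ^ 2 := by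
    intro n hn
    have : A n n = ((∑ k, ‖b k n‖ ^ 2 : ℝ) : ℂ) := by
      rw [hb n hn n hn]
      push_cast
      exact Finset.sum_congr rfl fun k _ => Complex.conj_mul' _
    rw [this, Complex.ofReal_re]
  have hS : S ⊆ U := Finset.subset_union_left
  have hT : T ⊆ U := Finset.subset_union_right
  have hmono : ∀ V ⊆ U, ∑ n ∈ V, ∑ k, ‖b k n‖ ^ 2 ≤ ∑ n ∈ U, ∑ k, ‖b k n‖ ^ 2 := fun V hV =>
    Finset.sum_le_sum_of_subset_of_nonneg hV fun _ _ _ => by positivity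
  rw [Finset.sum_congr rfl hdiag]
  calc ∑ n ∈ S, ‖∑ m ∈ T, A n m * D m n‖
      -- Here |xy| ≤ (x² + y²)/2 replaces Cauchy–Schwarz.
      ≤ ∑ n ∈ S, ∑ k, (‖b k n‖ ^ 2 + ‖∑ m ∈ T, b k m * D m n‖ ^ 2) / 2 := by
        refine Finset.sum_le_sum fun n hn => ?_
        have : ∑ m ∈ T, A n m * D m n = ∑ k, conj (b k n) * ∑ m ∈ T, b k m * D m n := by
          simp_rw [Finset.mul_sum]
          rw [Finset.sum_comm]
          refine Finset.sum_congr rfl fun m hm => ?_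
          rw [hb n (hS hn) m (hT hm), Finset.sum_mul]
          exact Finset.sum_congr rfl fun k _ => mul_assoc _ _ _
        rw [this]
        refine (norm_sum_le _ _).trans (Finset.sum_le_sum fun k _ => ?_)
        rw [norm_mul, RCLike.norm_conj]
        nlinarith [sq_nonneg (‖b k n‖ - ‖∑ m ∈ T, b k m * D m n‖)]
    _ = (∑ n ∈ S, ∑ k, ‖b k n‖ ^ 2 + ∑ k, ∑ n ∈ S, ‖∑ m ∈ T, b k m * D m n‖ ^ 2) / 2 := by
        rw [Finset.sum_comm (s := Finset.univ), ← Finset.sum_add_distrib, Finset.sum_div]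
        refine Finset.sum_congr rfl fun n _ => ?_
        rw [← Finset.sum_add_distrib, Finset.sum_div]
    _ ≤ (∑ n ∈ U, ∑ k, ‖b k n‖ ^ 2 + ∑ k, ∑ m ∈ T, ‖b k m‖ ^ 2) / 2 := by
        have h1 := hmono S hS
        have h2 := Finset.sum_le_sum fun (k : U) (_ : k ∈ Finset.univ) => hD S T (b k)
        linarith
    _ ≤ ∑ n ∈ U, ∑ k, ‖b k n‖ ^ 2 := by
        have h1 := hmono T hT
        rw [Finset.sum_comm] at h1
        linarith

/-! ### Trace-class operators -/

variable {I : Type*}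

theorem DensityOp.hasSum_re (ρ : DensityOp I) : HasSum (fun n => (ρ.toOp n n).re) 1 :=
  Complex.hasSum_re ρ.hasSum_diag

theorem DensityOp.mem_traceClass (ρ : DensityOp I) : ρ.toOp ∈ traceClass I :=
  Submodule.subset_span ⟨ρ, rfl⟩

/-- A normalizable positive operator is trace class. -/
theorem mem_traceClass_of_posSemidef {A : Op I} (hA : A.PosSemidef)
    (hs : Summable fun n => A n n) : A ∈ traceClass I := by
  have hre : ∀ n, A n n = ((A n n).re : ℂ) := fun n =>
    (Complex.conj_eq_iff_re.1 (hA.1.apply n n)).symm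
  have hsre : Summable fun n => (A n n).re := (Complex.hasSum_re hs.hasSum).summable
  set t := ∑' n, (A n n).re with ht
  -- A positive operator of trace 0 has zero diagonal, hence is zero; any other one is its trace
  -- times a state.
  rcases eq_or_ne t 0 with h0 | h0
  · have hz : ∀ n, (A n n).re = 0 := fun n =>
      congrFun ((hasSum_zero_iff_of_nonneg fun n => hA.re_diag_nonneg n).1 (by simpa [← ht, h0] using hsre.hasSum)) n
    have : A = 0 := by
      ext n m
      have := hA.norm_sq_le n m
      rw [hz n, zero_mul] at this
      simpa using this
    rw [this]
    exact zero_mem _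
  · have htpos : 0 < t := lt_of_le_of_ne (tsum_nonneg fun n => hA.re_diag_nonneg n) h0.symm
    let ρ : DensityOp I :=
      { toOp := ((t⁻¹ : ℝ) : ℂ) • A
        posSemidef := hA.smul (Complex.zero_le_real.2 (by positivity))
        hasSum_diag := by
          have h1 : HasSum (fun n => ((A n n).re : ℂ)) (t : ℂ) :=
            Complex.hasSum_ofReal.2 hsre.hasSum
          have h2 := h1.mul_left ((t⁻¹ : ℝ) : ℂ)
          have : (((t⁻¹ : ℝ) : ℂ) * t) = 1 := by
            rw [← Complex.ofReal_mul, inv_mul_cancel₀ h0, Complex.ofReal_one]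
          rw [this] at h2
          convert! h2 using 2 with n
          rw [Matrix.smul_apply, smul_eq_mul, ← hre n] }
    have : A = (t : ℂ) • ρ.toOp := by
      simp only [ρ, smul_smul]
      rw [← Complex.ofReal_mul, mul_inv_cancel₀ h0, Complex.ofReal_one, one_smul]
    rw [this]
    exact Submodule.smul_mem _ _ ρ.mem_traceClass

open Classical in
/-- The matrix unit `|a⟩⟨b|`. -/
def ketBra (a b : I → ℕ) : Op I := fun n m => if n = a ∧ m = b then 1 else 0

theorem vecMulVec_mem_traceClass (v : (I → ℕ) →₀ ℂ) :
    Matrix.vecMulVec v (star v) ∈ traceClass I := by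
  refine mem_traceClass_of_posSemidef (posSemidef_vecMulVec _) ?_
  refine summable_of_ne_finset_zero (s := v.support) fun n hn => ?_
  rw [Matrix.vecMulVec_apply, Finsupp.notMem_support_iff.1 hn, zero_mul]

/-- Polarization: the rank-one operators of |a⟩ + s|b⟩ for s = 1 and s = i yield |a⟩⟨b| + |b⟩⟨a| and
-i|a⟩⟨b| + i|b⟩⟨a| after subtracting diagonal terms. -/
theorem ketBra_mem_traceClass (a b : I → ℕ) : ketBra a b ∈ traceClass I := by
  classical
  have hself : ∀ a : I → ℕ, ketBra a a ∈ traceClass I := by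
    intro a
    convert! vecMulVec_mem_traceClass (Finsupp.single a 1) using 1
    ext n m
    by_cases hn : n = a <;> by_cases hm : m = a <;>
      simp [ketBra, Matrix.vecMulVec_apply, hn, hm]
  rcases eq_or_ne a b with rfl | hab
  · exact hself a
  have hs : ∀ s : ℂ, conj s • ketBra a b + s • ketBra b a +
      (ketBra a a + (s * conj s) • ketBra b b) ∈ traceClass I := by
    intro s
    convert! vecMulVec_mem_traceClass (Finsupp.single a 1 + Finsupp.single b s) using 1
    ext n m
    have hba := hab.symm
    by_cases hn : n = a <;> by_cases hm : m = a <;> by_cases hn' : n = b <;>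
      by_cases hm' : m = b <;> subst_vars <;>
      simp_all [ketBra, Matrix.vecMulVec_apply, eq_comm]
  have h1 := sub_mem (hs 1) (add_mem (hself a) (hself b))
  have h2 := sub_mem (hs Complex.I) (add_mem (hself a) (hself b))
  have := Submodule.smul_mem _ (1 / 2 : ℂ) (add_mem h1 (Submodule.smul_mem _ Complex.I h2))
  convert! this using 1
  ext n m
  simp only [Matrix.add_apply, Matrix.sub_apply, Matrix.smul_apply, smul_eq_mul, map_one,
    Complex.conj_I]
  linear_combination ((1/2) * (ketBra a b n m - ketBra b a n m) +
    (1/2) * Complex.I * ketBra b b n m) * Complex.I_sq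

/-- The vacuum state. -/
def vacuum (I : Type*) : DensityOp I where
  toOp := ketBra 0 0
  posSemidef := by
    classical
    convert posSemidef_vecMulVec (Pi.single (0 : I → ℕ) (1 : ℂ)) using 1
    ext n m
    by_cases hn : n = 0 <;> by_cases hm : m = 0 <;>
      simp [ketBra, Matrix.vecMulVec_apply, hn, hm]
  hasSum_diag := by
    classical
    convert! hasSum_ite_eq (0 : I → ℕ) (1 : ℂ) using 2 with n
    simp [ketBra]

/-- To prove a linear property of trace-class operators it suffices to prove it for states. -/
theorem traceClass_induction {p : Op I → Prop} (density : ∀ ρ : DensityOp I, p ρ.toOp)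
    (add : ∀ A B, p A → p B → p (A + B)) (smul : ∀ (c : ℂ) A, p A → p (c • A)) {A : Op I}
    (hA : A ∈ traceClass I) : p A := by
  induction hA using Submodule.span_induction with
  | mem x hx => obtain ⟨ρ, rfl⟩ := hx; exact density ρ
  | zero => simpa using smul 0 _ (density (vacuum I))
  | add x y _ _ hx hy => exact add x y hx hy
  | smul c x _ hx => exact smul c x hx

theorem summable_diag {A : Op I} (hA : A ∈ traceClass I) : Summable fun n => A n n :=
  traceClass_induction (p := fun A => Summable fun n => A n n)
    (fun ρ => ρ.hasSum_diag.summable) (fun _ _ hA hB => hA.add hB)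
    (fun c _ hA => hA.mul_left c) hA

/-- For a state, |A n m|² is at most the product of two diagonal entries. Square-summable rows make
the inner series of `charFun` converge against columns of the displacement matrix. -/
theorem summable_row_sq {A : Op I} (hA : A ∈ traceClass I) (n : I → ℕ) :
    Summable fun m => ‖A n m‖ ^ 2 := by
  refine traceClass_induction (p := fun A => Summable fun m => ‖A n m‖ ^ 2) (fun ρ => ?_)
    (fun A B hA hB => ?_) (fun c A hA => ?_) hA
  · exact Summable.of_nonneg_of_le (fun _ => sq_nonneg _) (fun m => ρ.posSemidef.norm_sq_le n m)
      (ρ.hasSum_re.summable.mul_left _)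
  · refine Summable.of_nonneg_of_le (fun _ => sq_nonneg _) (fun m => ?_)
      ((hA.add hB).mul_left 2)
    have := norm_add_le (A n m) (B n m)
    have h0 := norm_nonneg (A n m + B n m)
    rw [Matrix.add_apply]
    nlinarith [sq_nonneg (‖A n m‖ - ‖B n m‖)]
  · simp only [Matrix.smul_apply, smul_eq_mul, norm_mul, mul_pow]
    exact hA.mul_left _

/-- A bound on the trace norm: `∑ n, |(A D)ₙₙ|` is bounded, uniformly in the contraction `D`. -/
theorem exists_traceNorm_bound {A : Op I} (hA : A ∈ traceClass I) :
    ∃ C : ℝ, ∀ D : (I → ℕ) → (I → ℕ) → ℂ, IsContraction D → ∀ S T : Finset (I → ℕ),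
      ∑ n ∈ S, ‖∑ m ∈ T, A n m * D m n‖ ≤ C := by
  classical
  refine traceClass_induction (p := fun A => ∃ C : ℝ, ∀ D : (I → ℕ) → (I → ℕ) → ℂ,
    IsContraction D → ∀ S T : Finset (I → ℕ), ∑ n ∈ S, ‖∑ m ∈ T, A n m * D m n‖ ≤ C)
    (fun ρ => ⟨1, fun D hD S T => ?_⟩) ?_ ?_ hA
  · exact (ρ.posSemidef.sum_norm_le hD S T).trans
      (sum_le_hasSum _ (fun n _ => ρ.posSemidef.re_diag_nonneg n) ρ.hasSum_re)
  · rintro A B ⟨C, hC⟩ ⟨C', hC'⟩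
    refine ⟨C + C', fun D hD S T => ?_⟩
    refine le_trans ?_ (add_le_add (hC D hD S T) (hC' D hD S T))
    rw [← Finset.sum_add_distrib]
    refine Finset.sum_le_sum fun n _ => ?_
    simp only [Matrix.add_apply, add_mul, Finset.sum_add_distrib]
    exact norm_add_le _ _
  · rintro c A ⟨C, hC⟩
    refine ⟨‖c‖ * C, fun D hD S T => ?_⟩
    refine le_trans (le_of_eq ?_) (mul_le_mul_of_nonneg_left (hC D hD S T) (norm_nonneg c))
    simp only [Matrix.smul_apply, smul_eq_mul, mul_assoc, ← Finset.mul_sum, norm_mul]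

end Bosonic
end

noncomputable section
namespace Bosonic

/-! ### Square-summable families -/

theorem summable_norm_sq_add {ι : Type*} {f g : ι → ℂ} (hf : Summable fun i => ‖f i‖ ^ 2)
    (hg : Summable fun i => ‖g i‖ ^ 2) : Summable fun i => ‖f i + g i‖ ^ 2 := by
  refine Summable.of_nonneg_of_le (fun _ => sq_nonneg _) (fun i => ?_) ((hf.add hg).mul_left 2)
  have := norm_add_le (f i) (g i)
  have h0 := norm_nonneg (f i + g i)
  nlinarith [sq_nonneg (‖f i‖ - ‖g i‖)]

theorem summable_norm_sq_const_mul {ι : Type*} {f : ι → ℂ} (c : ℂ)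
    (hf : Summable fun i => ‖f i‖ ^ 2) : Summable fun i => ‖c * f i‖ ^ 2 := by
  simp only [norm_mul, mul_pow]
  exact hf.mul_left _

theorem summable_mul_of_norm_sq {ι : Type*} {f g : ι → ℂ} (hf : Summable fun i => ‖f i‖ ^ 2)
    (hg : Summable fun i => ‖g i‖ ^ 2) : Summable fun i => f i * g i := by
  refine Summable.of_norm_bounded (hf.add hg) fun i => ?_
  rw [norm_mul]
  nlinarith [sq_nonneg (‖f i‖ - ‖g i‖), sq_nonneg ‖f i‖, sq_nonneg ‖g i‖]

/-! ### Ladder relations for the one-mode displacement operator -/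

/-- The matrix element `⟨m|e^{z a†}|k⟩`. -/
def expCreate (z : ℂ) (m k : ℕ) : ℂ :=
  m.choose k * z ^ (m - k) * (Real.sqrt k.factorial / Real.sqrt m.factorial : ℝ)

theorem sqrt_factorial_pos (n : ℕ) : 0 < Real.sqrt n.factorial :=
  Real.sqrt_pos.2 (by exact_mod_cast n.factorial_pos)

theorem sqrt_factorial_succ (n : ℕ) :
    Real.sqrt (n + 1).factorial = Real.sqrt (n + 1) * Real.sqrt n.factorial := by
  rw [Nat.factorial_succ, ← Real.sqrt_mul (by positivity)]
  push_cast
  rfl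

theorem expCreate_eq_zero {z : ℂ} {m k : ℕ} (h : m < k) : expCreate z m k = 0 := by
  simp [expCreate, Nat.choose_eq_zero_of_lt h]

theorem expCreate_of_le {z : ℂ} {m k : ℕ} (h : k ≤ m) :
    (Real.sqrt (m.factorial / k.factorial) : ℂ) * z ^ (m - k) / (m - k).factorial =
      expCreate z m k := by
  have hm := sqrt_factorial_pos m
  have hk := sqrt_factorial_pos k
  have h1 : Real.sqrt (m.factorial / k.factorial) / (m - k).factorial =
      m.choose k * (Real.sqrt k.factorial / Real.sqrt m.factorial) := by
    rw [Real.sqrt_div (by positivity), Nat.cast_choose ℝ h]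
    have hmk : ((m - k).factorial : ℝ) ≠ 0 := by positivity
    have e1 : (m.factorial : ℝ) = Real.sqrt m.factorial ^ 2 := (Real.sq_sqrt (by positivity)).symm
    have e2 : (k.factorial : ℝ) = Real.sqrt k.factorial ^ 2 := (Real.sq_sqrt (by positivity)).symm
    rw [div_div, div_mul_div_comm, e1, e2, Real.sqrt_sq hm.le, Real.sqrt_sq hk.le]
    field_simp
  have h2 := congrArg (fun x : ℝ => (x : ℂ)) h1
  push_cast at h2
  rw [expCreate, mul_div_right_comm]
  push_cast
  rw [h2]
  ring

/-- The binomial coefficient in `expCreate` vanishes beyond the cut-off, so the range may be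
lengthened freely; this is what lets sums for neighbouring indices be compared. -/
theorem dispEntry_eq_sum (z : ℂ) {m n N : ℕ} (hN : min m n < N) :
    dispEntry z m n = (Real.exp (-‖z‖ ^ 2 / 2) : ℂ) *
      ∑ k ∈ Finset.range N, expCreate z m k * expCreate (-conj z) n k := by
  rw [dispEntry]
  congr 1
  rw [← Finset.sum_subset (Finset.range_subset_range.2 (Nat.succ_le_of_lt hN))]
  · refine Finset.sum_congr rfl fun k hk => ?_
    have := Finset.mem_range.1 hk
    rw [expCreate_of_le (by omega), expCreate_of_le (by omega)]
  · intro k _ hk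
    rw [Finset.mem_range, not_lt] at hk
    rcases lt_or_ge m k with h | h
    · rw [expCreate_eq_zero h, zero_mul]
    · rw [expCreate_eq_zero (show n < k by omega), mul_zero]

theorem expCreate_succ_zero (z : ℂ) (m : ℕ) :
    (Real.sqrt (m + 1) : ℂ) * expCreate z (m + 1) 0 = z * expCreate z m 0 := by
  have h1 : (Real.sqrt (m + 1) : ℂ) ≠ 0 := by
    exact_mod_cast (Real.sqrt_pos.2 (by positivity : (0 : ℝ) < m + 1)).ne'
  have h2 : (Real.sqrt m.factorial : ℂ) ≠ 0 := by exact_mod_cast (sqrt_factorial_pos m).ne'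
  simp only [expCreate, sqrt_factorial_succ]
  push_cast
  field_simp
  simp [pow_succ, mul_comm]

/-- The relation a e^{za†} = e^{za†}(a + z) between |m⟩ and |k+1⟩, which for the coefficients is
Pascal's rule. -/
theorem expCreate_succ_succ (z : ℂ) (m k : ℕ) :
    (Real.sqrt (m + 1) : ℂ) * expCreate z (m + 1) (k + 1) =
      (Real.sqrt (k + 1) : ℂ) * expCreate z m k + z * expCreate z m (k + 1) := by
  have h1 : (Real.sqrt (m + 1) : ℂ) ≠ 0 := by
    exact_mod_cast (Real.sqrt_pos.2 (by positivity : (0 : ℝ) < m + 1)).ne'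
  have h2 : (Real.sqrt m.factorial : ℂ) ≠ 0 := by exact_mod_cast (sqrt_factorial_pos m).ne'
  have h3 : (m.choose (k + 1) : ℂ) * z ^ (m - k) = m.choose (k + 1) * (z * z ^ (m - (k + 1))) := by
    rcases le_or_gt (k + 1) m with h | h
    · rw [← pow_succ', show m - (k + 1) + 1 = m - k by omega]
    · simp [Nat.choose_eq_zero_of_lt h]
  simp only [expCreate, sqrt_factorial_succ, Nat.choose_succ_succ, Nat.add_sub_add_right]
  push_cast
  field_simp
  linear_combination h3

/-- The operators a† and e^{za†} commute. For m = 0 the factor √0 makes the truncated index m - 1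
harmless. -/
theorem sqrt_mul_expCreate_succ (z : ℂ) (m k : ℕ) :
    (Real.sqrt (k + 1) : ℂ) * expCreate z m (k + 1) = (Real.sqrt m : ℂ) * expCreate z (m - 1) k := by
  cases m with
  | zero => simp [expCreate]
  | succ m =>
    have h1 : (Real.sqrt (m + 1) : ℂ) ≠ 0 := by
      exact_mod_cast (Real.sqrt_pos.2 (by positivity : (0 : ℝ) < m + 1)).ne'
    have h2 : (Real.sqrt m.factorial : ℂ) ≠ 0 := by exact_mod_cast (sqrt_factorial_pos m).ne'
    have e1 : (Real.sqrt (m + 1) : ℂ) ^ 2 = m + 1 := by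
      rw [← Complex.ofReal_pow, Real.sq_sqrt (by positivity)]; push_cast; rfl
    have e2 : (Real.sqrt (k + 1) : ℂ) ^ 2 = k + 1 := by
      rw [← Complex.ofReal_pow, Real.sq_sqrt (by positivity)]; push_cast; rfl
    have e3 : ((m : ℂ) + 1) * m.choose k = (m + 1).choose (k + 1) * (k + 1) := by
      exact_mod_cast Nat.add_one_mul_choose_eq m k
    simp only [expCreate, sqrt_factorial_succ, Nat.add_sub_add_right, Nat.add_sub_cancel]
    push_cast
    field_simp
    rw [e1, e2]
    linear_combination (-(z ^ (m - k))) * e3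

/-- `D(z) a† = (a† - conj z) D(z)`. -/
theorem dispEntry_create (z : ℂ) (m n : ℕ) :
    (Real.sqrt (n + 1) : ℂ) * dispEntry z m (n + 1) =
      (Real.sqrt m : ℂ) * dispEntry z (m - 1) n - conj z * dispEntry z m n := by
  -- The two sums that lose their k = 0 term start one term longer, so that afterwards all three
  -- have the same range.
  rw [dispEntry_eq_sum z (N := m + n + 3) (by omega),
    dispEntry_eq_sum z (N := m + n + 3) (n := n) (m := m)
    (by omega), dispEntry_eq_sum z (N := m + n + 2) (m := m - 1) (by omega)]
  rw [Finset.sum_range_succ', Finset.sum_range_succ' (n := m + n + 2)]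
  have hterm : (Real.sqrt (n + 1) : ℂ) * ∑ k ∈ Finset.range (m + n + 2),
        expCreate z m (k + 1) * expCreate (-conj z) (n + 1) (k + 1) =
      (Real.sqrt m : ℂ) * ∑ k ∈ Finset.range (m + n + 2),
        expCreate z (m - 1) k * expCreate (-conj z) n k -
      conj z * ∑ k ∈ Finset.range (m + n + 2),
        expCreate z m (k + 1) * expCreate (-conj z) n (k + 1) := by
    simp only [Finset.mul_sum, ← Finset.sum_sub_distrib]
    refine Finset.sum_congr rfl fun k _ => ?_
    linear_combination expCreate z m (k + 1) * expCreate_succ_succ (-conj z) n k +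
      expCreate (-conj z) n k * sqrt_mul_expCreate_succ z m k
  linear_combination (Real.exp (-‖z‖ ^ 2 / 2) : ℂ) * hterm +
    (Real.exp (-‖z‖ ^ 2 / 2) : ℂ) * expCreate z m 0 * expCreate_succ_zero (-conj z) n

/-- `a D(z) = D(z) (a + z)`. -/
theorem dispEntry_annihilate (z : ℂ) (m n : ℕ) :
    (Real.sqrt (m + 1) : ℂ) * dispEntry z (m + 1) n =
      (Real.sqrt n : ℂ) * dispEntry z m (n - 1) + z * dispEntry z m n := by
  -- Transposing the matrix replaces z by -conj z, which turns the lowering relation into the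
  -- raising relation.
  have hsymm : ∀ a b, dispEntry z a b = dispEntry (-conj z) b a := by
    intro a b
    rw [dispEntry_eq_sum z (N := a + 1) (by omega), dispEntry_eq_sum _ (N := a + 1) (by omega)]
    simp [mul_comm]
  rw [hsymm, hsymm, hsymm, dispEntry_create]
  simp

theorem dispEntry_zero_right (z : ℂ) (m : ℕ) :
    dispEntry z m 0 = (Real.exp (-‖z‖ ^ 2 / 2) : ℂ) * z ^ m / (Real.sqrt m.factorial : ℂ) := by
  rw [dispEntry_eq_sum z (N := 1) (by simp)]
  simp [expCreate]
  ring

/-! ### Columns of the displacement operators are orthonormal -/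

/-- Column 0 is a coherent state, with squares summing as an exponential series. The raising
relation obtains column n + 1 from column n multiplied by √m, and the lowering relation shows that
this weighted column is still square summable. -/
theorem summable_dispEntry_sq (z : ℂ) (n : ℕ) : Summable fun m => ‖dispEntry z m n‖ ^ 2 := by
  have hshift : ∀ f : ℕ → ℂ, (Summable fun m => ‖f m‖ ^ 2) → Summable fun m => ‖f (m + 1)‖ ^ 2 :=
    fun f hf => (summable_nat_add_iff (f := fun m => ‖f m‖ ^ 2) 1).2 hf
  induction n using Nat.strong_induction_on with
  | _ n ih =>
    cases n with
    | zero =>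
      have h := (Real.summable_pow_div_factorial (‖z‖ ^ 2)).mul_left (Real.exp (-‖z‖ ^ 2 / 2) ^ 2)
      convert! h using 2 with m
      rw [dispEntry_zero_right, norm_div, norm_mul, norm_pow, Complex.norm_real, Complex.norm_real,
        Real.norm_of_nonneg (Real.exp_pos _).le, Real.norm_of_nonneg (Real.sqrt_nonneg _), div_pow,
        Real.sq_sqrt (by positivity)]
      ring
    | succ n =>
      have hn := ih n (Nat.lt_succ_self n)
      have hlow : Summable fun m => ‖(Real.sqrt n : ℂ) * dispEntry z m (n - 1)‖ ^ 2 := by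
        cases n with
        | zero => simp
        | succ n => exact summable_norm_sq_const_mul _ (ih n (by omega))
      have h1 : Summable fun m : ℕ => ‖(Real.sqrt m : ℂ) * dispEntry z m n‖ ^ 2 := by
        rw [← summable_nat_add_iff 1]
        refine (summable_norm_sq_add hlow (summable_norm_sq_const_mul z hn)).congr fun m => ?_
        rw [← dispEntry_annihilate]
        push_cast
        rfl
      have h2 : Summable fun m : ℕ => ‖(Real.sqrt (m + 1) : ℂ) * dispEntry z m n‖ ^ 2 := by
        refine (h1.add hn).congr fun m => ?_
        rw [norm_mul, norm_mul, mul_pow, mul_pow, Complex.norm_real, Complex.norm_real,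
          Real.norm_of_nonneg (Real.sqrt_nonneg _), Real.norm_of_nonneg (Real.sqrt_nonneg _),
          Real.sq_sqrt (by positivity), Real.sq_sqrt (by positivity)]
        ring
      have h3 : Summable fun m : ℕ => ‖(Real.sqrt (n + 1) : ℂ) * dispEntry z m (n + 1)‖ ^ 2 := by
        rw [← summable_nat_add_iff 1]
        have := summable_norm_sq_add h2 (summable_norm_sq_const_mul (-conj z) (hshift _ hn))
        refine this.congr fun m => ?_
        rw [dispEntry_create]
        simp [sub_eq_add_neg]
      have hne : (Real.sqrt (n + 1) : ℂ) ≠ 0 := by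
        exact_mod_cast (Real.sqrt_pos.2 (by positivity : (0 : ℝ) < n + 1)).ne'
      refine (summable_norm_sq_const_mul (Real.sqrt (n + 1) : ℂ)⁻¹ h3).congr fun m => ?_
      rw [inv_mul_cancel_left₀ hne]

theorem summable_dispEntry_gram (z : ℂ) (n n' : ℕ) :
    Summable fun m => conj (dispEntry z m n) * dispEntry z m n' :=
  summable_mul_of_norm_sq (by simpa using summable_dispEntry_sq z n) (summable_dispEntry_sq z n')

/-- The adjointness of a and a†: raising in the left factor and, after shifting m, lowering in the
right one produce z terms that cancel. Iteration brings every Gram entry down to column 0. -/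
theorem tsum_dispEntry_gram_succ (z : ℂ) (n n' : ℕ) :
    (Real.sqrt (n + 1) : ℂ) * ∑' m, conj (dispEntry z m (n + 1)) * dispEntry z m n' =
      (Real.sqrt n' : ℂ) * ∑' m, conj (dispEntry z m n) * dispEntry z m (n' - 1) := by
  have hrw : ∀ m : ℕ, (Real.sqrt (n + 1) : ℂ) * (conj (dispEntry z m (n + 1)) * dispEntry z m n') =
      (Real.sqrt m : ℂ) * conj (dispEntry z (m - 1) n) * dispEntry z m n' -
        z * (conj (dispEntry z m n) * dispEntry z m n') := by
    intro m
    have := congrArg conj (dispEntry_create z m n)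
    simp only [map_mul, map_sub, Complex.conj_ofReal, Complex.conj_conj] at this
    linear_combination dispEntry z m n' * this
  have hshift : ∀ m : ℕ, (Real.sqrt (m + 1 : ℕ) : ℂ) * conj (dispEntry z (m + 1 - 1) n) *
      dispEntry z (m + 1) n' = (Real.sqrt n' : ℂ) * (conj (dispEntry z m n) *
        dispEntry z m (n' - 1)) + z * (conj (dispEntry z m n) * dispEntry z m n') := by
    intro m
    have := dispEntry_annihilate z m n'
    rw [Nat.add_sub_cancel]
    push_cast
    linear_combination conj (dispEntry z m n) * this
  have s0 := (summable_dispEntry_gram z n n').mul_left z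
  have s1 := (summable_dispEntry_gram z n (n' - 1)).mul_left (Real.sqrt n' : ℂ)
  have s2 : Summable fun m : ℕ =>
      (Real.sqrt m : ℂ) * conj (dispEntry z (m - 1) n) * dispEntry z m n' := by
    rw [← summable_nat_add_iff 1]
    exact (s1.add s0).congr fun m => (hshift m).symm
  rw [← tsum_mul_left, tsum_congr hrw, s2.tsum_sub s0, s2.tsum_eq_zero_add, tsum_congr hshift,
    s1.tsum_add s0, tsum_mul_left]
  simp

theorem hasSum_dispEntry_gram (z : ℂ) (n n' : ℕ) :
    HasSum (fun m => conj (dispEntry z m n) * dispEntry z m n') (if n = n' then 1 else 0) := by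
  have hne : ∀ n : ℕ, (Real.sqrt (n + 1) : ℂ) ≠ 0 := fun n => by
    exact_mod_cast (Real.sqrt_pos.2 (by positivity : (0 : ℝ) < n + 1)).ne'
  have hsucc : ∀ n, ∑' m, conj (dispEntry z m (n + 1)) * dispEntry z m 0 = 0 := by
    intro n
    have := tsum_dispEntry_gram_succ z n 0
    simpa [hne n] using this
  suffices h : ∑' m, conj (dispEntry z m n) * dispEntry z m n' = if n = n' then 1 else 0 by
    rw [← h]
    exact (summable_dispEntry_gram z n n').hasSum
  induction n generalizing n' with
  | zero =>
    cases n' with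
    | zero =>
      have h1 : HasSum (fun m => ((‖z‖ ^ 2) ^ m / m.factorial : ℝ)) (Real.exp (‖z‖ ^ 2)) := by
        rw [Real.exp_eq_exp_ℝ]
        exact NormedSpace.expSeries_div_hasSum_exp _
      have h2 := Complex.hasSum_ofReal.2 (h1.mul_left (Real.exp (-‖z‖ ^ 2 / 2) ^ 2))
      have h3 : Real.exp (-‖z‖ ^ 2 / 2) ^ 2 * Real.exp (‖z‖ ^ 2) = 1 := by
        rw [← Real.exp_nat_mul, ← Real.exp_add]
        simp
        ring
      rw [h3] at h2
      rw [if_pos rfl]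
      convert! h2.tsum_eq using 2
      · funext m
        rw [Complex.conj_mul', dispEntry_zero_right, norm_div, norm_mul, norm_pow,
          Complex.norm_real, Complex.norm_real, Real.norm_of_nonneg (Real.exp_pos _).le,
          Real.norm_of_nonneg (Real.sqrt_nonneg _), ← Complex.ofReal_pow, div_pow,
          Real.sq_sqrt (by positivity)]
        congr 1
        ring
    | succ k =>
      rw [if_neg (by omega)]
      have := congrArg conj (hsucc k)
      rw [Complex.conj_tsum] at this
      simpa [mul_comm] using this
  | succ n ih =>
    cases n' with
    | zero => rw [hsucc, if_neg (by omega)]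
    | succ k =>
      have h := tsum_dispEntry_gram_succ z n (k + 1)
      rw [Nat.add_sub_cancel, ih] at h
      push_cast at h
      refine mul_left_cancel₀ (hne n) (h.trans ?_)
      by_cases hnk : n = k
      · simp [hnk]
      · simp [hnk]

variable {I : Type*} [Fintype I]

theorem hasSum_disp_gram (ξ : I → ℂ) (n n' : I → ℕ) :
    HasSum (fun m => conj (disp ξ m n) * disp ξ m n') (if n = n' then 1 else 0) := by
  have h := hasSum_pi_prod (fun j (m : ℕ) => conj (dispEntry (ξ j) m (n j)) *
    dispEntry (ξ j) m (n' j)) _ fun j => hasSum_dispEntry_gram (ξ j) (n j) (n' j)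
  convert! h using 1
  · funext m
    simp only [disp, map_prod, Finset.prod_mul_distrib]
  · rw [Fintype.prod_ite_zero]
    simp [funext_iff]

theorem hasSum_disp_sq (ξ : I → ℂ) (n : I → ℕ) : HasSum (fun m => ‖disp ξ m n‖ ^ 2) 1 := by
  have h := hasSum_disp_gram ξ n n
  rw [if_pos rfl] at h
  have h2 := Complex.hasSum_re h
  convert! h2 using 1
  funext m
  rw [Complex.conj_mul', ← Complex.ofReal_pow, Complex.ofReal_re]

/-- Bessel's inequality for the orthonormal columns of the displacement matrix in ℓ². -/
theorem isContraction_disp (ξ : I → ℂ) : IsContraction (disp ξ) := by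
  classical
  intro S T v
  let col : (I → ℕ) → lp (fun _ : I → ℕ => ℂ) 2 := fun n =>
    ⟨fun m => disp ξ m n, (memℓp_gen_iff (by norm_num)).2
      (by simpa using (hasSum_disp_sq ξ n).summable)⟩
  have hcol : ∀ n m, col n m = disp ξ m n := fun _ _ => rfl
  have horth : Orthonormal ℂ col := by
    rw [orthonormal_iff_ite]
    intro n n'
    rw [lp.inner_eq_tsum]
    convert! (hasSum_disp_gram ξ n n').tsum_eq using 3 with m
    rw [hcol, hcol, RCLike.inner_apply, mul_comm]
  -- The conjugate turns the sesquilinear inner product with a column into the bilinear sum in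
  -- `IsContraction`, up to an overall conjugation.
  let x : lp (fun _ : I → ℕ => ℂ) 2 := ∑ m ∈ T, lp.single 2 m (conj (v m))
  have hx : ‖x‖ ^ 2 = ∑ m ∈ T, ‖v m‖ ^ 2 := by
    have := lp.norm_sum_single (E := fun _ : I → ℕ => ℂ) (p := 2) (by norm_num)
      (fun m => conj (v m)) T
    simpa using this
  rw [← hx]
  refine le_trans (le_of_eq (Finset.sum_congr rfl fun n _ => ?_))
    (horth.sum_inner_products_le x (s := S))
  rw [inner_sum]
  simp only [lp.inner_single_right, hcol, RCLike.inner_apply]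
  rw [← RCLike.norm_conj, map_sum]
  simp

/-! ### The characteristic function of a trace-class operator -/

theorem summable_charFun_inner {A : Op I} (hA : A ∈ traceClass I) (ξ : I → ℂ) (n : I → ℕ) :
    Summable fun m => A n m * disp ξ m n :=
  summable_mul_of_norm_sq (summable_row_sq hA n) (hasSum_disp_sq ξ n).summable

/-- The trace-norm bound in the limit of all m. Its independence of ξ makes C usable as a dominating
constant under an integral over ξ. -/
theorem exists_charFun_bound {A : Op I} (hA : A ∈ traceClass I) :
    ∃ C : ℝ, ∀ (ξ : I → ℂ) (S : Finset (I → ℕ)), ∑ n ∈ S, ‖∑' m, A n m * disp ξ m n‖ ≤ C := by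
  obtain ⟨C, hC⟩ := exists_traceNorm_bound hA
  refine ⟨C, fun ξ S => ?_⟩
  refine le_of_tendsto (x := Filter.atTop)
    (f := fun T : Finset (I → ℕ) => ∑ n ∈ S, ‖∑ m ∈ T, A n m * disp ξ m n‖) ?_
    (Filter.Eventually.of_forall fun T => hC _ (isContraction_disp ξ) S T)
  exact tendsto_finsetSum _ fun n _ => (summable_charFun_inner hA ξ n).hasSum.norm

theorem summable_charFun_outer {A : Op I} (hA : A ∈ traceClass I) (ξ : I → ℂ) :
    Summable fun n => ∑' m, A n m * disp ξ m n := by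
  obtain ⟨C, hC⟩ := exists_charFun_bound hA
  exact Summable.of_norm (summable_of_sum_le (fun _ => norm_nonneg _) (hC ξ))

theorem charFun_add {A B : Op I} (hA : A ∈ traceClass I) (hB : B ∈ traceClass I) (ξ : I → ℂ) :
    charFun (A + B) ξ = charFun A ξ + charFun B ξ := by
  rw [charFun, charFun, charFun,
    ← (summable_charFun_outer hA ξ).tsum_add (summable_charFun_outer hB ξ)]
  refine tsum_congr fun n => ?_
  rw [← (summable_charFun_inner hA ξ n).tsum_add (summable_charFun_inner hB ξ n)]
  simp only [Matrix.add_apply, add_mul]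

theorem charFun_smul (c : ℂ) (A : Op I) (ξ : I → ℂ) : charFun (c • A) ξ = c * charFun A ξ := by
  simp only [charFun, Matrix.smul_apply, smul_eq_mul, mul_assoc, tsum_mul_left]

theorem charFun_ketBra (a b : I → ℕ) (ξ : I → ℂ) : charFun (ketBra a b) ξ = disp ξ b a := by
  rw [charFun, tsum_eq_single a, tsum_eq_single b]
  · simp [ketBra]
  · intro m hm
    simp [ketBra, hm]
  · intro n hn
    simp [ketBra, hn]

end Bosonic
end

noncomputable section
namespace Bosonic
open MeasureTheory

/-! ### Gaussian moments of the displacement operators -/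

/-- The weight `(conj z)^p z^q e^{-|z|²/2}`. -/
def momentWeight (p q : ℕ) (z : ℂ) : ℂ := conj z ^ p * z ^ q * (Real.exp (-‖z‖ ^ 2 / 2) : ℂ)

/-- The moment `∫ (conj z)^p z^q e^{-|z|²/2} ⟨m|D(z)|n⟩ dz`. -/
def dispMoment (p q m n : ℕ) : ℂ := ∫ z : ℂ, momentWeight p q z * dispEntry z m n

theorem continuous_dispEntry (m n : ℕ) : Continuous fun z => dispEntry z m n := by
  unfold dispEntry
  fun_prop

theorem continuous_disp {I : Type*} [Fintype I] (m n : I → ℕ) :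
    Continuous fun ξ => disp ξ m n := by
  unfold disp
  exact continuous_finsetProd _ fun j _ => (continuous_dispEntry _ _).comp (continuous_apply j)

/-- An entry of a unit column, for a system with the single mode `Unit`. -/
theorem norm_dispEntry_le (z : ℂ) (m n : ℕ) : ‖dispEntry z m n‖ ≤ 1 := by
  have h := hasSum_disp_sq (fun _ : Unit => z) fun _ => n
  have := le_hasSum h (fun _ => m) fun _ _ => by positivity
  simp only [disp, Finset.univ_unique, Finset.prod_singleton] at this
  exact (sq_le_one_iff₀ (norm_nonneg _)).1 this

theorem integral_norm_pow_mul_exp (k : ℕ) {b : ℝ} (hb : 0 < b) :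
    ∫ z : ℂ, ‖z‖ ^ k * Real.exp (-b * ‖z‖ ^ 2) =
      Real.pi * b ^ (-((k : ℝ) + 2) / 2) * Real.Gamma ((k + 2) / 2) := by
  have h := Complex.integral_rpow_mul_exp_neg_mul_rpow (p := 2) (q := k) (by norm_num)
    (by have : (0 : ℝ) ≤ k := by positivity
        linarith) hb
  simp only [Real.rpow_natCast, Real.rpow_two] at h
  rw [h]
  ring

theorem integrable_momentWeight (p q : ℕ) : Integrable (momentWeight p q) := by
  have h : Integrable fun z : ℂ => ‖z‖ ^ (p + q) * Real.exp (-(1 / 2) * ‖z‖ ^ 2) := by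
    -- A non-integrable function has integral 0 by convention, so the nonzero value of the integral
    -- proves integrability.
    refine Integrable.of_integral_ne_zero ?_
    rw [integral_norm_pow_mul_exp _ (by norm_num)]
    have := Real.Gamma_pos_of_pos (s := ((p + q : ℕ) + 2 : ℝ) / 2) (by positivity)
    positivity
  refine h.mono' ?_ (Filter.Eventually.of_forall fun z => le_of_eq ?_)
  · unfold momentWeight
    exact Continuous.aestronglyMeasurable (by fun_prop)
  · rw [momentWeight, norm_mul, norm_mul, norm_pow, norm_pow, RCLike.norm_conj, Complex.norm_real,
      Real.norm_of_nonneg (Real.exp_pos _).le, pow_add]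
    congr 2
    ring

theorem integrable_momentWeight_mul (p q m n : ℕ) :
    Integrable fun z => momentWeight p q z * dispEntry z m n :=
  (integrable_momentWeight p q).mul_bdd (continuous_dispEntry m n).aestronglyMeasurable
    (Filter.Eventually.of_forall fun z => norm_dispEntry_le z m n)

/-- The raising relation, solved for conj z times D(z), trades a factor in the weight for a shift of
the indices; the companion for z uses the lowering relation. -/
theorem dispMoment_succ_left (p q m n : ℕ) : dispMoment (p + 1) q m n =
    (Real.sqrt m : ℂ) * dispMoment p q (m - 1) n -
      (Real.sqrt (n + 1) : ℂ) * dispMoment p q m (n + 1) := by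
  simp only [dispMoment]
  rw [← integral_const_mul, ← integral_const_mul,
    ← integral_sub ((integrable_momentWeight_mul _ _ _ _).const_mul _)
      ((integrable_momentWeight_mul _ _ _ _).const_mul _)]
  refine integral_congr_ae (Filter.Eventually.of_forall fun z => ?_)
  simp only [momentWeight]
  linear_combination conj z ^ p * z ^ q * (Real.exp (-‖z‖ ^ 2 / 2) : ℂ) * dispEntry_create z m n

theorem dispMoment_succ_right (p q m n : ℕ) : dispMoment p (q + 1) m n =
    (Real.sqrt (m + 1) : ℂ) * dispMoment p q (m + 1) n -
      (Real.sqrt n : ℂ) * dispMoment p q m (n - 1) := by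
  simp only [dispMoment]
  rw [← integral_const_mul, ← integral_const_mul,
    ← integral_sub ((integrable_momentWeight_mul _ _ _ _).const_mul _)
      ((integrable_momentWeight_mul _ _ _ _).const_mul _)]
  refine integral_congr_ae (Filter.Eventually.of_forall fun z => ?_)
  simp only [momentWeight]
  linear_combination -(conj z ^ p * z ^ q * (Real.exp (-‖z‖ ^ 2 / 2) : ℂ)) *
    dispEntry_annihilate z m n

/-- Rotations of phase space act on the displacement operators by phases. -/
theorem dispEntry_rotate {c : ℂ} (hc : conj c * c = 1) (z : ℂ) (m n : ℕ) :
    dispEntry (c * z) m n = c ^ m * conj c ^ n * dispEntry z m n := by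
  have hnorm : ‖c‖ = 1 := by
    rw [Complex.conj_mul'] at hc
    have : ‖c‖ ^ 2 = 1 := by exact_mod_cast hc
    exact (pow_eq_one_iff_of_nonneg (norm_nonneg _) two_ne_zero).1 this
  rw [dispEntry, dispEntry, norm_mul, hnorm, one_mul, mul_left_comm (c ^ m * conj c ^ n),
    Finset.mul_sum _ _ (c ^ m * conj c ^ n)]
  congr 1
  refine Finset.sum_congr rfl fun k hk => ?_
  have hk := Finset.mem_range.1 hk
  have h1 : c ^ m * conj c ^ n = c ^ (m - k) * conj c ^ (n - k) := by
    obtain ⟨a, rfl⟩ := Nat.exists_eq_add_of_le (show k ≤ m by omega)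
    obtain ⟨b, rfl⟩ := Nat.exists_eq_add_of_le (show k ≤ n by omega)
    rw [Nat.add_sub_cancel_left, Nat.add_sub_cancel_left, pow_add, pow_add]
    calc c ^ k * c ^ a * (conj c ^ k * conj c ^ b) = (conj c * c) ^ k * (c ^ a * conj c ^ b) := by
          ring
      _ = _ := by rw [hc, one_pow, one_mul]
  rw [h1, map_mul, neg_mul_eq_mul_neg, mul_pow, mul_pow]
  ring

theorem conj_exp_mul_exp (θ : ℝ) :
    conj (Complex.exp (Complex.I * θ)) * Complex.exp (Complex.I * θ) = 1 := by
  rw [← Complex.exp_conj, ← Complex.exp_add]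
  simp

/-- Rotating z by π/(m - n) preserves Lebesgue measure and the weight but multiplies the entry by
e^{iπ} = -1, so the moment equals its own negative. -/
theorem dispMoment_zero_of_ne {m n : ℕ} (h : m ≠ n) : dispMoment 0 0 m n = 0 := by
  have hd : (m : ℝ) - n ≠ 0 := sub_ne_zero.2 (by exact_mod_cast h)
  set θ : ℝ := Real.pi / (m - n) with hθ
  set c := Complex.exp (Complex.I * θ) with hc
  have hcc : conj c * c = 1 := conj_exp_mul_exp θ
  have hphase : c ^ m * conj c ^ n = -1 := by
    rw [hc, ← Complex.exp_conj, ← Complex.exp_nat_mul, ← Complex.exp_nat_mul, ← Complex.exp_add,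
      ← Complex.exp_pi_mul_I]
    congr 1
    have h1 : ((m : ℂ) - n) * θ = Real.pi := by
      rw [hθ]
      push_cast
      have : (m : ℂ) - n ≠ 0 := by exact_mod_cast hd
      field_simp
    simp only [map_mul, Complex.conj_I, Complex.conj_ofReal]
    linear_combination Complex.I * h1
  have hrotc : ∀ z, rotation (Circle.exp θ) z = c * z := fun z => by
    rw [rotation_apply, Circle.coe_exp, mul_comm (θ : ℂ)]
  have hnorm : ‖c‖ = 1 := by rw [hc, mul_comm]; exact Complex.norm_exp_ofReal_mul_I θ
  have hrot := (rotation (Circle.exp θ)).measurePreserving.integral_comp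
    (rotation (Circle.exp θ)).toHomeomorph.measurableEmbedding
    (fun z => momentWeight 0 0 z * dispEntry z m n)
  have heq : ∀ z, momentWeight 0 0 (rotation (Circle.exp θ) z) *
      dispEntry (rotation (Circle.exp θ) z) m n =
      -(momentWeight 0 0 z * dispEntry z m n) := by
    intro z
    rw [hrotc]
    simp only [momentWeight, dispEntry_rotate hcc, hphase, norm_mul, hnorm]
    simp
  simp only [heq, integral_neg] at hrot
  have : dispMoment 0 0 m n = -dispMoment 0 0 m n := hrot.symm
  linear_combination this / 2

/-- Radial integration turns the k-th term into π(-1)^{n-k} times the binomial coefficient, the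
Gamma value (n-k)! cancelling the factorials. The alternating sum is (1 - 1)^n. -/
theorem dispMoment_zero_diag (n : ℕ) : dispMoment 0 0 n n = if n = 0 then (Real.pi : ℂ) else 0 := by
  have hterm : ∀ k ∈ Finset.range (n + 1), ∫ z : ℂ, (Real.exp (-‖z‖ ^ 2 / 2) : ℂ) *
      ((Real.exp (-‖z‖ ^ 2 / 2) : ℂ) * (expCreate z n k * expCreate (-conj z) n k)) =
      Real.pi * ((-1) ^ (n - k) * n.choose k) := by
    intro k hk
    have hk : k ≤ n := by have := Finset.mem_range.1 hk; omega
    have h1 : ∀ z : ℂ, (Real.exp (-‖z‖ ^ 2 / 2) : ℂ) *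
        ((Real.exp (-‖z‖ ^ 2 / 2) : ℂ) * (expCreate z n k * expCreate (-conj z) n k)) =
        (((-1) ^ (n - k) * (n.choose k) ^ 2 * (k.factorial / n.factorial) : ℝ) : ℂ) *
          ((‖z‖ ^ (2 * (n - k)) * Real.exp (-1 * ‖z‖ ^ 2) : ℝ) : ℂ) := by
      intro z
      have e1 : (Real.sqrt k.factorial : ℂ) ^ 2 = k.factorial := by
        rw [← Complex.ofReal_pow, Real.sq_sqrt (by positivity)]; push_cast; rfl
      have e2 : (Real.sqrt n.factorial : ℂ) ^ 2 = n.factorial := by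
        rw [← Complex.ofReal_pow, Real.sq_sqrt (by positivity)]; push_cast; rfl
      have e3 : (Real.exp (-1 * ‖z‖ ^ 2) : ℂ) = (Real.exp (-‖z‖ ^ 2 / 2) : ℂ) ^ 2 := by
        rw [← Complex.ofReal_pow, ← Real.exp_nat_mul]
        congr 2
        push_cast
        ring
      have e4 : z ^ (n - k) * (-conj z) ^ (n - k) = (-1) ^ (n - k) * (‖z‖ : ℂ) ^ (2 * (n - k)) := by
        rw [pow_mul, ← Complex.conj_mul', ← mul_pow, ← mul_pow]
        ring
      push_cast at e3 ⊢
      rw [e3, ← e1, ← e2]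
      simp only [expCreate]
      push_cast
      linear_combination Complex.exp (-‖z‖ ^ 2 / 2) ^ 2 * (n.choose k : ℂ) ^ 2 *
        ((Real.sqrt k.factorial : ℂ) / Real.sqrt n.factorial) ^ 2 * e4
    simp only [h1]
    rw [integral_const_mul, integral_complex_ofReal, integral_norm_pow_mul_exp _ one_pos]
    have h2 : Real.Gamma (((2 * (n - k) : ℕ) + 2 : ℝ) / 2) = (n - k).factorial := by
      rw [← Real.Gamma_nat_eq_factorial]
      congr 1
      push_cast
      ring
    rw [h2, Real.one_rpow, ← Complex.ofReal_mul]
    have h3 : (n.choose k : ℝ) * k.factorial * (n - k).factorial = n.factorial := by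
      exact_mod_cast Nat.choose_mul_factorial_mul_factorial hk
    have h4 : (n.factorial : ℝ) ≠ 0 := by positivity
    have h5 : (-1 : ℝ) ^ (n - k) * (n.choose k) ^ 2 * (k.factorial / n.factorial) *
        (Real.pi * 1 * (n - k).factorial) = Real.pi * ((-1) ^ (n - k) * n.choose k) := by
      field_simp
      linear_combination (n.choose k : ℝ) * h3
    rw [h5]
    push_cast
    rfl
  have hint : ∀ k ∈ Finset.range (n + 1), Integrable fun z : ℂ =>
      (Real.exp (-‖z‖ ^ 2 / 2) : ℂ) *
      ((Real.exp (-‖z‖ ^ 2 / 2) : ℂ) * (expCreate z n k * expCreate (-conj z) n k)) := by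
    intro k hk
    refine Integrable.of_integral_ne_zero ?_
    rw [hterm k hk]
    have hk : k ≤ n := by have := Finset.mem_range.1 hk; omega
    have := Nat.choose_pos hk
    have hpi := Real.pi_ne_zero
    simp [hpi, this.ne']
  have h0 : dispMoment 0 0 n n = ∑ k ∈ Finset.range (n + 1), ∫ z : ℂ,
      (Real.exp (-‖z‖ ^ 2 / 2) : ℂ) *
      ((Real.exp (-‖z‖ ^ 2 / 2) : ℂ) * (expCreate z n k * expCreate (-conj z) n k)) := by
    rw [← integral_finsetSum _ hint, dispMoment]
    refine integral_congr_ae (Filter.Eventually.of_forall fun z => ?_)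
    simp only [dispEntry_eq_sum z (m := n) (n := n) (N := n + 1) (by simp), momentWeight,
      Finset.mul_sum, pow_zero, one_mul]
  rw [h0, Finset.sum_congr rfl hterm, ← Finset.mul_sum, ← Finset.sum_range_reflect]
  have h6 : ∑ j ∈ Finset.range (n + 1), (-1 : ℂ) ^ (n - (n + 1 - 1 - j)) *
      (n.choose (n + 1 - 1 - j) : ℂ) = if n = 0 then 1 else 0 := by
    have := congrArg (fun x : ℤ => (x : ℂ)) (Int.alternating_sum_range_choose (n := n))
    push_cast at this
    rw [← this]
    refine Finset.sum_congr rfl fun j hj => ?_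
    have hj : j ≤ n := by have := Finset.mem_range.1 hj; omega
    rw [Nat.add_sub_cancel, Nat.sub_sub_self hj, Nat.choose_symm hj]
  rw [h6]
  split_ifs <;> simp

/-- The Gaussian average of the displacement operators is π|0⟩⟨0|; it starts the triangular
induction. -/
theorem dispMoment_zero (m n : ℕ) :
    dispMoment 0 0 m n = if m = 0 ∧ n = 0 then (Real.pi : ℂ) else 0 := by
  rcases eq_or_ne m n with rfl | h
  · rw [dispMoment_zero_diag]
    simp
  · rw [dispMoment_zero_of_ne h, if_neg]
    rintro ⟨rfl, rfl⟩
    exact h rfl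

/-- The moments are triangular. -/
theorem dispMoment_triangular (p q : ℕ) :
    (∀ m n, dispMoment p q m n ≠ 0 → m ≤ p ∧ n ≤ q) ∧ dispMoment p q p q ≠ 0 := by
  have hne : ∀ n : ℕ, (Real.sqrt (n + 1) : ℂ) ≠ 0 := fun n => by
    exact_mod_cast (Real.sqrt_pos.2 (by positivity : (0 : ℝ) < n + 1)).ne'
  -- Each step in p or q enlarges the support by at most one in the matching index, and at the new
  -- corner only the old corner survives, multiplied by a nonzero square root.
  induction q with
  | zero =>
    induction p with
    | zero =>
      refine ⟨fun m n h => ?_, ?_⟩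
      · rw [dispMoment_zero] at h
        have := (ite_ne_right_iff.1 h).1
        omega
      · rw [dispMoment_zero]
        simp [Real.pi_ne_zero]
    | succ p ih =>
      obtain ⟨h1, h2⟩ := ih
      refine ⟨fun m n h => ?_, ?_⟩
      · by_contra hcon
        refine h ?_
        rw [dispMoment_succ_left]
        have e1 : dispMoment p 0 (m - 1) n = 0 := by
          by_contra h'
          have := h1 _ _ h'
          omega
        have e2 : dispMoment p 0 m (n + 1) = 0 := by
          by_contra h'
          have := h1 _ _ h'
          omega
        rw [e1, e2]
        ring
      · rw [dispMoment_succ_left]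
        have e2 : dispMoment p 0 (p + 1) (0 + 1) = 0 := by
          by_contra h'
          have := h1 _ _ h'
          omega
        rw [e2, mul_zero, sub_zero, Nat.add_sub_cancel]
        push_cast
        exact mul_ne_zero (hne p) h2
  | succ q ih =>
    obtain ⟨h1, h2⟩ := ih
    refine ⟨fun m n h => ?_, ?_⟩
    · by_contra hcon
      refine h ?_
      rw [dispMoment_succ_right]
      have e1 : dispMoment p q (m + 1) n = 0 := by
        by_contra h'
        have := h1 _ _ h'
        omega
      have e2 : dispMoment p q m (n - 1) = 0 := by
        by_contra h'
        have := h1 _ _ h'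
        omega
      rw [e1, e2]
      ring
    · rw [dispMoment_succ_right]
      have e2 : dispMoment p q (p + 1) (q + 1) = 0 := by
        by_contra h'
        have := h1 _ _ h'
        omega
      rw [e2, mul_zero, zero_sub, Nat.add_sub_cancel]
      push_cast
      exact neg_ne_zero.2 (mul_ne_zero (hne q) h2)

/-! ### The characteristic function determines a trace-class operator -/

/-- Dominated convergence along finite subsets of κ. Only the partial sums need a uniform bound;
countability of κ makes the filter countably generated. -/
theorem hasSum_integral_mul_of_bounded {α κ : Type*} [MeasurableSpace α] {μ : Measure α}
    [Countable κ] {F : κ → α → ℂ} {w : α → ℂ} (hw : Integrable w μ)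
    (hF : ∀ k, AEStronglyMeasurable (F k) μ) {C : ℝ}
    (hC : ∀ x (S : Finset κ), ‖∑ k ∈ S, F k x‖ ≤ C) (hs : ∀ x, Summable fun k => F k x) :
    HasSum (fun k => ∫ x, w x * F k x ∂μ) (∫ x, w x * ∑' k, F k x ∂μ) := by
  have hint : ∀ k, Integrable (fun x => w x * F k x) μ := fun k =>
    hw.mul_bdd (hF k) (Filter.Eventually.of_forall fun x => by simpa using hC x {k})
  have h := tendsto_integral_filter_of_dominated_convergence (μ := μ) (l := Filter.atTop)
    (F := fun (S : Finset κ) x => ∑ k ∈ S, w x * F k x) (f := fun x => w x * ∑' k, F k x)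
    (fun x => ‖w x‖ * C)
    (Filter.Eventually.of_forall fun S =>
      (integrable_finsetSum S fun k _ => hint k).aestronglyMeasurable)
    (Filter.Eventually.of_forall fun S => Filter.Eventually.of_forall fun x => by
      rw [← Finset.mul_sum, norm_mul]
      exact mul_le_mul_of_nonneg_left (hC x S) (norm_nonneg _))
    (hw.norm.mul_const C)
    (Filter.Eventually.of_forall fun x => ((hs x).hasSum.mul_left (w x)))
  refine h.congr fun S => ?_
  exact integral_finsetSum S fun k _ => hint k

variable {I : Type*} [Fintype I]

/-- Term-by-term integration, carried out twice: over m within a fixed row, and over n with the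
uniform bound of `exists_charFun_bound`. -/
theorem hasSum_moments {A : Op I} (hA : A ∈ traceClass I) (p q : I → ℕ) :
    HasSum (fun n => ∑' m, A n m * ∏ j, dispMoment (p j) (q j) (m j) (n j))
      (∫ ξ : I → ℂ, (∏ j, momentWeight (p j) (q j) (ξ j)) * charFun A ξ) := by
  have hw : Integrable fun ξ : I → ℂ => ∏ j, momentWeight (p j) (q j) (ξ j) :=
    Integrable.fintype_prod fun j => integrable_momentWeight (p j) (q j)
  have hmeas : ∀ n m, AEStronglyMeasurable (fun ξ : I → ℂ => A n m * disp ξ m n) :=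
    fun n m => ((continuous_disp m n).const_mul _).aestronglyMeasurable
  have hinner : ∀ n, HasSum (fun m => A n m * ∏ j, dispMoment (p j) (q j) (m j) (n j))
      (∫ ξ : I → ℂ, (∏ j, momentWeight (p j) (q j) (ξ j)) * ∑' m, A n m * disp ξ m n) := by
    intro n
    have h := hasSum_integral_mul_of_bounded hw (hmeas n)
      -- From |xy| ≤ x² + y²: the row of A gives the series, and the unit column of the displacement
      -- matrix gives 1.
      (C := ∑' m, ‖A n m‖ ^ 2 + 1) (fun ξ S => ?_) (fun ξ => summable_charFun_inner hA ξ n)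
    · convert! h using 2 with m
      simp only [dispMoment, disp]
      rw [← integral_fintype_prod_volume_eq_prod, ← integral_const_mul]
      refine integral_congr_ae (Filter.Eventually.of_forall fun ξ => ?_)
      simp only [Finset.prod_mul_distrib]
      ring
    · refine (norm_sum_le _ _).trans ?_
      have h1 := (summable_row_sq hA n).sum_le_tsum S fun _ _ => sq_nonneg _
      have h2 := sum_le_hasSum S (fun _ _ => sq_nonneg _) (hasSum_disp_sq ξ n)
      refine le_trans ?_ (add_le_add h1 h2)
      rw [← Finset.sum_add_distrib]
      refine Finset.sum_le_sum fun m _ => ?_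
      rw [norm_mul]
      nlinarith [sq_nonneg (‖A n m‖ - ‖disp ξ m n‖), sq_nonneg ‖A n m‖, sq_nonneg ‖disp ξ m n‖]
  obtain ⟨C, hC⟩ := exists_charFun_bound hA
  have h := hasSum_integral_mul_of_bounded (F := fun n ξ => ∑' m, A n m * disp ξ m n) hw
    (fun n => ?_) (C := C) (fun ξ S => (norm_sum_le _ _).trans (hC ξ S))
    (fun ξ => summable_charFun_outer hA ξ)
  · simp only [(hinner _).tsum_eq]
    exact h
  · exact aestronglyMeasurable_of_tendsto_ae Filter.atTop
      (f := fun (S : Finset (I → ℕ)) ξ => ∑ m ∈ S, A n m * disp ξ m n)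
      (fun S => Finset.aestronglyMeasurable_fun_sum S fun m _ => hmeas n m)
      (Filter.Eventually.of_forall fun ξ => (summable_charFun_inner hA ξ n).hasSum)

/-- A trace-class operator with vanishing characteristic function vanishes. -/
theorem eq_zero_of_charFun_eq_zero {A : Op I} (hA : A ∈ traceClass I)
    (h : ∀ ξ, charFun A ξ = 0) : A = 0 := by
  -- Strong induction on the total degree of the entry. The moment (p, q) sees only entries (n, m)
  -- with n ≤ q and m ≤ p; all of them except (q, p) have smaller degree and already vanish.
  suffices key : ∀ (N : ℕ) (p q : I → ℕ), ∑ j, p j + ∑ j, q j = N → A q p = 0 by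
    ext n m
    exact key _ m n rfl
  intro N
  induction N using Nat.strong_induction_on with
  | _ N ih =>
    intro p q hN
    have hmom := (hasSum_moments hA p q).tsum_eq
    simp only [h, mul_zero, integral_zero] at hmom
    have hvanish : ∀ n m, ¬ (n = q ∧ m = p) →
        A n m * ∏ j, dispMoment (p j) (q j) (m j) (n j) = 0 := by
      intro n m hnm
      by_cases hle : m ≤ p ∧ n ≤ q
      · rw [ih (∑ j, m j + ∑ j, n j) _ m n rfl, zero_mul]
        have h1 : ∑ j, m j ≤ ∑ j, p j := Finset.sum_le_sum fun j _ => hle.1 j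
        have h2 : ∑ j, n j ≤ ∑ j, q j := Finset.sum_le_sum fun j _ => hle.2 j
        rw [← hN]
        by_contra hcon
        have e1 : ∑ j, m j = ∑ j, p j := by omega
        have e2 : ∑ j, n j = ∑ j, q j := by omega
        refine hnm ⟨funext fun j => ?_, funext fun j => ?_⟩
        · exact (Finset.sum_eq_sum_iff_of_le fun j _ => hle.2 j).1 e2 j (Finset.mem_univ j)
        · exact (Finset.sum_eq_sum_iff_of_le fun j _ => hle.1 j).1 e1 j (Finset.mem_univ j)
      · have : ∃ j, dispMoment (p j) (q j) (m j) (n j) = 0 := by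
          by_contra! hcon
          exact hle ⟨fun j => ((dispMoment_triangular _ _).1 _ _ (hcon j)).1,
            fun j => ((dispMoment_triangular _ _).1 _ _ (hcon j)).2⟩
        obtain ⟨j, hj⟩ := this
        rw [Finset.prod_eq_zero (Finset.mem_univ j) hj, mul_zero]
    rw [tsum_eq_single q, tsum_eq_single p] at hmom
    · exact (mul_eq_zero.1 hmom).resolve_right
        (Finset.prod_ne_zero_iff.2 fun j _ => (dispMoment_triangular _ _).2)
    · exact fun m hm => hvanish q m fun h' => hm h'.2
    · intro n hn
      rw [tsum_congr fun m => hvanish n m fun h' => hn h'.1, tsum_zero]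

theorem eq_of_charFun_eq {A B : Op I} (hA : A ∈ traceClass I) (hB : B ∈ traceClass I)
    (h : ∀ ξ, charFun A ξ = charFun B ξ) : A = B := by
  have hB' : (-1 : ℂ) • B ∈ traceClass I := Submodule.smul_mem _ _ hB
  have := eq_zero_of_charFun_eq_zero (add_mem hA hB') fun ξ => by
    rw [charFun_add hA hB', charFun_smul, h]
    ring
  rw [neg_one_smul, add_neg_eq_zero] at this
  exact this

end Bosonic
end

noncomputable section
namespace Bosonic

/-! ### Splitting the modes into two groups -/

section Glue

variable {P Q J α : Type*} (e : P ⊕ Q ≃ J)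

/-- Glue two families along a splitting of the index type. -/
def glue (a : P → α) (b : Q → α) : J → α := fun j => Sum.elim a b (e.symm j)

/-- The part of a family on the first group of modes. -/
def leftPart (x : J → α) : P → α := fun p => x (e (Sum.inl p))

/-- The part of a family on the second group of modes. -/
def rightPart (x : J → α) : Q → α := fun q => x (e (Sum.inr q))

@[simp] theorem glue_inl (a : P → α) (b : Q → α) (p : P) : glue e a b (e (Sum.inl p)) = a p := by
  simp [glue]

@[simp] theorem glue_inr (a : P → α) (b : Q → α) (q : Q) : glue e a b (e (Sum.inr q)) = b q := by
  simp [glue]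

@[simp] theorem leftPart_glue (a : P → α) (b : Q → α) : leftPart e (glue e a b) = a :=
  funext fun p => glue_inl e a b p

@[simp] theorem rightPart_glue (a : P → α) (b : Q → α) : rightPart e (glue e a b) = b :=
  funext fun q => glue_inr e a b q

@[simp] theorem glue_leftPart_rightPart (x : J → α) :
    glue e (leftPart e x) (rightPart e x) = x := by
  funext j
  obtain ⟨p | q, rfl⟩ := e.surjective j
  · rw [glue_inl]; rfl
  · rw [glue_inr]; rfl

/-- Families on all modes are pairs of families on the two groups. -/
def glueEquiv (α : Type*) : (P → α) × (Q → α) ≃ (J → α) where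
  toFun x := glue e x.1 x.2
  invFun x := (leftPart e x, rightPart e x)
  left_inv x := by simp
  right_inv x := by simp

theorem prod_split [Fintype P] [Fintype Q] [Fintype J] {M : Type*} [CommMonoid M] (f : J → M) :
    ∏ j, f j = (∏ p, f (e (Sum.inl p))) * ∏ q, f (e (Sum.inr q)) := by
  rw [← e.prod_comp, Fintype.prod_sum_type]

theorem sum_split [Fintype P] [Fintype Q] [Fintype J] {M : Type*} [AddCommMonoid M] (f : J → M) :
    ∑ j, f j = (∑ p, f (e (Sum.inl p))) + ∑ q, f (e (Sum.inr q)) := by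
  rw [← e.sum_comp, Fintype.sum_sum_type]

end Glue

/-! ### Appending a state -/

variable {I O K : Type*}

section Append

variable {P Q J : Type*} (e : P ⊕ Q ≃ J)

/-- The tensor product of operators on two groups of modes. -/
def tensorOp (A : Op P) (B : Op Q) : Op J := fun n m =>
  A (leftPart e n) (leftPart e m) * B (rightPart e n) (rightPart e m)

theorem hasSum_tensorOp_diag {A : Op P} {B : Op Q} {a b : ℂ} (hA : HasSum (fun n => A n n) a)
    (hB : HasSum (fun n => B n n) b) : HasSum (fun n => tensorOp e A B n n) (a * b) := by
  have hs : Summable fun x : (P → ℕ) × (Q → ℕ) => A x.1 x.1 * B x.2 x.2 :=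
    summable_mul_of_summable_norm (f := fun n => A n n) (g := fun n => B n n)
      hA.summable.norm hB.summable.norm
  rw [← (glueEquiv e ℕ).hasSum_iff]
  convert! hA.mul hB hs using 2 with x
  simp [tensorOp, glueEquiv]

/-- The product of two states. -/
def DensityOp.tensor (ρ : DensityOp P) (σ : DensityOp Q) : DensityOp J where
  toOp := tensorOp e ρ.toOp σ.toOp
  posSemidef := (ρ.posSemidef.submatrix (leftPart e)).hadamard
    (σ.posSemidef.submatrix (rightPart e))
  hasSum_diag := by simpa using hasSum_tensorOp_diag e ρ.hasSum_diag σ.hasSum_diag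

theorem tensorOp_mem {A : Op P} (hA : A ∈ traceClass P) (σ : DensityOp Q) :
    tensorOp e A σ.toOp ∈ traceClass J := by
  refine traceClass_induction (p := fun A => tensorOp e A σ.toOp ∈ traceClass J)
    (fun ρ => (ρ.tensor e σ).mem_traceClass) (fun A B hA hB => ?_) (fun c A hA => ?_) hA
  · convert! add_mem hA hB using 1
    ext n m
    simp [tensorOp, add_mul]
  · convert! Submodule.smul_mem _ c hA using 1
    ext n m
    simp [tensorOp, mul_assoc]

/-- The channel `A ↦ A ⊗ σ`. -/
def appendState (σ : DensityOp Q) : Channel P J where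
  toLin :=
    { toFun := fun A => ⟨tensorOp e A σ.toOp, tensorOp_mem e A.2 σ⟩
      map_add' := fun A B => by
        ext n m
        simp [tensorOp, add_mul]
      map_smul' := fun c A => by
        ext n m
        simp [tensorOp, mul_assoc] }
  trace_preserving A := by
    have := hasSum_tensorOp_diag e (summable_diag A.2).hasSum σ.hasSum_diag
    rw [mul_one] at this
    exact this.tsum_eq
  completely_positive k B hB := by
    -- Schur product theorem: A ⊗ σ is an entrywise product of two pulled-back positive matrices.
    exact (hB.submatrix fun x : Fin k × (J → ℕ) => (x.1, leftPart e x.2)).hadamard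
      (σ.posSemidef.submatrix fun x : Fin k × (J → ℕ) => rightPart e x.2)

theorem appendState_apply (σ : DensityOp Q) (A : traceClass P) :
    ((appendState e σ).toLin A : Op J) = tensorOp e A σ.toOp := rfl

variable [Fintype P] [Fintype Q] [Fintype J]

theorem disp_split (ξ : J → ℂ) (m n : J → ℕ) : disp ξ m n =
    disp (leftPart e ξ) (leftPart e m) (leftPart e n) *
      disp (rightPart e ξ) (rightPart e m) (rightPart e n) :=
  prod_split e _

theorem charFun_tensorOp {A : Op P} {B : Op Q} (hA : A ∈ traceClass P) (hB : B ∈ traceClass Q)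
    (ξ : J → ℂ) :
    charFun (tensorOp e A B) ξ = charFun A (leftPart e ξ) * charFun B (rightPart e ξ) := by
  have hinner : ∀ n, ∑' m, tensorOp e A B n m * disp ξ m n =
      (∑' m, A (leftPart e n) m * disp (leftPart e ξ) m (leftPart e n)) *
        ∑' m, B (rightPart e n) m * disp (rightPart e ξ) m (rightPart e n) := by
    intro n
    rw [tsum_mul_tsum_of_summable_norm (summable_charFun_inner hA _ _).norm
      (summable_charFun_inner hB _ _).norm, ← (glueEquiv e ℕ).tsum_eq]
    refine tsum_congr fun x => ?_
    rw [disp_split e]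
    simp only [tensorOp, glueEquiv, Equiv.coe_fn_mk, leftPart_glue, rightPart_glue]
    ring
  rw [charFun, tsum_congr hinner, charFun, charFun,
    tsum_mul_tsum_of_summable_norm (summable_charFun_outer hA _).norm
      (summable_charFun_outer hB _).norm, ← (glueEquiv e ℕ).tsum_eq]
  refine tsum_congr fun x => ?_
  simp only [glueEquiv, Equiv.coe_fn_mk, leftPart_glue, rightPart_glue]

end Append

/-! ### Tracing out modes -/

section TraceOut

variable {P Q J : Type*} (e : P ⊕ Q ≃ J)

/-- The partial trace over the second group of modes. -/
def traceOutOp (A : Op J) : Op P := fun n m => ∑' k, A (glue e n k) (glue e m k)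

theorem glue_injective_right (n : P → ℕ) : Function.Injective fun k : Q → ℕ => glue e n k :=
  fun k k' h => by simpa using congrArg (rightPart e) h

theorem glue_injective_left (k : Q → ℕ) : Function.Injective fun n : P → ℕ => glue e n k :=
  fun n n' h => by simpa using congrArg (leftPart e) h

theorem summable_traceOutOp {A : Op J} (hA : A ∈ traceClass J) (n m : P → ℕ) :
    Summable fun k => A (glue e n k) (glue e m k) := by
  refine traceClass_induction (p := fun A => Summable fun k => A (glue e n k) (glue e m k))
    (fun ρ => ?_) (fun _ _ hA hB => hA.add hB) (fun c _ hA => hA.mul_left c) hA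
  have hs := ρ.hasSum_re.summable
  refine Summable.of_norm_bounded ((hs.comp_injective (glue_injective_right e n)).add
    (hs.comp_injective (glue_injective_right e m))) fun k => ?_
  have h := ρ.posSemidef.norm_sq_le (glue e n k) (glue e m k)
  have h1 := ρ.posSemidef.re_diag_nonneg (glue e n k)
  have h2 := ρ.posSemidef.re_diag_nonneg (glue e m k)
  refine abs_le_of_sq_le_sq' ?_ (add_nonneg h1 h2) |>.2
  nlinarith

theorem hasSum_traceOutOp {A : Op J} (hA : A ∈ traceClass J) (n m : P → ℕ) :
    HasSum (fun k => A (glue e n k) (glue e m k)) (traceOutOp e A n m) :=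
  (summable_traceOutOp e hA n m).hasSum

theorem hasSum_traceOutOp_diag {A : Op J} (hA : A ∈ traceClass J) {a : ℂ}
    (h : HasSum (fun n => A n n) a) : HasSum (fun n => traceOutOp e A n n) a := by
  rw [← (glueEquiv e ℕ).hasSum_iff] at h
  exact h.prod_fiberwise fun n => hasSum_traceOutOp e hA n n

theorem traceOutOp_add {A B : Op J} (hA : A ∈ traceClass J) (hB : B ∈ traceClass J) :
    traceOutOp e (A + B) = traceOutOp e A + traceOutOp e B := by
  ext n m
  exact (summable_traceOutOp e hA n m).tsum_add (summable_traceOutOp e hB n m)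

theorem traceOutOp_smul (c : ℂ) (A : Op J) : traceOutOp e (c • A) = c • traceOutOp e A := by
  ext n m
  exact tsum_mul_left

/-- The reduced state. -/
def DensityOp.traceOut (ρ : DensityOp J) : DensityOp P where
  toOp := traceOutOp e ρ.toOp
  posSemidef := posSemidef_of_hasSum
    (fun k => ρ.posSemidef.submatrix fun n => glue e n k)
    fun n m => hasSum_traceOutOp e ρ.mem_traceClass n m
  hasSum_diag := hasSum_traceOutOp_diag e ρ.mem_traceClass ρ.hasSum_diag

theorem traceOutOp_mem {A : Op J} (hA : A ∈ traceClass J) : traceOutOp e A ∈ traceClass P := by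
  refine (traceClass_induction (p := fun A => A ∈ traceClass J ∧ traceOutOp e A ∈ traceClass P)
    (fun ρ => ⟨ρ.mem_traceClass, (ρ.traceOut e).mem_traceClass⟩) (fun A B hA hB => ?_)
    (fun c A hA => ?_) hA).2
  · rw [traceOutOp_add e hA.1 hB.1]
    exact ⟨add_mem hA.1 hB.1, add_mem hA.2 hB.2⟩
  · rw [traceOutOp_smul]
    exact ⟨Submodule.smul_mem _ _ hA.1, Submodule.smul_mem _ _ hA.2⟩

/-- The partial trace over the second group of modes, as a channel. -/
def traceOut : Channel J P where
  toLin :=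
    { toFun := fun A => ⟨traceOutOp e A, traceOutOp_mem e A.2⟩
      map_add' := fun A B => Subtype.ext (traceOutOp_add e A.2 B.2)
      map_smul' := fun c A => Subtype.ext (traceOutOp_smul e c A) }
  trace_preserving A := (hasSum_traceOutOp_diag e A.2 (summable_diag A.2).hasSum).tsum_eq
  completely_positive k B hB := posSemidef_of_hasSum
    (fun l : Q → ℕ => hB.submatrix fun x : Fin k × (P → ℕ) => (x.1, glue e x.2 l))
    fun x y => hasSum_traceOutOp e (B x.1 y.1).2 x.2 y.2

theorem traceOut_apply (A : traceClass J) : ((traceOut e).toLin A : Op P) = traceOutOp e A := rfl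

variable [Fintype P]

theorem dispEntry_zero (m n : ℕ) : dispEntry 0 m n = if m = n then 1 else 0 := by
  have h : ∀ m k, expCreate 0 m k = if m = k then 1 else 0 := by
    intro m k
    rcases lt_trichotomy m k with h | rfl | h
    · rw [expCreate_eq_zero h, if_neg h.ne]
    · have := (sqrt_factorial_pos m).ne'
      simp [expCreate, this]
    · rw [if_neg h.ne', expCreate, zero_pow (by omega)]
      simp
  rw [dispEntry_eq_sum 0 (N := m + 1) (by omega)]
  simp only [h, map_zero, neg_zero, Finset.mem_range, norm_zero,
    ite_mul, one_mul, zero_mul, Finset.sum_ite_eq]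
  simp [eq_comm]

theorem disp_zero (m n : P → ℕ) : disp 0 m n = if m = n then 1 else 0 := by
  simp only [disp, Pi.zero_apply, dispEntry_zero, Fintype.prod_ite_zero, funext_iff,
    Finset.prod_const_one]

/-- Joint summability in (m, k) permits exchanging the partial trace with the sum in `charFun`. For
a state, |A(nk, mk)| |D m n| ≤ |D m n|² A(nk, nk) + A(mk, mk), and both terms are jointly summable.
-/
theorem summable_traceOutOp_mul_disp {A : Op J} (hA : A ∈ traceClass J) (ξ : P → ℂ) (n : P → ℕ) :
    Summable fun x : (P → ℕ) × (Q → ℕ) =>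
      A (glue e n x.2) (glue e x.1 x.2) * disp ξ x.1 n := by
  refine traceClass_induction (p := fun A => Summable fun x : (P → ℕ) × (Q → ℕ) =>
      A (glue e n x.2) (glue e x.1 x.2) * disp ξ x.1 n) (fun ρ => ?_)
    (fun _ _ hA hB => (hA.add hB).congr fun _ => (add_mul _ _ _).symm)
    (fun c _ hA => (hA.mul_left c).congr fun _ => (mul_assoc _ _ _).symm) hA
  have hs := ρ.hasSum_re.summable
  have h1 : Summable fun x : (P → ℕ) × (Q → ℕ) =>
      ‖disp ξ x.1 n‖ ^ 2 * (ρ.toOp (glue e n x.2) (glue e n x.2)).re :=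
    (hasSum_disp_sq ξ n).summable.mul_of_nonneg
      (hs.comp_injective (glue_injective_right e n)) (fun _ => sq_nonneg _)
      fun _ => ρ.posSemidef.re_diag_nonneg _
  have h2 : Summable fun x : (P → ℕ) × (Q → ℕ) =>
      (ρ.toOp (glue e x.1 x.2) (glue e x.1 x.2)).re := (glueEquiv e ℕ).summable_iff.2 hs
  refine Summable.of_norm_bounded (h1.add h2) fun x => ?_
  have h := ρ.posSemidef.norm_sq_le (glue e n x.2) (glue e x.1 x.2)
  have h3 := ρ.posSemidef.re_diag_nonneg (glue e n x.2)
  have h4 := ρ.posSemidef.re_diag_nonneg (glue e x.1 x.2)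
  have h5 := mul_nonneg (sq_nonneg ‖disp ξ x.1 n‖) h3
  refine abs_le_of_sq_le_sq' ?_ (add_nonneg h5 h4) |>.2
  rw [norm_mul, mul_pow]
  have h6 := mul_le_mul_of_nonneg_right h (sq_nonneg ‖disp ξ x.1 n‖)
  nlinarith [mul_nonneg h5 h4, sq_nonneg (‖disp ξ x.1 n‖ ^ 2 *
    (ρ.toOp (glue e n x.2) (glue e n x.2)).re), sq_nonneg
    (ρ.toOp (glue e x.1 x.2) (glue e x.1 x.2)).re]

theorem tsum_glue_mul_disp [Fintype Q] [Fintype J] (A : Op J) (ξ : P → ℂ) (n : P → ℕ)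
    (k : Q → ℕ) : ∑' M, A (glue e n k) M * disp (glue e ξ 0) M (glue e n k) =
      ∑' m, A (glue e n k) (glue e m k) * disp ξ m n := by
  rw [← (glue_injective_left e k).tsum_eq]
  · refine tsum_congr fun m => ?_
    rw [disp_split e]
    simp [disp_zero]
  · intro M hM
    refine ⟨leftPart e M, ?_⟩
    have : rightPart e M = k := by
      by_contra hne
      refine hM ?_
      simp only
      rw [disp_split e]
      simp [disp_zero, hne]
    simp only [← this, glue_leftPart_rightPart]

/-- This is Tr[(Tr_Q A) D(ξ)] = Tr[A (D(ξ) ⊗ 1)], the displacement by 0 being the identity. -/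
theorem charFun_traceOutOp [Fintype Q] [Fintype J] {A : Op J} (hA : A ∈ traceClass J)
    (ξ : P → ℂ) : charFun (traceOutOp e A) ξ = charFun A (glue e ξ 0) := by
  let g : (P → ℕ) × (Q → ℕ) → ℂ := fun x =>
    ∑' m, A (glue e x.1 x.2) (glue e m x.2) * disp ξ m x.1
  have hg : ∀ x, ∑' M, A (glueEquiv e ℕ x) M * disp (glue e ξ 0) M (glueEquiv e ℕ x) = g x :=
    fun x => tsum_glue_mul_disp e A ξ x.1 x.2
  have hs : Summable g :=
    ((glueEquiv e ℕ).summable_iff.2 (summable_charFun_outer hA (glue e ξ 0))).congr hg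
  have h1 : charFun A (glue e ξ 0) = ∑' x, g x := by
    rw [charFun, ← (glueEquiv e ℕ).tsum_eq]
    exact tsum_congr hg
  rw [h1, hs.tsum_prod, charFun]
  refine tsum_congr fun n => ?_
  have h2 := Summable.tsum_comm (f := fun (m : P → ℕ) (k : Q → ℕ) =>
    A (glue e n k) (glue e m k) * disp ξ m n) (summable_traceOutOp_mul_disp e hA ξ n)
  refine Eq.trans (tsum_congr fun m => ?_) h2.symm
  exact tsum_mul_right.symm

end TraceOut

/-! ### Composition of channels, and channels acting on states -/

/-- Composition of channels. -/
def Channel.comp (F : Channel O K) (E : Channel I O) : Channel I K where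
  toLin := F.toLin ∘ₗ E.toLin
  trace_preserving A := (F.trace_preserving _).trans (E.trace_preserving A)
  completely_positive k B hB := F.completely_positive k _ (E.completely_positive k B hB)

/-- The output state of a channel. -/
def Channel.mapState (E : Channel I O) (ρ : DensityOp I) : DensityOp O where
  toOp := E.toLin ⟨ρ.toOp, ρ.mem_traceClass⟩
  posSemidef := by
    have h := E.completely_positive 1 (fun _ _ => ⟨ρ.toOp, ρ.mem_traceClass⟩)
      (ρ.posSemidef.submatrix Prod.snd)
    exact h.submatrix fun n => ((0 : Fin 1), n)
  hasSum_diag := by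
    have h := E.trace_preserving ⟨ρ.toOp, ρ.mem_traceClass⟩
    have h1 : opTrace ρ.toOp = 1 := ρ.hasSum_diag.tsum_eq
    have h2 := (summable_diag (E.toLin ⟨ρ.toOp, ρ.mem_traceClass⟩).2).hasSum
    exact (h.trans h1) ▸ h2

/-- Channels with equal action on characteristic functions are equal. -/
theorem toLin_eq_of_charFun_eq [Fintype O] {L L' : traceClass I →ₗ[ℂ] traceClass O}
    (h : ∀ A ξ, charFun (L A : Op O) ξ = charFun (L' A : Op O) ξ) : L = L' :=
  LinearMap.ext fun A => Subtype.ext (eq_of_charFun_eq (L A).2 (L' A).2 (h A))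

end Bosonic
end

noncomputable section
namespace Bosonic

/-! ### Products over frequency sectors -/

section Sectors

variable {I : Type*} {ω : I → ℝ} {W : Finset ℝ}

/-- The part of a family on the modes of frequency `w`. -/
def sectorPart {α : Type*} (w : W) (x : ModesIn ω W → α) : Sector ω w → α :=
  fun j => x ⟨j.1, by rw [j.2]; exact w.2⟩

/-- Families on the modes with frequency in `W` are families of families on the sectors. -/
def sectorEquiv (ω : I → ℝ) (W : Finset ℝ) (α : Type*) :
    (ModesIn ω W → α) ≃ ∀ w : W, (Sector ω w → α) where
  toFun x w := sectorPart w x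
  invFun y j := y ⟨ω j.1, j.2⟩ ⟨j.1, rfl⟩
  left_inv x := rfl
  right_inv y := by
    -- With w a free variable the equation ω j = w can be eliminated, which removes the dependent
    -- casts.
    have h : ∀ (w : ℝ) (hw : w ∈ W) (j : I) (hj : ω j = w),
        y ⟨ω j, hj ▸ hw⟩ ⟨j, rfl⟩ = y ⟨w, hw⟩ ⟨j, hj⟩ := by
      rintro _ _ _ rfl
      rfl
    funext w j
    exact h w w.2 j j.2

/-- The modes with frequency in `W`, grouped by frequency. -/
def sigmaSectorEquiv (ω : I → ℝ) (W : Finset ℝ) : (Σ w : W, Sector ω w) ≃ ModesIn ω W where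
  toFun x := ⟨x.2.1, by rw [x.2.2]; exact x.1.2⟩
  invFun j := ⟨⟨ω j.1, j.2⟩, ⟨j.1, rfl⟩⟩
  left_inv := by
    have h : ∀ (w : ℝ) (hw : w ∈ W) (j : I) (hj : ω j = w),
        (⟨⟨ω j, hj ▸ hw⟩, ⟨j, rfl⟩⟩ : Σ w : W, Sector ω w) = ⟨⟨w, hw⟩, ⟨j, hj⟩⟩ := by
      rintro _ _ _ rfl
      rfl
    exact fun x => h x.1 x.1.2 x.2.1 x.2.2
  right_inv j := rfl

theorem hasSum_sectorProduct_diag {A : ∀ w : W, Op (Sector ω w)} {a : W → ℂ}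
    (h : ∀ w : W, HasSum (fun n => A w n n) (a w)) :
    HasSum (fun n => sectorProduct ω W A n n) (∏ w, a w) := by
  have h' := hasSum_pi_prod (fun (w : W) (n : Sector ω w → ℕ) => A w n n) a h
  rw [← (sectorEquiv ω W ℕ).hasSum_iff] at h'
  exact h'

/-- The product of states of the sectors. -/
def sectorState (σ : ∀ w : W, DensityOp (Sector ω w)) : DensityOp (ModesIn ω W) where
  toOp := sectorProduct ω W fun w => (σ w).toOp
  posSemidef := by
    have key : ∀ S : Finset W, Matrix.PosSemidef (fun n m : ModesIn ω W → ℕ =>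
        ∏ w ∈ S, (σ w).toOp (restrictSector w n) (restrictSector w m)) := by
      classical
      intro S
      induction S using Finset.induction_on with
      | empty =>
        simp only [Finset.prod_empty]
        have h := posSemidef_vecMulVec (fun _ : ModesIn ω W → ℕ => (1 : ℂ))
        have h1 : Matrix.vecMulVec (fun _ : ModesIn ω W → ℕ => (1 : ℂ)) 
            (star fun _ : ModesIn ω W → ℕ => (1 : ℂ)) = fun _ _ => 1 := by
          ext n m
          simp [Matrix.vecMulVec_apply]
        exact h1 ▸ h
      | insert w S hw ih =>
        simp only [Finset.prod_insert hw]
        exact ((σ w).posSemidef.submatrix (restrictSector w)).hadamard ih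
    exact key Finset.univ
  hasSum_diag := by
    have h := hasSum_sectorProduct_diag (A := fun w : W => (σ w).toOp) (a := fun _ => 1)
      fun w => (σ w).hasSum_diag
    rwa [Finset.prod_const_one] at h

theorem sectorProduct_update (A : ∀ w : W, Op (Sector ω w)) (w : W) (X : Op (Sector ω w))
    (n m : ModesIn ω W → ℕ) : sectorProduct ω W (Function.update A w X) n m =
      X (restrictSector w n) (restrictSector w m) *
        ∏ v ∈ Finset.univ.erase w, A v (restrictSector v n) (restrictSector v m) := by
  rw [sectorProduct, ← Finset.mul_prod_erase _ _ (Finset.mem_univ w), Function.update_self]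
  congr 1
  refine Finset.prod_congr rfl fun v hv => ?_
  rw [Function.update_of_ne (Finset.ne_of_mem_erase hv)]

/-- Multilinearity: the factors are replaced by states one at a time. S contains the sectors whose
factor is still arbitrary; when it is empty the product is a product state. -/
theorem sectorProduct_mem {A : ∀ w : W, Op (Sector ω w)} (hA : ∀ w : W, A w ∈ traceClass (Sector ω w)) :
    sectorProduct ω W A ∈ traceClass (ModesIn ω W) := by
  suffices key : ∀ (S : Finset W) (A : ∀ w : W, Op (Sector ω w)),
      (∀ w : W, A w ∈ traceClass (Sector ω w)) → (∀ w : W, w ∉ S → ∃ ρ : DensityOp (Sector ω w), A w = ρ.toOp) →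
      sectorProduct ω W A ∈ traceClass (ModesIn ω W) from
    key Finset.univ A hA fun w hw => absurd (Finset.mem_univ w) hw
  intro S
  induction S using Finset.induction_on with
  | empty =>
    intro A _ h
    choose σ hσ using fun w => h w (Finset.notMem_empty w)
    rw [funext hσ]
    exact (sectorState σ).mem_traceClass
  | insert w S hw ih =>
    intro A hA h
    suffices hX : ∀ X ∈ traceClass (Sector ω w),
        sectorProduct ω W (Function.update A w X) ∈ traceClass (ModesIn ω W) by
      simpa using hX (A w) (hA w)
    intro X hX
    refine traceClass_induction (p := fun X =>
      sectorProduct ω W (Function.update A w X) ∈ traceClass (ModesIn ω W)) (fun ρ => ?_)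
      (fun X Y hX hY => ?_) (fun c X hX => ?_) hX
    · refine ih _ (fun v => ?_) fun v hv => ?_
      · rcases eq_or_ne v w with rfl | hvw
        · rw [Function.update_self]
          exact ρ.mem_traceClass
        · rw [Function.update_of_ne hvw]
          exact hA v
      · rcases eq_or_ne v w with rfl | hvw
        · exact ⟨ρ, Function.update_self ..⟩
        · rw [Function.update_of_ne hvw]
          exact h v (by simp [hvw, hv])
    · convert! add_mem hX hY using 1
      ext n m
      simp only [Matrix.add_apply, sectorProduct_update, add_mul]
    · convert! Submodule.smul_mem _ c hX using 1
      ext n m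
      simp only [Matrix.smul_apply, sectorProduct_update, smul_eq_mul, mul_assoc]

variable [Fintype I]

theorem disp_sectors (ξ : ModesIn ω W → ℂ) (m n : ModesIn ω W → ℕ) : disp ξ m n =
    ∏ w : W, disp (sectorPart w ξ) (restrictSector w m) (restrictSector w n) := by
  rw [disp, ← (sigmaSectorEquiv ω W).prod_comp, Fintype.prod_sigma]
  rfl

theorem charFun_sectorProduct {A : ∀ w : W, Op (Sector ω w)}
    (hA : ∀ w : W, A w ∈ traceClass (Sector ω w)) (ξ : ModesIn ω W → ℂ) :
    charFun (sectorProduct ω W A) ξ = ∏ w : W, charFun (A w) (sectorPart w ξ) := by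
  have hinner : ∀ n, ∑' m, sectorProduct ω W A n m * disp ξ m n = ∏ w : W,
      ∑' m, A w (restrictSector w n) m * disp (sectorPart w ξ) m (restrictSector w n) := by
    intro n
    have h := hasSum_pi_prod (fun (w : W) m => A w (restrictSector w n) m *
      disp (sectorPart w ξ) m (restrictSector w n)) _
      fun w => (summable_charFun_inner (hA w) _ _).hasSum
    rw [← (sectorEquiv ω W ℕ).hasSum_iff] at h
    rw [← h.tsum_eq]
    refine tsum_congr fun m => ?_
    rw [disp_sectors, sectorProduct, ← Finset.prod_mul_distrib]
    rfl
  have h := hasSum_pi_prod (fun (w : W) n => ∑' m, A w n m * disp (sectorPart w ξ) m n) _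
    fun w => (summable_charFun_outer (hA w) _).hasSum
  rw [← (sectorEquiv ω W ℕ).hasSum_iff] at h
  rw [charFun, tsum_congr hinner]
  exact h.tsum_eq

end Sectors

end Bosonic
end

noncomputable section
namespace Bosonic

/-! ### Doubled vectors and matrices -/

section Doubled

variable {I O K : Type*}

/-- The minus sign distinguishes `dbl ξ` from a doubled vector; it reflects that the exponent of a
displacement operator is anti-Hermitian. -/
theorem dbl_swap (ξ : I → ℂ) (a : I ⊕ I) : dbl ξ (Sum.swap a) = -conj (dbl ξ a) := by
  rcases a with a | a <;> simp [dbl]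

theorem IsDoubled.mul [Fintype I] {X : Matrix (K ⊕ K) (I ⊕ I) ℂ} {Y : Matrix (I ⊕ I) (O ⊕ O) ℂ}
    (hX : IsDoubled X) (hY : IsDoubled Y) : IsDoubled (X * Y) := by
  intro a b
  rw [Matrix.mul_apply, Matrix.mul_apply, map_sum, ← (Equiv.sumComm I I).sum_comp]
  refine Finset.sum_congr rfl fun c _ => ?_
  rw [map_mul, ← hX, ← hY]
  rfl

theorem IsDoubled.conjTranspose {X : Matrix (O ⊕ O) (I ⊕ I) ℂ} (hX : IsDoubled X) :
    IsDoubled Xᴴ := by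
  intro a b
  rw [Matrix.conjTranspose_apply, Matrix.conjTranspose_apply, hX]
  rfl

theorem IsDoubled.add {X Y : Matrix (O ⊕ O) (I ⊕ I) ℂ} (hX : IsDoubled X) (hY : IsDoubled Y) :
    IsDoubled (X + Y) := fun a b => by
  rw [Matrix.add_apply, Matrix.add_apply, hX, hY, map_add]

theorem IsDoubled.sub {X Y : Matrix (O ⊕ O) (I ⊕ I) ℂ} (hX : IsDoubled X) (hY : IsDoubled Y) :
    IsDoubled (X - Y) := fun a b => by
  rw [Matrix.sub_apply, Matrix.sub_apply, hX, hY, map_sub]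

theorem IsDoubledVec.mulVec [Fintype I] {X : Matrix (O ⊕ O) (I ⊕ I) ℂ} {r : I ⊕ I → ℂ}
    (hX : IsDoubled X) (hr : IsDoubledVec r) : IsDoubledVec (X *ᵥ r) := by
  intro a
  rw [Matrix.mulVec, Matrix.mulVec, dotProduct, dotProduct, map_sum,
    ← (Equiv.sumComm I I).sum_comp]
  refine Finset.sum_congr rfl fun c _ => ?_
  rw [map_mul, ← hX, ← hr]
  rfl

theorem IsDoubledVec.add {r s : I ⊕ I → ℂ} (hr : IsDoubledVec r) (hs : IsDoubledVec s) :
    IsDoubledVec (r + s) := fun a => by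
  rw [Pi.add_apply, Pi.add_apply, hr, hs, map_add]

theorem isDoubled_zero : IsDoubled (0 : Matrix (O ⊕ O) (I ⊕ I) ℂ) := fun a b => by simp

theorem isDoubledVec_zero : IsDoubledVec (0 : I ⊕ I → ℂ) := fun a => by simp

/-- `pullback` keeps only the first half of X†u. For doubled X the other half is determined by it,
so nothing is lost. -/
theorem dbl_pullback [Fintype O] {X : Matrix (O ⊕ O) (I ⊕ I) ℂ} (hX : IsDoubled X) (ξ : O → ℂ) :
    dbl (pullback X ξ) = Xᴴ *ᵥ dbl ξ := by
  have h : ∀ b, (Xᴴ *ᵥ dbl ξ) (Sum.swap b) = -conj ((Xᴴ *ᵥ dbl ξ) b) := by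
    intro b
    rw [Matrix.mulVec, Matrix.mulVec, dotProduct, dotProduct, map_sum, ← Finset.sum_neg_distrib,
      ← (Equiv.sumComm O O).sum_comp]
    refine Finset.sum_congr rfl fun c _ => ?_
    have h1 := hX.conjTranspose b c
    have h2 := dbl_swap ξ c
    simp only [Equiv.sumComm_apply]
    rw [h1, h2, map_mul]
    ring
  funext b
  rcases b with j | j
  · simp [dbl, pullback]
  · have := h (Sum.inl j)
    rw [Sum.swap_inl] at this
    rw [this]
    simp [dbl, pullback]

theorem pullback_mul [Fintype O] [Fintype K] [Fintype I] {X : Matrix (O ⊕ O) (K ⊕ K) ℂ}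
    {X' : Matrix (K ⊕ K) (I ⊕ I) ℂ} (hX : IsDoubled X) (ξ : O → ℂ) :
    pullback (X * X') ξ = pullback X' (pullback X ξ) := by
  funext j
  rw [pullback, pullback, Matrix.conjTranspose_mul, dbl_pullback hX, Matrix.mulVec_mulVec]

/-- The moment rule r ↦ Xr + d, M ↦ XMX† + Y at the level of Gaussian functions, serving both
composition of channels and their action on states. -/
theorem gaussFun_pullback [Fintype I] [Fintype O] {X : Matrix (O ⊕ O) (I ⊕ I) ℂ}
    (hX : IsDoubled X) (r : I ⊕ I → ℂ) (M : Matrix (I ⊕ I) (I ⊕ I) ℂ) (d : O ⊕ O → ℂ)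
    (Y : Matrix (O ⊕ O) (O ⊕ O) ℂ) (ξ : O → ℂ) :
    gaussFun r M (pullback X ξ) * gaussFun d Y ξ =
      gaussFun (X *ᵥ r + d) (X * M * Xᴴ + Y) ξ := by
  have h1 : star (Xᴴ *ᵥ dbl ξ) ⬝ᵥ r = star (dbl ξ) ⬝ᵥ X *ᵥ r := by
    rw [Matrix.star_mulVec, Matrix.conjTranspose_conjTranspose, Matrix.dotProduct_mulVec]
  have h2 : star (Xᴴ *ᵥ dbl ξ) ⬝ᵥ M *ᵥ (Xᴴ *ᵥ dbl ξ) = star (dbl ξ) ⬝ᵥ (X * M * Xᴴ) *ᵥ dbl ξ := by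
    rw [Matrix.star_mulVec, Matrix.conjTranspose_conjTranspose, ← Matrix.dotProduct_mulVec,
      Matrix.mulVec_mulVec, Matrix.mulVec_mulVec, Matrix.mul_assoc]
  rw [gaussFun, gaussFun, gaussFun, ← Complex.exp_add, dbl_pullback hX, h1, h2, dotProduct_add,
    Matrix.add_mulVec, dotProduct_add]
  congr 1
  ring

theorem gaussFun_zero [Fintype I] (ξ : I → ℂ) : gaussFun 0 0 ξ = 1 := by
  simp [gaussFun]

theorem gaussFun_apply_zero [Fintype I] (r : I ⊕ I → ℂ) (M : Matrix (I ⊕ I) (I ⊕ I) ℂ) :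
    gaussFun r M 0 = 1 := by
  have : dbl (0 : I → ℂ) = 0 := by
    funext a
    rcases a with a | a <;> simp [dbl]
  simp [gaussFun, this]

end Doubled

/-! ### Gaussian channels: composition and action on Gaussian states -/

section Tuples

variable {I O K : Type*} [Fintype I] [DecidableEq I] [Fintype O] [DecidableEq O] [Fintype K]
  [DecidableEq K]

theorem Channel.HasTuple.comp {F : Channel O K} {E : Channel I O} {X X' Y Y' d d'}
    (hF : F.HasTuple X Y d) (hE : E.HasTuple X' Y' d') :
    (F.comp E).HasTuple (X * X') (X * Y' * Xᴴ + Y) (X *ᵥ d' + d) where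
  doubled_X := hF.doubled_X.mul hE.doubled_X
  doubled_Y := ((hF.doubled_X.mul hE.doubled_Y).mul hF.doubled_X.conjTranspose).add hF.doubled_Y
  doubled_d := (IsDoubledVec.mulVec hF.doubled_X hE.doubled_d).add hF.doubled_d
  hermitian_Y := (Matrix.isHermitian_mul_mul_conjTranspose X hE.hermitian_Y).add hF.hermitian_Y
  uncertainty := by
    -- Conjugating the inner relation by X and adding the outer one cancels the Z terms of the
    -- intermediate system.
    have h := (hE.uncertainty.mul_mul_conjTranspose_same X).add hF.uncertainty
    convert! h using 1
    rw [Matrix.conjTranspose_mul]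
    simp only [Matrix.mul_sub, Matrix.sub_mul, Matrix.mul_assoc]
    abel
  charFun_eq A ξ := by
    have h1 := hF.charFun_eq (E.toLin A) ξ
    rw [hE.charFun_eq A] at h1
    rw [pullback_mul hF.doubled_X, ← gaussFun_pullback hF.doubled_X, ← mul_assoc]
    exact h1

theorem Channel.IsGaussian.comp {F : Channel O K} {E : Channel I O} (hF : F.IsGaussian)
    (hE : E.IsGaussian) : (F.comp E).IsGaussian := by
  obtain ⟨X, Y, d, h⟩ := hF
  obtain ⟨X', Y', d', h'⟩ := hE
  exact ⟨_, _, _, h.comp h'⟩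

theorem IsGCO.comp {ωI : I → ℝ} {ωO : O → ℝ} {ωK : K → ℝ} {F : Channel O K} {E : Channel I O}
    (hF : IsGCO ωO ωK F) (hE : IsGCO ωI ωO E) : IsGCO ωI ωK (F.comp E) where
  gaussian := hF.gaussian.comp hE.gaussian
  covariant t := by
    have h1 := hE.covariant t
    have h2 := hF.covariant t
    change (F.toLin ∘ₗ E.toLin) ∘ₗ evolve ωI t = evolve ωK t ∘ₗ F.toLin ∘ₗ E.toLin
    rw [LinearMap.comp_assoc, h1, ← LinearMap.comp_assoc, h2, LinearMap.comp_assoc]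

theorem Channel.IsGaussian.mapState {E : Channel I O} (hE : E.IsGaussian) {ρ : DensityOp I}
    (hρ : ρ.IsGaussian) : (E.mapState ρ).IsGaussian := by
  obtain ⟨X, Y, d, h⟩ := hE
  obtain ⟨r, M, hr, hM, hMh, hu, hχ⟩ := hρ
  refine ⟨X *ᵥ r + d, X * M * Xᴴ + Y, (IsDoubledVec.mulVec h.doubled_X hr).add h.doubled_d,
    ((h.doubled_X.mul hM).mul h.doubled_X.conjTranspose).add h.doubled_Y,
    (Matrix.isHermitian_mul_mul_conjTranspose X hMh).add h.hermitian_Y, ?_, fun ξ => ?_⟩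
  · convert! (hu.mul_mul_conjTranspose_same X).add h.uncertainty using 1
    simp only [Matrix.mul_add, Matrix.add_mul]
    abel
  · rw [← gaussFun_pullback h.doubled_X, ← hχ]
    exact h.charFun_eq ⟨ρ.toOp, ρ.mem_traceClass⟩ ξ

theorem IsGCO.isSymmetric_mapState {ωI : I → ℝ} {ωO : O → ℝ} {E : Channel I O}
    (hE : IsGCO ωI ωO E) {ρ : DensityOp I} (hρ : ρ.IsSymmetric ωI) :
    (E.mapState ρ).IsSymmetric ωO := by
  intro t
  have h := LinearMap.congr_fun (hE.covariant t) ⟨ρ.toOp, ρ.mem_traceClass⟩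
  have h1 : evolve ωI t ⟨ρ.toOp, ρ.mem_traceClass⟩ = ⟨ρ.toOp, ρ.mem_traceClass⟩ :=
    Subtype.ext (hρ t)
  rw [LinearMap.comp_apply, h1] at h
  exact (congrArg Subtype.val h).symm

end Tuples

/-! ### The vacuum -/

section Vacuum

variable {I : Type*}

theorem Zmat_eq_diagonal [DecidableEq I] :
    Zmat I = Matrix.diagonal (Sum.elim (fun _ => (1 / 2 : ℂ)) fun _ => -(1 / 2)) := by
  rw [Zmat, ← Matrix.fromBlocks_diagonal, Matrix.smul_one_eq_diagonal, ← Matrix.diagonal_neg]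

variable [Fintype I]

theorem disp_zero_zero (ξ : I → ℂ) :
    disp ξ 0 0 = ∏ j, (Real.exp (-‖ξ j‖ ^ 2 / 2) : ℂ) := by
  simp [disp, dispEntry_zero_right]

theorem vacuum_isSymmetric (ω : I → ℝ) : (vacuum I).IsSymmetric ω := by
  intro t
  ext n m
  rw [evolveOp_apply]
  by_cases h : n = 0 ∧ m = 0
  · obtain ⟨rfl, rfl⟩ := h
    simp [energy]
  · simp [vacuum, ketBra, h]

theorem vacuum_isGaussian [DecidableEq I] : (vacuum I).IsGaussian := by
  -- The vacuum has symmetrized second moments 1/2, so M + Z = diag(1, 0).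
  refine ⟨0, (1 / 2 : ℂ) • 1, isDoubledVec_zero, fun a b => ?_, ?_, ?_, fun ξ => ?_⟩
  · by_cases h : a = b
    · subst h
      simp [Complex.conj_ofNat]
    · have h' : Sum.swap a ≠ Sum.swap b := fun h' => h (Sum.swap_leftInverse.injective h')
      simp [Matrix.one_apply_ne h, Matrix.one_apply_ne h']
  · rw [Matrix.IsHermitian, Matrix.conjTranspose_smul, Matrix.conjTranspose_one]
    simp
  · rw [Zmat_eq_diagonal, Matrix.smul_one_eq_diagonal, Matrix.diagonal_add]
    refine Matrix.PosSemidef.diagonal fun a => ?_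
    rcases a with a | a
    · simp only [Pi.zero_apply, Sum.elim_inl]
      norm_num
    · simp
  · have h1 : charFun (vacuum I).toOp ξ = disp ξ 0 0 := charFun_ketBra 0 0 ξ
    rw [h1, disp_zero_zero, gaussFun, dotProduct_zero, Matrix.smul_mulVec, Matrix.one_mulVec,
      dotProduct_smul, dotProduct, Fintype.sum_sum_type]
    simp only [Complex.ofReal_exp, ← Complex.exp_sum]
    congr 1
    simp only [dbl, Pi.star_apply, Sum.elim_inl, Sum.elim_inr, Complex.star_def, map_neg,
      neg_mul_neg, Complex.conj_conj, Complex.conj_mul', Complex.mul_conj']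
    push_cast
    rw [smul_eq_mul, ← Finset.sum_add_distrib, Finset.mul_sum, Finset.mul_sum, zero_sub,
      ← Finset.sum_neg_distrib]
    exact Finset.sum_congr rfl fun j _ => by ring

end Vacuum

theorem energy_split {P Q J : Type*} [Fintype P] [Fintype Q] [Fintype J] (e : P ⊕ Q ≃ J)
    (ω : J → ℝ) (n : J → ℕ) : energy ω n =
    energy (leftPart e ω) (leftPart e n) + energy (rightPart e ω) (rightPart e n) :=
  sum_split e _

/-! ### Selecting modes -/

section Select

variable {P Q J : Type*} [DecidableEq J]

/-- The phase-space matrix that selects the modes in the range of `f`. -/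
def selMat (f : P → J) : Matrix (P ⊕ P) (J ⊕ J) ℂ := fun a b => if Sum.map f f a = b then 1 else 0

theorem conjTranspose_selMat_apply (f : P → J) (a : P ⊕ P) (b : J ⊕ J) :
    (selMat f)ᴴ b a = selMat f a b := by
  rw [Matrix.conjTranspose_apply]
  unfold selMat
  split_ifs <;> simp

theorem selMat_isDoubled (f : P → J) : IsDoubled (selMat f) := by
  intro a b
  have : Sum.map f f (Sum.swap a) = Sum.swap b ↔ Sum.map f f a = b := by
    rcases a with a | a <;> rcases b with b | b <;> simp
  simp [selMat, this]

theorem pullback_selMat_left [Fintype P] (e : P ⊕ Q ≃ J) (ξ : P → ℂ) :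
    pullback (selMat fun p => e (Sum.inl p)) ξ = glue e ξ 0 := by
  funext j
  rw [pullback, Matrix.mulVec, dotProduct, Fintype.sum_sum_type]
  obtain ⟨p | q, rfl⟩ := e.surjective j
  · rw [glue_inl, Finset.sum_eq_single p]
    · simp [selMat, Matrix.conjTranspose_apply, dbl]
    · intro b _ hb
      simp [selMat, Matrix.conjTranspose_apply, hb]
    · simp
  · rw [glue_inr]
    simp [selMat, Matrix.conjTranspose_apply]

variable [Fintype J]

theorem selMat_mulVec (f : P → J) (v : J ⊕ J → ℂ) (a : P ⊕ P) :
    (selMat f *ᵥ v) a = v (Sum.map f f a) := by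
  rw [Matrix.mulVec, dotProduct, Finset.sum_eq_single (Sum.map f f a)]
  · simp [selMat]
  · intro b _ hb
    simp [selMat, hb.symm]
  · simp

theorem pullback_conjTranspose_selMat (f : P → J) (ξ : J → ℂ) :
    pullback (selMat f)ᴴ ξ = fun p => ξ (f p) := by
  funext p
  rw [pullback, Matrix.conjTranspose_conjTranspose, selMat_mulVec]
  simp [dbl]

theorem selMat_mul_Zmat [DecidableEq P] [Fintype P] (f : P → J) : selMat f * Zmat J = Zmat P * selMat f := by
  ext a b
  rw [Zmat_eq_diagonal, Zmat_eq_diagonal, Matrix.mul_diagonal, Matrix.diagonal_mul]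
  by_cases h : Sum.map f f a = b
  · subst h
    rcases a with a | a <;> simp [selMat]
  · simp [selMat, h]

theorem selMat_mul_conjTranspose [DecidableEq P] {f : P → J} (hf : Function.Injective f) :
    selMat f * (selMat f)ᴴ = 1 := by
  ext a b
  have h := selMat_mulVec f (fun c => (selMat f)ᴴ c b) a
  refine h.trans ?_
  have hinj : Sum.map f f b = Sum.map f f a ↔ a = b := by
    rw [(Function.Injective.sumMap hf hf).eq_iff, eq_comm]
  simp [Matrix.conjTranspose_apply, selMat, Matrix.one_apply, hinj, apply_ite]

variable [Fintype P] [Fintype Q] (e : P ⊕ Q ≃ J)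

theorem selMat_complete :
    (selMat fun p => e (Sum.inl p))ᴴ * (selMat fun p => e (Sum.inl p)) +
      (selMat fun q => e (Sum.inr q))ᴴ * (selMat fun q => e (Sum.inr q)) = 1 := by
  ext a b
  have h : (1 : Matrix (J ⊕ J) (J ⊕ J) ℂ) a b = ∑ c : J ⊕ J,
      (if c = a then 1 else 0) * (if c = b then 1 else 0) := by
    simp [Matrix.one_apply, eq_comm]
  rw [h, Fintype.sum_sum_type, sum_split e, sum_split e, Matrix.add_apply, Matrix.mul_apply,
    Matrix.mul_apply, Fintype.sum_sum_type, Fintype.sum_sum_type]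
  simp only [conjTranspose_selMat_apply]
  exact add_add_add_comm _ _ _ _

variable [DecidableEq P]

theorem traceOut_hasTuple : (traceOut e).HasTuple (selMat fun p => e (Sum.inl p)) 0 0 where
  doubled_X := selMat_isDoubled _
  doubled_Y := isDoubled_zero
  doubled_d := isDoubledVec_zero
  hermitian_Y := Matrix.isHermitian_zero
  uncertainty := by
    rw [selMat_mul_Zmat, Matrix.mul_assoc,
      selMat_mul_conjTranspose fun _ _ h => Sum.inl_injective (e.injective h), Matrix.mul_one, sub_self,
      sub_zero]
    exact Matrix.PosSemidef.zero
  charFun_eq A ξ := by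
    rw [gaussFun_zero, mul_one, pullback_selMat_left]
    exact charFun_traceOutOp e A.2 ξ

theorem traceOut_isGCO (ω : J → ℝ) : IsGCO ω (leftPart e ω) (traceOut e) where
  gaussian := ⟨_, _, _, traceOut_hasTuple e⟩
  covariant t := by
    refine LinearMap.ext fun A => Subtype.ext (Matrix.ext fun n m => ?_)
    change traceOutOp e (evolveOp ω t A) n m = evolveOp (leftPart e ω) t (traceOutOp e A) n m
    rw [evolveOp_apply, traceOutOp, traceOutOp, ← tsum_mul_left, ← tsum_mul_right]
    refine tsum_congr fun k => ?_
    rw [evolveOp_apply, energy_split e, energy_split e ω (glue e m k)]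
    simp only [leftPart_glue, rightPart_glue]
    -- A traced-out mode has the same occupation k on both sides, so its phases cancel.
    have h : Complex.exp (-(Complex.I * energy (rightPart e ω) k * t)) *
        Complex.exp (Complex.I * energy (rightPart e ω) k * t) = 1 := by
      rw [← Complex.exp_add, neg_add_cancel, Complex.exp_zero]
    push_cast
    simp only [mul_add, add_mul, neg_add, Complex.exp_add]
    linear_combination Complex.exp (-(Complex.I * energy (leftPart e ω) n * t)) *
      (A : Op J) (glue e n k) (glue e m k) *
      Complex.exp (Complex.I * energy (leftPart e ω) m * t) * h

variable [DecidableEq Q]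

/-- With X the embedding of the first group, XZX† - Z is minus the embedded Z of the second. The
uncertainty relation of the channel is therefore the embedded relation M + Z ≥ 0 of the state. The
summands `+ 0` match `gaussFun_pullback` with trivial d and Y. -/
theorem appendState_hasTuple {σ : DensityOp Q} {r M} (hr : IsDoubledVec r) (hM : IsDoubled M)
    (hMh : M.IsHermitian) (hu : (M + Zmat Q).PosSemidef)
    (hχ : ∀ ξ, charFun σ.toOp ξ = gaussFun r M ξ) :
    (appendState e σ).HasTuple (selMat fun p => e (Sum.inl p))ᴴ
      ((selMat fun q => e (Sum.inr q))ᴴ * M * ((selMat fun q => e (Sum.inr q))ᴴ)ᴴ + 0)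
      ((selMat fun q => e (Sum.inr q))ᴴ *ᵥ r + 0) where
  doubled_X := (selMat_isDoubled _).conjTranspose
  doubled_Y := (((selMat_isDoubled _).conjTranspose.mul hM).mul
    (selMat_isDoubled _).conjTranspose.conjTranspose).add isDoubled_zero
  doubled_d := (IsDoubledVec.mulVec (selMat_isDoubled _).conjTranspose hr).add isDoubledVec_zero
  hermitian_Y := (Matrix.isHermitian_mul_mul_conjTranspose _ hMh).add Matrix.isHermitian_zero
  uncertainty := by
    convert! hu.mul_mul_conjTranspose_same (selMat fun q => e (Sum.inr q))ᴴ using 1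
    have h := congrArg (· * Zmat J) (selMat_complete e)
    simp only [Matrix.add_mul, Matrix.mul_assoc, selMat_mul_Zmat, Matrix.one_mul] at h
    simp only [Matrix.conjTranspose_conjTranspose, Matrix.mul_add, Matrix.add_mul,
      Matrix.mul_assoc, ← h]
    abel
  charFun_eq A ξ := by
    rw [← gaussFun_pullback (selMat_isDoubled _).conjTranspose, gaussFun_zero, mul_one,
      pullback_conjTranspose_selMat, pullback_conjTranspose_selMat, ← hχ]
    exact charFun_tensorOp e A.2 σ.mem_traceClass ξ

theorem appendState_isGCO (ω : J → ℝ) {σ : DensityOp Q} (hσ : σ.IsGaussian)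
    (hs : σ.IsSymmetric (rightPart e ω)) : IsGCO (leftPart e ω) ω (appendState e σ) where
  gaussian := by
    obtain ⟨r, M, hr, hM, hMh, hu, hχ⟩ := hσ
    exact ⟨_, _, _, appendState_hasTuple e hr hM hMh hu hχ⟩
  covariant t := by
    refine LinearMap.ext fun A => Subtype.ext (Matrix.ext fun n m => ?_)
    change tensorOp e (evolveOp (leftPart e ω) t A) σ.toOp n m =
      evolveOp ω t (tensorOp e A σ.toOp) n m
    have h := congrFun (congrFun (hs t) (rightPart e n)) (rightPart e m)
    rw [tensorOp, ← h, evolveOp_apply, evolveOp_apply, evolveOp_apply, tensorOp, energy_split e,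
      energy_split e ω m]
    push_cast
    simp only [mul_add, add_mul, neg_add, Complex.exp_add]
    ring

end Select

end Bosonic
end

noncomputable section
namespace Bosonic

/-! ### Uniqueness of exponents -/

/-- Differentiating at s = 0 reads off the linear coefficient and avoids the 2πi ambiguity of the
logarithm. -/
theorem eq_of_exp_quadratic_eq {a b a' b' : ℂ}
    (h : ∀ s : ℝ, Complex.exp (s * a + s ^ 2 * b) = Complex.exp (s * a' + s ^ 2 * b')) :
    a = a' := by
  have hd : ∀ a b : ℂ, HasDerivAt (fun s : ℝ => Complex.exp (s * a + s ^ 2 * b)) a 0 := by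
    intro a b
    have h1 : HasDerivAt (fun s : ℝ => (s : ℂ)) 1 0 := Complex.ofRealCLM.hasDerivAt
    have h2 := ((h1.mul_const a).add ((h1.pow 2).mul_const b)).cexp
    simpa using h2
  have h1 := hd a b
  rw [funext h] at h1
  exact h1.unique (hd a' b')

theorem eq_of_exp_mul_eq {z w : ℂ} (h : ∀ s : ℝ, Complex.exp (s * z) = Complex.exp (s * w)) :
    z = w :=
  eq_of_exp_quadratic_eq (b := 0) (b' := 0) fun s => by simpa using h s

theorem eq_and_eq_of_exp_quadratic_eq {a b a' b' : ℂ}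
    (h : ∀ s : ℝ, Complex.exp (s * a + s ^ 2 * b) = Complex.exp (s * a' + s ^ 2 * b')) :
    a = a' ∧ b = b' := by
  have ha := eq_of_exp_quadratic_eq h
  subst ha
  refine ⟨rfl, eq_of_exp_mul_eq fun s => ?_⟩
  -- Putting s = √t makes the quadratic term linear in t ≥ 0; negative values follow by inversion.
  have hpos : ∀ t : ℝ, 0 ≤ t → Complex.exp (t * b) = Complex.exp (t * b') := by
    intro t ht
    have h1 := h (Real.sqrt t)
    rw [Complex.exp_add, Complex.exp_add] at h1
    have h2 := mul_left_cancel₀ (Complex.exp_ne_zero _) h1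
    rwa [← Complex.ofReal_pow, Real.sq_sqrt ht] at h2
  rcases le_total 0 s with hs | hs
  · exact hpos s hs
  · have h1 := congrArg (·⁻¹) (hpos (-s) (by linarith))
    simp only [← Complex.exp_neg] at h1
    simpa using h1

/-! ### Doubled vectors span -/

section Span

variable {I : Type*} [Fintype I]

theorem star_dbl_dotProduct_mulVec {N : Matrix (I ⊕ I) (I ⊕ I) ℂ} (hN : IsDoubled N)
    (ξ η : I → ℂ) :
    star (star (dbl ξ) ⬝ᵥ N *ᵥ dbl η) = star (dbl ξ) ⬝ᵥ N *ᵥ dbl η := by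
  have hN' : ∀ a b, N (Sum.swap a) (Sum.swap b) = conj (N a b) := hN
  simp only [dotProduct, Matrix.mulVec, star_sum]
  rw [← (Equiv.sumComm I I).sum_comp]
  refine Finset.sum_congr rfl fun a _ => ?_
  rw [star_mul', star_sum, ← (Equiv.sumComm I I).sum_comp]
  simp only [Equiv.sumComm_apply, Pi.star_apply, dbl_swap, hN', Complex.star_def,
    map_neg, map_mul, Complex.conj_conj, mul_neg, Finset.sum_neg_distrib, neg_mul, neg_neg]

variable [DecidableEq I]

/-- The vectors `dbl ξ` form only a real subspace, but its complex span is everything: ξ = e_k and ξ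
= i e_k suffice for each mode k. -/
theorem eq_zero_of_mulVec_dbl {κ : Type*} {N : Matrix κ (I ⊕ I) ℂ}
    (h : ∀ ξ, N *ᵥ dbl ξ = 0) : N = 0 := by
  have key : ∀ a k, N a (Sum.inl k) = 0 ∧ N a (Sum.inr k) = 0 := by
    intro a k
    have hs : ∀ c : ℂ, N a (Sum.inl k) * -c + N a (Sum.inr k) * conj c = 0 := by
      intro c
      have h1 := congrFun (h (Pi.single k c)) a
      rw [Matrix.mulVec, dotProduct, Fintype.sum_sum_type, Finset.sum_eq_single k,
        Finset.sum_eq_single k] at h1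
      · simpa [dbl] using h1
      · intro b _ hb
        simp [dbl, hb]
      · simp
      · intro b _ hb
        simp [dbl, hb]
      · simp
    have h1 := hs 1
    have h2 := hs Complex.I
    simp only [map_one, Complex.conj_I] at h1 h2
    constructor
    · linear_combination (-1 / 2) * h1 + (Complex.I / 2) * h2 +
        (1 / 2 * N a (Sum.inl k) + 1 / 2 * N a (Sum.inr k)) * Complex.I_sq
    · linear_combination (1 / 2) * h1 + (Complex.I / 2) * h2 +
        (1 / 2 * N a (Sum.inl k) + 1 / 2 * N a (Sum.inr k)) * Complex.I_sq
  ext a b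
  rcases b with k | k
  · exact (key a k).1
  · exact (key a k).2

theorem eq_zero_of_star_dbl_dotProduct {v : I ⊕ I → ℂ} (h : ∀ ξ, star (dbl ξ) ⬝ᵥ v = 0) :
    v = 0 := by
  have h1 : Matrix.of (fun (_ : Unit) => star v) = 0 := eq_zero_of_mulVec_dbl fun ξ => by
    funext u
    have := congrArg star (h ξ)
    rw [← Matrix.star_dotProduct_star, star_star, star_zero] at this
    rw [Pi.zero_apply, ← this]
    rfl
  have h2 := congrFun h1 ()
  exact star_eq_zero.1 h2

/-- Polarization over the reals. The two cross terms agree because N is Hermitian and its form takes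
real values on vectors `dbl ξ`. -/
theorem eq_zero_of_quadratic_dbl {N : Matrix (I ⊕ I) (I ⊕ I) ℂ} (hN : IsDoubled N)
    (hNh : N.IsHermitian) (h : ∀ ξ, star (dbl ξ) ⬝ᵥ N *ᵥ dbl ξ = 0) : N = 0 := by
  refine eq_zero_of_mulVec_dbl fun η => eq_zero_of_star_dbl_dotProduct fun ξ => ?_
  have hadd : dbl (ξ + η) = dbl ξ + dbl η := by
    funext a
    rcases a with a | a
    · simp only [dbl, Pi.add_apply, Sum.elim_inl]
      ring
    · simp [dbl]
  have h1 := h (ξ + η)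
  rw [hadd, star_add, Matrix.mulVec_add, add_dotProduct, dotProduct_add, dotProduct_add, h, h] at h1
  have h2 : star (dbl η) ⬝ᵥ N *ᵥ dbl ξ = star (dbl ξ) ⬝ᵥ N *ᵥ dbl η := by
    rw [← star_dbl_dotProduct_mulVec hN ξ η, ← Matrix.star_dotProduct_star, star_star,
      Matrix.star_mulVec, hNh.eq, ← Matrix.dotProduct_mulVec]
  rw [h2] at h1
  linear_combination h1 / 2

end Span

/-! ### Covariance on phase space -/

section Rotate

variable {I : Type*}

/-- Time translation of a phase-space point. -/
def rotate (ω : I → ℝ) (t : ℝ) (ξ : I → ℂ) : I → ℂ := fun j => Complex.exp (t * (Complex.I * ω j)) * ξ j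

/-- The signed frequencies of the doubled coordinates. -/
def signedFreq (ω : I → ℝ) : I ⊕ I → ℝ := Sum.elim ω fun j => -ω j

/-- The matrix of time translation in doubled coordinates. -/
def phaseMat [DecidableEq I] (ω : I → ℝ) (t : ℝ) : Matrix (I ⊕ I) (I ⊕ I) ℂ :=
  Matrix.diagonal fun a => Complex.exp (t * (Complex.I * signedFreq ω a))

theorem phaseMat_isDoubled [DecidableEq I] (ω : I → ℝ) (t : ℝ) : IsDoubled (phaseMat ω t) := by
  intro a b
  by_cases h : a = b
  · subst h
    rw [phaseMat, Matrix.diagonal_apply_eq, Matrix.diagonal_apply_eq, ← Complex.exp_conj]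
    rcases a with a | a <;> simp [signedFreq]
  · rw [phaseMat, Matrix.diagonal_apply_ne _ h, map_zero,
      Matrix.diagonal_apply_ne _ fun h' => h (Sum.swap_leftInverse.injective h')]

theorem conjTranspose_phaseMat [DecidableEq I] (ω : I → ℝ) (t : ℝ) :
    (phaseMat ω t)ᴴ = phaseMat ω (-t) := by
  rw [phaseMat, Matrix.diagonal_conjTranspose, phaseMat]
  congr 1
  funext a
  rw [Pi.star_apply, Complex.star_def, ← Complex.exp_conj]
  simp

variable [Fintype I]

/-- Cyclicity moves the evolution onto the displacement operator, where it rotates each ξ j. -/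
theorem charFun_evolveOp (ω : I → ℝ) (t : ℝ) (A : Op I) (ξ : I → ℂ) :
    charFun (evolveOp ω t A) ξ = charFun A (rotate ω t ξ) := by
  have h : ∀ n m : I → ℕ, disp (rotate ω t ξ) m n =
      Complex.exp (Complex.I * energy ω m * t) * Complex.exp (-(Complex.I * energy ω n * t)) *
        disp ξ m n := by
    intro n m
    have h1 : ∀ k : I → ℕ, Complex.exp (Complex.I * energy ω k * t) =
        ∏ j, Complex.exp (t * (Complex.I * ω j)) ^ k j := by
      intro k
      simp only [← Complex.exp_nat_mul, ← Complex.exp_sum, energy]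
      congr 1
      push_cast
      rw [Finset.mul_sum, Finset.sum_mul]
      exact Finset.sum_congr rfl fun j _ => by ring
    rw [← conj_phase, h1, h1, map_prod, disp, disp, ← Finset.prod_mul_distrib,
      ← Finset.prod_mul_distrib]
    refine Finset.prod_congr rfl fun j _ => ?_
    have hc := conj_exp_mul_exp (t * ω j)
    have he : Complex.I * ((t * ω j : ℝ) : ℂ) = t * (Complex.I * ω j) := by
      push_cast
      ring
    rw [he] at hc
    rw [rotate, dispEntry_rotate hc, map_pow]
  refine tsum_congr fun n => tsum_congr fun m => ?_
  rw [h, evolveOp_apply]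
  ring

theorem dbl_rotate [DecidableEq I] (ω : I → ℝ) (t : ℝ) (ξ : I → ℂ) :
    dbl (rotate ω t ξ) = phaseMat ω t *ᵥ dbl ξ := by
  funext a
  rw [phaseMat, Matrix.mulVec_diagonal]
  rcases a with j | j
  · simp [dbl, rotate, signedFreq]
  · simp [dbl, rotate, signedFreq, ← Complex.exp_conj]

/-- The characteristic functions of trace-class operators separate phase-space points, even up to
a common factor. -/
theorem eq_and_eq_of_charFun_mul_eq {η η' : I → ℂ} {a b : ℂ} (ha : a ≠ 0)
    (h : ∀ A ∈ traceClass I, charFun A η * a = charFun A η' * b) : η = η' ∧ a = b := by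
  classical
  have hne : ∀ ξ : I → ℂ, disp ξ 0 0 ≠ 0 := fun ξ => by
    rw [disp_zero_zero]
    exact Finset.prod_ne_zero_iff.2 fun j _ => by exact_mod_cast (Real.exp_pos _).ne'
  -- The vacuum probe compares the two Gaussian prefactors times a and b; the probe |0⟩⟨1_j|
  -- multiplies each side by its j-th coordinate, so dividing gives η j = η' j.
  have h0 := h _ (ketBra_mem_traceClass 0 0)
  rw [charFun_ketBra, charFun_ketBra] at h0
  have h1 : ∀ (ξ : I → ℂ) (j : I), disp ξ (Pi.single j 1) 0 = ξ j * disp ξ 0 0 := by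
    intro ξ j
    have hother : ∀ i ∈ Finset.univ.erase j, dispEntry (ξ i) ((Pi.single j 1 : I → ℕ) i) ((0 : I → ℕ) i) =
        dispEntry (ξ i) ((0 : I → ℕ) i) ((0 : I → ℕ) i) := fun i hi => by
      rw [Pi.single_eq_of_ne (Finset.ne_of_mem_erase hi)]
      rfl
    rw [disp, disp, ← Finset.mul_prod_erase _ _ (Finset.mem_univ j), Finset.prod_congr rfl hother,
      ← Finset.mul_prod_erase Finset.univ (fun i => dispEntry (ξ i) ((0 : I → ℕ) i) _)
        (Finset.mem_univ j), Pi.single_eq_same, Pi.zero_apply, dispEntry_zero_right,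
      dispEntry_zero_right]
    simp
    ring
  have heq : η = η' := by
    funext j
    have hj := h _ (ketBra_mem_traceClass 0 (Pi.single j 1))
    rw [charFun_ketBra, charFun_ketBra, h1, h1] at hj
    have : η j * (disp η 0 0 * a) = η' j * (disp η 0 0 * a) := by
      rw [← mul_assoc, hj, h0, mul_assoc]
    exact mul_right_cancel₀ (mul_ne_zero (hne η) ha) this
  refine ⟨heq, ?_⟩
  subst heq
  exact mul_left_cancel₀ (hne η) h0

end Rotate

theorem eq_of_phase_eq {x y : ℝ}
    (h : ∀ t : ℝ, Complex.exp (t * (Complex.I * x)) = Complex.exp (t * (Complex.I * y))) :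
    x = y := by
  have := mul_left_cancel₀ Complex.I_ne_zero (eq_of_exp_mul_eq h)
  exact_mod_cast this

/-! ### The structure of Gaussian covariant operations -/

section Structure

variable {I O : Type*} [Fintype I] [DecidableEq I] [Fintype O] [DecidableEq O]
  {ωI : I → ℝ} {ωO : O → ℝ} {E : Channel I O} {X : Matrix (O ⊕ O) (I ⊕ I) ℂ}
  {Y : Matrix (O ⊕ O) (O ⊕ O) ℂ} {d : O ⊕ O → ℂ}

/-- Both sides of the covariance identity are evaluated on characteristic functions, for every input
at once, and then separated by `eq_and_eq_of_charFun_mul_eq`. -/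
theorem rotate_pullback_and_gaussFun (h : E.HasTuple X Y d)
    (hc : ∀ t : ℝ, E.toLin ∘ₗ evolve ωI t = evolve ωO t ∘ₗ E.toLin) (t : ℝ) (ξ : O → ℂ) :
    rotate ωI t (pullback X ξ) = pullback X (rotate ωO t ξ) ∧
      gaussFun d Y ξ = gaussFun d Y (rotate ωO t ξ) := by
  refine eq_and_eq_of_charFun_mul_eq (Complex.exp_ne_zero _) fun A hA => ?_
  have h1 := congrArg (fun B : traceClass O => charFun (B : Op O) ξ)
    (LinearMap.congr_fun (hc t) ⟨A, hA⟩)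
  have h2 : charFun (E.toLin (evolve ωI t ⟨A, hA⟩) : Op O) ξ =
      charFun (evolveOp ωO t (E.toLin ⟨A, hA⟩ : Op O)) ξ := h1
  rw [h.charFun_eq, charFun_evolveOp, h.charFun_eq] at h2
  rw [← charFun_evolveOp]
  exact h2

/-- X† intertwines two diagonal matrices of phases, so a nonzero entry forces its two phases to
agree at all times. -/
theorem signedFreq_eq_of_X_ne_zero (h : E.HasTuple X Y d)
    (hc : ∀ t : ℝ, E.toLin ∘ₗ evolve ωI t = evolve ωO t ∘ₗ E.toLin) {a : O ⊕ O} {b : I ⊕ I}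
    (hab : X a b ≠ 0) : signedFreq ωO a = signedFreq ωI b := by
  refine eq_of_phase_eq fun t => ?_
  have hN : Xᴴ * phaseMat ωO t - phaseMat ωI t * Xᴴ = 0 := eq_zero_of_mulVec_dbl fun ξ => by
    have h1 := congrArg dbl (rotate_pullback_and_gaussFun h hc t ξ).1
    rw [dbl_rotate, dbl_pullback h.doubled_X, dbl_pullback h.doubled_X, dbl_rotate,
      Matrix.mulVec_mulVec, Matrix.mulVec_mulVec] at h1
    rw [Matrix.sub_mulVec, h1, sub_self]
  have h2 := congrFun (congrFun hN b) a
  rw [Matrix.sub_apply, phaseMat, Matrix.mul_diagonal, phaseMat, Matrix.diagonal_mul,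
    Matrix.conjTranspose_apply, Matrix.zero_apply, mul_comm, ← sub_mul] at h2
  exact sub_eq_zero.1 ((mul_eq_zero.1 h2).resolve_right (star_ne_zero.2 hab))

/-- Scaling ξ by a real s commutes with rotation and separates the linear from the quadratic part of
the exponent. -/
theorem rotate_linear_and_quadratic (h : E.HasTuple X Y d)
    (hc : ∀ t : ℝ, E.toLin ∘ₗ evolve ωI t = evolve ωO t ∘ₗ E.toLin) (t : ℝ) (ξ : O → ℂ) :
    star (dbl ξ) ⬝ᵥ d = star (dbl (rotate ωO t ξ)) ⬝ᵥ d ∧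
      star (dbl ξ) ⬝ᵥ Y *ᵥ dbl ξ =
        star (dbl (rotate ωO t ξ)) ⬝ᵥ Y *ᵥ dbl (rotate ωO t ξ) := by
  have hscale : ∀ (s : ℝ) (η : O → ℂ), gaussFun d Y ((s : ℂ) • η) =
      Complex.exp (s * (star (dbl η) ⬝ᵥ d) +
        s ^ 2 * (-(1 / 2) * (star (dbl η) ⬝ᵥ Y *ᵥ dbl η))) := by
    intro s η
    have hd : dbl ((s : ℂ) • η) = (s : ℂ) • dbl η := by
      funext a
      rcases a with a | a <;> simp [dbl]
    rw [gaussFun, hd, star_smul, Matrix.mulVec_smul, smul_dotProduct, smul_dotProduct,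
      dotProduct_smul, Complex.star_def, Complex.conj_ofReal]
    simp only [smul_eq_mul]
    congr 1
    ring
  have hrot : ∀ s : ℝ, rotate ωO t ((s : ℂ) • ξ) = (s : ℂ) • rotate ωO t ξ := by
    intro s
    funext j
    simp only [rotate, Pi.smul_apply, smul_eq_mul]
    ring
  have h1 := eq_and_eq_of_exp_quadratic_eq fun s : ℝ =>
    (hscale s ξ).symm.trans ((rotate_pullback_and_gaussFun h hc t ((s : ℂ) • ξ)).2.trans
      ((congrArg _ (hrot s)).trans (hscale s (rotate ωO t ξ))))
  exact ⟨h1.1, mul_left_cancel₀ (by norm_num) h1.2⟩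

/-- A rotation-invariant vector is supported on signed frequency zero, and positive frequencies
leave no such coordinate. -/
theorem displacement_eq_zero (hO : ∀ o, 0 < ωO o) (h : E.HasTuple X Y d)
    (hc : ∀ t : ℝ, E.toLin ∘ₗ evolve ωI t = evolve ωO t ∘ₗ E.toLin) : d = 0 := by
  funext a
  by_contra hne
  have h0 : signedFreq ωO a = 0 := by
    refine (eq_of_phase_eq fun t => ?_).symm
    have h1 : phaseMat ωO t *ᵥ d - d = 0 := eq_zero_of_star_dbl_dotProduct fun ξ => by
      have h2 := (rotate_linear_and_quadratic h hc (-t) ξ).1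
      rw [dbl_rotate, Matrix.star_mulVec, conjTranspose_phaseMat, neg_neg,
        ← Matrix.dotProduct_mulVec] at h2
      rw [dotProduct_sub, ← h2, sub_self]
    have h3 := congrFun h1 a
    rw [Pi.sub_apply, phaseMat, Matrix.mulVec_diagonal, Pi.zero_apply] at h3
    have h4 : Complex.exp (t * (Complex.I * signedFreq ωO a)) = 1 :=
      mul_right_cancel₀ hne (by rw [one_mul]; exact sub_eq_zero.1 h3)
    rw [h4]
    simp
  rcases a with o | o
  · exact (hO o).ne' h0
  · exact (hO o).ne' (neg_eq_zero.1 h0)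

theorem signedFreq_eq_of_Y_ne_zero (h : E.HasTuple X Y d)
    (hc : ∀ t : ℝ, E.toLin ∘ₗ evolve ωI t = evolve ωO t ∘ₗ E.toLin) {a b : O ⊕ O}
    (hab : Y a b ≠ 0) : signedFreq ωO a = signedFreq ωO b := by
  refine eq_of_phase_eq fun t => ?_
  have hN : (phaseMat ωO t)ᴴ * Y * phaseMat ωO t - Y = 0 := by
    refine eq_zero_of_quadratic_dbl ?_ ?_ fun ξ => ?_
    · exact (((phaseMat_isDoubled ωO t).conjTranspose.mul h.doubled_Y).mul
        (phaseMat_isDoubled ωO t)).sub h.doubled_Y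
    · exact (Matrix.isHermitian_conjTranspose_mul_mul _ h.hermitian_Y).sub h.hermitian_Y
    · have h2 := (rotate_linear_and_quadratic h hc t ξ).2
      rw [dbl_rotate, Matrix.star_mulVec, ← Matrix.dotProduct_mulVec, Matrix.mulVec_mulVec,
        Matrix.mulVec_mulVec] at h2
      rw [Matrix.sub_mulVec, dotProduct_sub, ← h2, sub_self]
  have h3 := congrFun (congrFun hN a) b
  rw [conjTranspose_phaseMat, Matrix.sub_apply, phaseMat, phaseMat, Matrix.mul_diagonal,
    Matrix.diagonal_mul, Matrix.zero_apply] at h3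
  have h4 : Complex.exp (t * (Complex.I * signedFreq ωO a)) *
      Complex.exp ((-t : ℝ) * (Complex.I * signedFreq ωO a)) = 1 := by
    rw [← Complex.exp_add]
    simp
  refine mul_left_cancel₀ hab ?_
  linear_combination -(Complex.exp (t * (Complex.I * signedFreq ωO a))) * h3 +
    Y a b * Complex.exp (t * (Complex.I * signedFreq ωO b)) * h4

end Structure

end Bosonic
end

noncomputable section
namespace Bosonic

/-! ### Frequency blocks, compressed channels and prepared states -/

section Structure

variable {I O : Type*} [Fintype I] [DecidableEq I] [Fintype O] [DecidableEq O]
  {ωI : I → ℝ} {ωO : O → ℝ} {E : Channel I O} {X : Matrix (O ⊕ O) (I ⊕ I) ℂ}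
  {Y : Matrix (O ⊕ O) (O ⊕ O) ℂ} {d : O ⊕ O → ℂ}

/-- Positivity of the frequencies rules out matching an annihilation coordinate with a creation
coordinate. -/
theorem freq_eq_of_signedFreq_eq (hI : ∀ i, 0 < ωI i) (hO : ∀ o, 0 < ωO o) {a : O ⊕ O}
    {b : I ⊕ I} (h : signedFreq ωO a = signedFreq ωI b) :
    Sum.elim ωO ωO a = Sum.elim ωI ωI b := by
  rcases a with o | o <;> rcases b with i | i <;> simp only [signedFreq, Sum.elim_inl, Sum.elim_inr] at h ⊢
  · exact h
  · linarith [hI i, hO o]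
  · linarith [hI i, hO o]
  · linarith

/-- The pullback of a covariant Gaussian channel respects the frequency sectors. -/
theorem pullback_congr (hI : ∀ i, 0 < ωI i) (hO : ∀ o, 0 < ωO o) (h : E.HasTuple X Y d)
    (hc : ∀ t : ℝ, E.toLin ∘ₗ evolve ωI t = evolve ωO t ∘ₗ E.toLin) {ξ η : O → ℂ} {j : I}
    (hξ : ∀ o, ωO o = ωI j → ξ o = η o) : pullback X ξ j = pullback X η j := by
  rw [pullback, pullback, Matrix.mulVec, Matrix.mulVec, dotProduct, dotProduct]
  congr 1
  refine Finset.sum_congr rfl fun a _ => ?_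
  rw [Matrix.conjTranspose_apply]
  by_cases hX : X a (Sum.inl j) = 0
  · simp [hX]
  · have hf := freq_eq_of_signedFreq_eq hI hO (signedFreq_eq_of_X_ne_zero h hc hX)
    rcases a with o | o
    · simp only [dbl, Sum.elim_inl, hξ o hf]
    · simp only [dbl, Sum.elim_inr, hξ o hf]

theorem pullback_zero (X : Matrix (O ⊕ O) (I ⊕ I) ℂ) : pullback X 0 = 0 := by
  funext j
  have : dbl (0 : O → ℂ) = 0 := by
    funext a
    rcases a with a | a <;> simp [dbl]
  simp [pullback, this]

/-- The Gaussian factor of a covariant Gaussian channel factorizes over the frequency sectors. -/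
theorem gaussFun_eq_prod (hO : ∀ o, 0 < ωO o) (h : E.HasTuple X Y d)
    (hc : ∀ t : ℝ, E.toLin ∘ₗ evolve ωI t = evolve ωO t ∘ₗ E.toLin) (S : Finset ℝ) {ξ : O → ℂ}
    (hξ : ∀ o, ωO o ∉ S → ξ o = 0) :
    gaussFun d Y ξ = ∏ w ∈ S, gaussFun d Y fun o => if ωO o = w then ξ o else 0 := by
  rw [displacement_eq_zero hO h hc]
  simp only [gaussFun, dotProduct_zero, zero_sub]
  rw [← Complex.exp_sum, Finset.sum_neg_distrib, ← Finset.mul_sum]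
  refine congrArg (fun z => Complex.exp (-(1 / 2 * z))) ?_
  simp only [dotProduct, Matrix.mulVec, Finset.mul_sum]
  rw [Finset.sum_comm (s := S)]
  refine Finset.sum_congr rfl fun a _ => ?_
  rw [Finset.sum_comm (s := S)]
  refine Finset.sum_congr rfl fun b _ => ?_
  have hmask : ∀ w a, dbl (fun o => if ωO o = w then ξ o else 0) a =
      if Sum.elim ωO ωO a = w then dbl ξ a else 0 := by
    intro w a
    rcases a with o | o
    · by_cases hw : ωO o = w <;> simp [dbl, hw]
    · by_cases hw : ωO o = w <;> simp [dbl, hw]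
  -- A nonzero Y a b joins two coordinates of one frequency: if it lies in S exactly one w keeps the
  -- term, and otherwise ξ vanishes there.
  by_cases hY : Y a b = 0
  · simp [hY]
  by_cases ha : Sum.elim ωO ωO a ∈ S
  · have hf := freq_eq_of_signedFreq_eq hO hO (signedFreq_eq_of_Y_ne_zero h hc hY)
    rw [Finset.sum_eq_single_of_mem _ ha]
    · simp only [Pi.star_apply, hmask, ← hf, if_true]
    · intro w _ hw
      simp [hmask, hw.symm]
  · have h0 : dbl ξ a = 0 := by
      rcases a with o | o <;> simp [dbl, hξ o ha]
    simp [hmask, h0]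

variable {P Q R T : Type*} [Fintype P] [DecidableEq P] [Fintype Q] [DecidableEq Q] [Fintype R]
  [DecidableEq R] [Fintype T] [DecidableEq T] (eI : P ⊕ Q ≃ I) (eO : R ⊕ T ≃ O)

/-- Restriction of a channel to some of the modes: put the other input modes into the vacuum, and
trace out the other output modes. -/
def Channel.reduce (E : Channel I O) : Channel P R :=
  (traceOut eO).comp (E.comp (appendState eI (vacuum Q)))

theorem reduce_isGCO (hE : IsGCO ωI ωO E) :
    IsGCO (leftPart eI ωI) (leftPart eO ωO) (E.reduce eI eO) :=
  (traceOut_isGCO eO ωO).comp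
    (hE.comp (appendState_isGCO eI ωI vacuum_isGaussian (vacuum_isSymmetric _)))

theorem charFun_vacuum_zero : charFun (vacuum I).toOp 0 = 1 := by
  have h : charFun (vacuum I).toOp 0 = disp (0 : I → ℂ) 0 0 := charFun_ketBra 0 0 0
  rw [h, disp_zero, if_pos rfl]

/-- By `hne` no discarded input mode shares a frequency with a kept output mode. The pulled-back
argument is therefore zero on the vacuum modes, which contribute the factor χ(0) = 1. -/
theorem charFun_reduce (hI : ∀ i, 0 < ωI i) (hO : ∀ o, 0 < ωO o) (h : E.HasTuple X Y d)
    (hc : ∀ t : ℝ, E.toLin ∘ₗ evolve ωI t = evolve ωO t ∘ₗ E.toLin)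
    (hne : ∀ q r, rightPart eI ωI q ≠ leftPart eO ωO r) (A : traceClass P) (ξ : R → ℂ) :
    charFun ((E.reduce eI eO).toLin A : Op R) ξ =
      charFun (A : Op P) (leftPart eI (pullback X (glue eO ξ 0))) *
        gaussFun d Y (glue eO ξ 0) := by
  have h1 : charFun ((E.reduce eI eO).toLin A : Op R) ξ =
      charFun (E.toLin ((appendState eI (vacuum Q)).toLin A) : Op O) (glue eO ξ 0) :=
    charFun_traceOutOp eO (E.toLin ((appendState eI (vacuum Q)).toLin A)).2 ξ
  rw [h1, h.charFun_eq, appendState_apply,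
    charFun_tensorOp eI A.2 (vacuum Q).mem_traceClass]
  have h2 : rightPart eI (pullback X (glue eO ξ 0)) = 0 := by
    funext q
    have h3 := pullback_congr hI hO h hc (ξ := glue eO ξ 0) (η := 0) (j := eI (Sum.inr q))
      fun o ho => by
        obtain ⟨r | t, rfl⟩ := eO.surjective o
        · exact absurd ho.symm (hne q r)
        · rw [glue_inr]
          rfl
    rw [pullback_zero] at h3
    exact h3
  rw [h2, charFun_vacuum_zero, mul_one]

/-- The state that the channel prepares, from the vacuum, on some of its output modes. -/
def Channel.prepared (E : Channel I O) : DensityOp R := (traceOut eO).mapState (E.mapState (vacuum I))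

/-- Output modes whose frequency is absent from the input pull back to 0, so only the Gaussian
factor remains. The same would happen for any other input state, since χ(0) = 1. -/
theorem charFun_prepared (hI : ∀ i, 0 < ωI i) (hO : ∀ o, 0 < ωO o) (h : E.HasTuple X Y d)
    (hc : ∀ t : ℝ, E.toLin ∘ₗ evolve ωI t = evolve ωO t ∘ₗ E.toLin)
    (hne : ∀ i r, ωI i ≠ leftPart eO ωO r) (ξ : R → ℂ) :
    charFun (E.prepared eO).toOp ξ = gaussFun d Y (glue eO ξ 0) := by
  have h1 : charFun (E.prepared eO).toOp ξ =
      charFun (E.mapState (vacuum I)).toOp (glue eO ξ 0) :=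
    charFun_traceOutOp eO (E.mapState (vacuum I)).mem_traceClass ξ
  have h2 := h.charFun_eq ⟨(vacuum I).toOp, (vacuum I).mem_traceClass⟩ (glue eO ξ 0)
  have h3 : pullback X (glue eO ξ 0) = 0 := by
    funext i
    have h3 := pullback_congr hI hO h hc (ξ := glue eO ξ 0) (η := 0) (j := i)
      fun o ho => by
        obtain ⟨r | t, rfl⟩ := eO.surjective o
        · exact absurd ho.symm (hne i r)
        · rw [glue_inr]
          rfl
    rw [h3, pullback_zero]
  rw [h3] at h2
  rw [h1]
  refine h2.trans ?_
  rw [charFun_vacuum_zero, one_mul]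

theorem prepared_isGaussian (hE : IsGCO ωI ωO E) : (E.prepared eO).IsGaussian :=
  Channel.IsGaussian.mapState (E := traceOut eO) ⟨_, _, _, traceOut_hasTuple eO⟩
    (hE.gaussian.mapState vacuum_isGaussian)

theorem prepared_isSymmetric (hE : IsGCO ωI ωO E) :
    (E.prepared eO).IsSymmetric (leftPart eO ωO) :=
  (traceOut_isGCO eO ωO).isSymmetric_mapState
    (hE.isSymmetric_mapState (vacuum_isSymmetric ωI))

end Structure

/-! ### The decomposition -/

theorem glue_sumCompl {J α : Type*} (p : J → Prop) [DecidablePred p] (a : {j // p j} → α)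
    (b : {j // ¬ p j} → α) :
    glue (Equiv.sumCompl p) a b = fun j => if h : p j then a ⟨j, h⟩ else b ⟨j, h⟩ := by
  funext j
  by_cases h : p j <;> simp [glue, h]

/-- Two complementary groups of modes. -/
def splitModes {J : Type*} (p q : J → Prop) [DecidablePred p] (h : ∀ j, q j ↔ ¬ p j) :
    {j // p j} ⊕ {j // q j} ≃ J :=
  ((Equiv.refl _).sumCongr (Equiv.subtypeEquivRight h)).trans (Equiv.sumCompl p)

section Decomposition

variable {I O : Type*} [Fintype I] [DecidableEq I] [Fintype O] [DecidableEq O]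

/-- The modes with frequency in `W`, and the others. -/
abbrev modesSplit (ω : I → ℝ) (W : Finset ℝ) : ModesIn ω W ⊕ {j : I // ¬ ω j ∈ W} ≃ I :=
  Equiv.sumCompl fun j => ω j ∈ W

/-- The modes of frequency `w`, and the others. -/
abbrev sectorSplit (ω : I → ℝ) (w : ℝ) : Sector ω w ⊕ {j : I // ¬ ω j = w} ≃ I :=
  Equiv.sumCompl fun j => ω j = w

theorem glue_modesSplit_mask (ω : I → ℝ) {W : Finset ℝ} (w : W) (ξ : ModesIn ω W → ℂ) :
    (fun j => if ω j = w then glue (modesSplit ω W) ξ 0 j else 0) =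
      glue (sectorSplit ω w) (sectorPart w ξ) 0 := by
  rw [glue_sumCompl, glue_sumCompl]
  funext j
  by_cases hj : ω j = w
  · have hjW : ω j ∈ W := hj ▸ w.2
    simp only [hj, if_true, dif_pos, w.2]
    rfl
  · simp [hj]

theorem glue_modesSplit_eq_zero (ω : I → ℝ) {W : Finset ℝ} (ξ : ModesIn ω W → ℂ) {j : I}
    (hj : ω j ∉ W) : glue (modesSplit ω W) ξ 0 j = 0 := by
  rw [glue_sumCompl]
  simp [hj]

variable {ωI : I → ℝ} {ωO : O → ℝ} {E : Channel I O} {X : Matrix (O ⊕ O) (I ⊕ I) ℂ}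
  {Y : Matrix (O ⊕ O) (O ⊕ O) ℂ} {d : O ⊕ O → ℂ}

theorem gaussFun_glue_eq_prod (hO : ∀ o, 0 < ωO o) (h : E.HasTuple X Y d)
    (hc : ∀ t : ℝ, E.toLin ∘ₗ evolve ωI t = evolve ωO t ∘ₗ E.toLin) {W : Finset ℝ}
    (ξ : ModesIn ωO W → ℂ) : gaussFun d Y (glue (modesSplit ωO W) ξ 0) =
      ∏ w : W, gaussFun d Y (glue (sectorSplit ωO w) (sectorPart w ξ) 0) := by
  rw [gaussFun_eq_prod hO h hc W fun o ho => glue_modesSplit_eq_zero ωO ξ ho,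
    ← Finset.prod_coe_sort]
  exact Finset.prod_congr rfl fun w _ => congrArg _ (glue_modesSplit_mask ωO w ξ)

theorem charFun_reduce_modes (hI : ∀ i, 0 < ωI i) (hO : ∀ o, 0 < ωO o) (h : E.HasTuple X Y d)
    (hc : ∀ t : ℝ, E.toLin ∘ₗ evolve ωI t = evolve ωO t ∘ₗ E.toLin) {W : Finset ℝ}
    (A : traceClass (ModesIn ωI W)) (ξ : ModesIn ωO W → ℂ) :
    charFun ((E.reduce (modesSplit ωI W) (modesSplit ωO W)).toLin A : Op (ModesIn ωO W)) ξ =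
      charFun (A : Op (ModesIn ωI W))
        (leftPart (modesSplit ωI W) (pullback X (glue (modesSplit ωO W) ξ 0))) *
        gaussFun d Y (glue (modesSplit ωO W) ξ 0) :=
  charFun_reduce _ _ hI hO h hc (fun q r hqr => q.2 (by
    have h' : ωI q.1 = ωO r.1 := hqr
    rw [h']
    exact r.2)) A ξ

theorem charFun_reduce_sector (hI : ∀ i, 0 < ωI i) (hO : ∀ o, 0 < ωO o) (h : E.HasTuple X Y d)
    (hc : ∀ t : ℝ, E.toLin ∘ₗ evolve ωI t = evolve ωO t ∘ₗ E.toLin) (w : ℝ)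
    (A : traceClass (Sector ωI w)) (ξ : Sector ωO w → ℂ) :
    charFun ((E.reduce (sectorSplit ωI w) (sectorSplit ωO w)).toLin A : Op (Sector ωO w)) ξ =
      charFun (A : Op (Sector ωI w))
        (leftPart (sectorSplit ωI w) (pullback X (glue (sectorSplit ωO w) ξ 0))) *
        gaussFun d Y (glue (sectorSplit ωO w) ξ 0) :=
  charFun_reduce _ _ hI hO h hc (fun q r hqr => q.2 (by
    have h' : ωI q.1 = ωO r.1 := hqr
    rw [h']
    exact r.2)) A ξ

/-- Both sides factor over W: the Gaussian factor by `gaussFun_glue_eq_prod`, and the argument of χ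
because the pullback at a mode of frequency w sees only the output sector w. -/
theorem reduce_isDirectSum (hI : ∀ i, 0 < ωI i) (hO : ∀ o, 0 < ωO o) (hE : IsGCO ωI ωO E)
    (W : Finset ℝ) : (E.reduce (modesSplit ωI W) (modesSplit ωO W)).IsDirectSum
      fun w : W => E.reduce (sectorSplit ωI w) (sectorSplit ωO w) := by
  obtain ⟨X, Y, d, h⟩ := hE.gaussian
  have hc := hE.covariant
  intro A
  refine ⟨⟨_, sectorProduct_mem fun w => (A w).2⟩, rfl, ?_⟩
  refine eq_of_charFun_eq (Subtype.property _) (sectorProduct_mem fun w => Subtype.property _)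
    fun ξ => ?_
  rw [charFun_sectorProduct fun w => Subtype.property _, charFun_reduce_modes hI hO h hc,
    charFun_sectorProduct fun w => (A w).2, gaussFun_glue_eq_prod hO h hc,
    ← Finset.prod_mul_distrib]
  refine Finset.prod_congr rfl fun w _ => ?_
  rw [charFun_reduce_sector hI hO h hc]
  refine congrArg (fun η => charFun (A w : Op (Sector ωI w)) η * _) ?_
  funext j
  refine pullback_congr hI hO h hc fun o ho => ?_
  have ho' : ωO o = w := Eq.trans ho j.2
  have hm := congrFun (glue_modesSplit_mask ωO w ξ) o
  simp only [ho', if_true] at hm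
  exact hm

theorem prepared_eq_sectorProduct (hI : ∀ i, 0 < ωI i) (hO : ∀ o, 0 < ωO o)
    (hE : IsGCO ωI ωO E) {V : Finset ℝ} (hV : ∀ w ∈ V, ∀ i, ωI i ≠ w) :
    (E.prepared (modesSplit ωO V)).toOp =
      sectorProduct ωO V fun w => (E.prepared (sectorSplit ωO w)).toOp := by
  obtain ⟨X, Y, d, h⟩ := hE.gaussian
  have hc := hE.covariant
  refine eq_of_charFun_eq (DensityOp.mem_traceClass _)
    (sectorProduct_mem fun w => DensityOp.mem_traceClass _) fun ξ => ?_
  rw [charFun_sectorProduct fun w => DensityOp.mem_traceClass _,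
    charFun_prepared _ hI hO h hc fun i r => hV _ r.2 i, gaussFun_glue_eq_prod hO h hc]
  refine Finset.prod_congr rfl fun w _ => ?_
  exact (charFun_prepared _ hI hO h hc (fun i r hir => hV w w.2 i (Eq.trans hir r.2)) _).symm

/-- The composite evaluates χ_A at the pullback of the W part of ξ, extended by zero, and multiplies
by the Gaussian factors of the W and V parts. Block diagonality identifies this with the action of
the channel. -/
theorem toLin_eq_comp (hI : ∀ i, 0 < ωI i) (hO : ∀ o, 0 < ωO o) (hE : IsGCO ωI ωO E)
    {W V : Finset ℝ} (hV : ∀ w ∈ V, ∀ i, ωI i ≠ w) (hVW : ∀ o, ωO o ∈ V ↔ ¬ ωO o ∈ W)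
    (hW : ∀ i o, ωO o = ωI i → ωI i ∈ W) :
    E.toLin = (appendState (splitModes (fun o => ωO o ∈ W) (fun o => ωO o ∈ V) hVW)
        (E.prepared (modesSplit ωO V))).toLin ∘ₗ
      (E.reduce (modesSplit ωI W) (modesSplit ωO W)).toLin ∘ₗ
      (traceOut (modesSplit ωI W)).toLin := by
  obtain ⟨X, Y, d, h⟩ := hE.gaussian
  have hc := hE.covariant
  set e₃ := splitModes (fun o => ωO o ∈ W) (fun o => ωO o ∈ V) hVW
  refine toLin_eq_of_charFun_eq fun A ξ => ?_
  rw [LinearMap.comp_apply, LinearMap.comp_apply, appendState_apply,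
    charFun_tensorOp e₃ (Subtype.property _) (DensityOp.mem_traceClass _),
    charFun_reduce_modes hI hO h hc, charFun_prepared _ hI hO h hc fun i r => hV _ r.2 i,
    traceOut_apply, charFun_traceOutOp _ A.2, h.charFun_eq, mul_assoc]
  have hglueW : glue (modesSplit ωO W) (leftPart e₃ ξ) 0 =
      fun o => if ωO o ∈ W then ξ o else 0 := by
    rw [glue_sumCompl]
    funext o
    by_cases ho : ωO o ∈ W
    · rw [dif_pos ho, if_pos ho]
      rfl
    · rw [dif_neg ho, if_neg ho]
      rfl
  have hglueV : glue (modesSplit ωO V) (rightPart e₃ ξ) 0 =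
      fun o => if ωO o ∈ V then ξ o else 0 := by
    rw [glue_sumCompl]
    funext o
    by_cases ho : ωO o ∈ V
    · rw [dif_pos ho, if_pos ho]
      rfl
    · rw [dif_neg ho, if_neg ho]
      rfl
  -- By `hW`, an input mode with frequency outside W matches no output mode, so its pulled-back
  -- coordinate is 0, which is exactly what tracing it out inserts.
  have hpull : pullback X ξ = glue (modesSplit ωI W)
      (leftPart (modesSplit ωI W) (pullback X fun o => if ωO o ∈ W then ξ o else 0)) 0 := by
    funext i
    rw [glue_sumCompl]
    beta_reduce
    by_cases hi : ωI i ∈ W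
    · rw [dif_pos hi]
      exact pullback_congr hI hO h hc fun o ho => (if_pos (ho ▸ hi)).symm
    · rw [dif_neg hi]
      refine (pullback_congr hI hO h hc fun o ho => absurd (hW i o ho) hi).trans
        (congrFun (pullback_zero X) i)
  -- W and V are complementary only on frequencies that occur in the output. Any other frequency
  -- masks ξ to 0 and contributes the factor 1, so all products may be restricted to occurring
  -- frequencies.
  have hgauss : gaussFun d Y ξ = gaussFun d Y (fun o => if ωO o ∈ W then ξ o else 0) *
      gaussFun d Y fun o => if ωO o ∈ V then ξ o else 0 := by
    have hmask : ∀ S : Finset ℝ, gaussFun d Y (fun o => if ωO o ∈ S then ξ o else 0) =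
        ∏ w ∈ S, gaussFun d Y fun o => if ωO o = w then ξ o else 0 := by
      intro S
      rw [gaussFun_eq_prod hO h hc S fun o ho => if_neg ho]
      refine Finset.prod_congr rfl fun w hw => congrArg _ (funext fun o => ?_)
      by_cases ho : ωO o = w
      · simp [ho, hw]
      · simp [ho]
    have hall : gaussFun d Y ξ = ∏ w ∈ Finset.univ.image ωO,
        gaussFun d Y fun o => if ωO o = w then ξ o else 0 :=
      gaussFun_eq_prod hO h hc _ fun o ho =>
        absurd (Finset.mem_image_of_mem _ (Finset.mem_univ o)) ho
    have hone : ∀ w, w ∉ Finset.univ.image ωO →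
        gaussFun d Y (fun o => if ωO o = w then ξ o else 0) = 1 := by
      intro w hw
      rw [← gaussFun_apply_zero d Y]
      refine congrArg _ (funext fun o => if_neg ?_)
      rintro rfl
      exact hw (Finset.mem_image_of_mem _ (Finset.mem_univ o))
    have hinter : ∀ S : Finset ℝ,
        ∏ w ∈ S, gaussFun d Y (fun o => if ωO o = w then ξ o else 0) =
        ∏ w ∈ (Finset.univ.image ωO).filter (· ∈ S),
          gaussFun d Y fun o => if ωO o = w then ξ o else 0 := by
      intro S
      refine (Finset.prod_subset (fun w hw => (Finset.mem_filter.1 hw).2) fun w hw hw' => ?_).symm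
      exact hone w fun hw'' => hw' (Finset.mem_filter.2 ⟨hw'', hw⟩)
    have hVeq : (Finset.univ.image ωO).filter (· ∈ V) =
        (Finset.univ.image ωO).filter (fun w => ¬ w ∈ W) := by
      refine Finset.filter_congr fun w hw => ?_
      obtain ⟨o, _, rfl⟩ := Finset.mem_image.1 hw
      exact hVW o
    rw [hmask, hmask, hall, hinter W, hinter V, hVeq, Finset.prod_filter_mul_prod_filter_not]
  rw [hglueW, hglueV, ← hpull, ← hgauss]

theorem traceOut_isPartialTrace (ω : I → ℝ) (W : Finset ℝ) :
    (traceOut (modesSplit ω W)).IsPartialTrace := by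
  intro A
  rw [traceOut_apply]
  ext n m
  simp only [traceOutOp, partialTrace, glue_sumCompl]

/-- Of the common and the new frequencies only three properties matter: V avoids the input, V and W
are complementary on the output, and W contains every shared frequency. -/
theorem exists_decomposition (hI : ∀ i, 0 < ωI i) (hO : ∀ o, 0 < ωO o) (hE : IsGCO ωI ωO E)
    (W V : Finset ℝ) (hV : ∀ w ∈ V, ∀ i, ωI i ≠ w) (hVW : ∀ o, ωO o ∈ V ↔ ¬ ωO o ∈ W)
    (hW : ∀ i o, ωO o = ωI i → ωI i ∈ W) :
    ∃ (E₁ : Channel I (ModesIn ωI W)) (E₂ : Channel (ModesIn ωI W) (ModesIn ωO W))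
      (E₃ : Channel (ModesIn ωO W) O) (F : ∀ w : W, Channel (Sector ωI w) (Sector ωO w))
      (σ : ∀ w : V, DensityOp (Sector ωO w)),
      IsGCO ωI (modesFreq ωI W) E₁ ∧ IsGCO (modesFreq ωI W) (modesFreq ωO W) E₂ ∧
      IsGCO (modesFreq ωO W) ωO E₃ ∧ E₁.IsPartialTrace ∧
      (∀ w : W, IsGCO (sectorFreq ωI w) (sectorFreq ωO w) (F w)) ∧ E₂.IsDirectSum F ∧
      (∀ w, (σ w).IsGaussian ∧ (σ w).IsSymmetric (sectorFreq ωO w)) ∧ E₃.Appends σ ∧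
      E.toLin = E₃.toLin ∘ₗ E₂.toLin ∘ₗ E₁.toLin := by
  have h1 : IsGCO ωI (modesFreq ωI W) (traceOut (modesSplit ωI W)) :=
    traceOut_isGCO (modesSplit ωI W) ωI
  have h2 : IsGCO (modesFreq ωI W) (modesFreq ωO W)
      (E.reduce (modesSplit ωI W) (modesSplit ωO W)) :=
    reduce_isGCO (modesSplit ωI W) (modesSplit ωO W) hE
  have h3 : IsGCO (modesFreq ωO W) ωO
      (appendState (splitModes (fun o => ωO o ∈ W) (fun o => ωO o ∈ V) hVW)
        (E.prepared (modesSplit ωO V))) :=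
    appendState_isGCO (splitModes (fun o => ωO o ∈ W) (fun o => ωO o ∈ V) hVW) ωO
      (prepared_isGaussian (modesSplit ωO V) hE) (prepared_isSymmetric (modesSplit ωO V) hE)
  have h5 : ∀ w : W, IsGCO (sectorFreq ωI w) (sectorFreq ωO w)
      (E.reduce (sectorSplit ωI w) (sectorSplit ωO w)) := fun w =>
    reduce_isGCO (sectorSplit ωI w) (sectorSplit ωO w) hE
  have h7 : ∀ w : V, (E.prepared (sectorSplit ωO w)).IsGaussian ∧
      (E.prepared (sectorSplit ωO w)).IsSymmetric (sectorFreq ωO w) := fun w =>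
    ⟨prepared_isGaussian (sectorSplit ωO w) hE, prepared_isSymmetric (sectorSplit ωO w) hE⟩
  have h8 : (appendState (splitModes (fun o => ωO o ∈ W) (fun o => ωO o ∈ V) hVW)
      (E.prepared (modesSplit ωO V))).Appends
        fun w : V => E.prepared (sectorSplit ωO w) := by
    intro A n m
    rw [appendState_apply, tensorOp, prepared_eq_sectorProduct hI hO hE hV]
    rfl
  exact ⟨traceOut (modesSplit ωI W), E.reduce (modesSplit ωI W) (modesSplit ωO W),
    appendState (splitModes (fun o => ωO o ∈ W) (fun o => ωO o ∈ V) hVW)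
      (E.prepared (modesSplit ωO V)),
    fun w => E.reduce (sectorSplit ωI w) (sectorSplit ωO w),
    fun w => E.prepared (sectorSplit ωO w), h1, h2, h3, traceOut_isPartialTrace ωI W, h5,
    reduce_isDirectSum hI hO hE W, h7, h8, toLin_eq_comp hI hO hE hV hVW hW⟩

end Decomposition

end Bosonic
end

theorem propositionS1 {I O : Type*} [Fintype I] [DecidableEq I] [Fintype O] [DecidableEq O]
    (ωI : I → ℝ) (ωO : O → ℝ) (hI : ∀ i, 0 < ωI i) (hO : ∀ o, 0 < ωO o)
    (E : Channel I O) (hE : IsGCO ωI ωO E) :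
    ∃ (E₁ : Channel I (ModesIn ωI (commonFreq ωI ωO)))
      (E₂ : Channel (ModesIn ωI (commonFreq ωI ωO)) (ModesIn ωO (commonFreq ωI ωO)))
      (E₃ : Channel (ModesIn ωO (commonFreq ωI ωO)) O)
      (F : ∀ w : commonFreq ωI ωO, Channel (Sector ωI w) (Sector ωO w))
      (σ : ∀ w : newFreq ωI ωO, DensityOp (Sector ωO w)),
      -- the three steps are GCOs
      IsGCO ωI (modesFreq ωI (commonFreq ωI ωO)) E₁ ∧
      IsGCO (modesFreq ωI (commonFreq ωI ωO)) (modesFreq ωO (commonFreq ωI ωO)) E₂ ∧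
      IsGCO (modesFreq ωO (commonFreq ωI ωO)) ωO E₃ ∧
      -- step 1 traces out the input modes without a matching output
      E₁.IsPartialTrace ∧
      -- step 2 is a direct sum of GCOs, one for each common frequency
      (∀ w : commonFreq ωI ωO, IsGCO (sectorFreq ωI w) (sectorFreq ωO w) (F w)) ∧
      E₂.IsDirectSum F ∧
      -- step 3 appends fixed symmetric (Gaussian) states on the output modes without a matching input
      (∀ w, (σ w).IsGaussian ∧ (σ w).IsSymmetric (sectorFreq ωO w)) ∧
      E₃.Appends σ ∧
      -- the given operation is the concatenation of the three steps
      E.toLin = E₃.toLin ∘ₗ E₂.toLin ∘ₗ E₁.toLin := by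
  refine exists_decomposition hI hO hE (commonFreq ωI ωO) (newFreq ωI ωO) ?_ ?_ ?_
  · rintro w hw i rfl
    exact (Finset.mem_sdiff.1 hw).2 (Finset.mem_image_of_mem _ (Finset.mem_univ i))
  · intro o
    simp [newFreq, commonFreq]
  · exact fun i o hio => Finset.mem_inter.2 ⟨Finset.mem_image_of_mem _ (Finset.mem_univ i),
      hio ▸ Finset.mem_image_of_mem _ (Finset.mem_univ o)⟩
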